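/- Let $\mathcal R_1,\dots,\mathcal R_u\in\mathbf C[b_1,\dots,b_r,q_1,\dots,q_r]$, $R_i=\mathcal R_i|_{q=0}$, $H=\mathbf C[b]/(R_1,\dots,R_u)$ and $QH=\mathbf C[b,q]/(\mathcal R_1,\dots,\mathcal R_u)$ (for instance $H=H^\ast(G/B)$ and $QH=QH^\ast(G/B)$ in their usual presentations). Write $[c]$ and $[[c]]$ for the elements of $QH$ and of $H\otimes\mathbf C[q]$ given by $c\in\mathbf C[b,q]$. Let $\partial_i=\partial/\partial t_i=q_i\partial/\partial q_i$ with $q_i=e^{t_i}$, and let $D^h$ be the algebra of differential operators generated by $h\partial_1,\dots,h\partial_r$ over $\mathbf C[q,h]$. For $D\in D^h$, let $S(D)\in\mathbf C[b,q,h]$ be the result of replacing $h\partial_i$ by $b_i$ in $D$ (coefficients written on the left). Let $M^h=D^h/(D^h_1,\dots,D^h_u)$ (quotient by a left ideal) be a quantization of $QH$: $M^h$ is free over $\mathbf C[q,h]$ of rank $s+1=\dim H$, and $\lim_{h\to0}S(D^h_i)=\mathcal R_i$ for all $i$. Let $P_0,\dots,P_s$ be monomials in $h\partial_1,\dots,h\partial_r$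 whose classes form a basis of $M^h$, put $c_j=S(P_j)$, and let $\Omega^h=\sum_i\Omega^h_i\,dt_i$, where $[h\partial_iP_j]=\sum_k(h\Omega^h_i)_{kj}[P_k]$. **Theorem 1.2.** $[c_0],\dots,[c_s]$ is a basis of the $\mathbf C[q]$-module $QH$. Let $\omega_i$ be the matrix of multiplication by $[b_i]$ in this basis, $[b_ic_j]=\sum_k(\omega_i)_{kj}[c_k]$, and $\omega=\sum_i\omega_i\,dt_i$. (a) Let $U\subseteq\mathbf C^r$ be open, let $L$ be a holomorphic map from $U$ to the smooth loop group of $GL_{s+1}\mathbf C$ ($|h|=1$) with $L^{-1}dL=\Omega^h$, and let $L=L_-L_+$ be a Birkhoff factorization on $U$, with factors holomorphic in $t$, $L_-=I+h^{-1}A_1+h^{-2}A_2+\cdots$ and $L_+=B_0+hB_1+h^2B_2+\cdots$. Put $\hat\omega=B_0\omega B_0^{-1}=\sum_i\hat\omega_i\,dt_i$. Then $L_-^{-1}dL_-=\hat\Omega^h$ with $\hat\Omega^h=h^{-1}\hat\omega$, the connection $d+h^{-1}\hat\omega$ is flat on $U$ for every $h\ne0$, and $\partial_i\hat\omega_j=\partial_j\hat\omega_i$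 on $U$ for all $i,j$. (b) Suppose moreover that each $S(D^h_i)$ is homogeneous with respect to $\deg b_i=2$, $\deg q_i=4$, $\deg h=2$, and that $S(D^h_i)|_{q=0}=R_i$. Then there is exactly one matrix $L_+$ with entries in $\mathbf C[q,h]$ such that $L_+|_{q=0}=I$ and such that, for some $L$ and $L_-$ as in (a) on some non-empty open set, $L=L_-L_+$ is a Birkhoff factorization; $L_+$ is invertible over $\mathbf C[q,h]$ and the factorization exists on all of $\mathbf C^r$. Let $B_0=L_+|_{h=0}$ and $\hat c_j=\sum_k(B_0^{-1})_{kj}c_k$. Then $[\hat c_0],\dots,[\hat c_s]$ is a basis of the $\mathbf C[q]$-module $QH$, and the $\mathbf C[q]$-linear map $\hat\delta:QH\to H\otimes\mathbf C[q]$ with $\hat\delta[\hat c_j]=[[\hat c_j|_{q=0}]]$ is a quantum evaluation map, that is: it is an isomorphism of $\mathbf C[q]$-modules; $\hat\delta[1]=[[1]]$ and $\hat\delta[b_i]=[[b_i]]$; it preserves the degrees of homogeneous elements; and $(\hat\delta[c])|_{q=0}=[[c|_{q=0}]]$ for every $c\in\mathbf C[b,q]$. The matrix $\hat\omega_i$ of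 multiplication by $[b_i]$ with respect to $[\hat c_0],\dots,[\hat c_s]$ is $\hat\omega_i=B_0\omega_iB_0^{-1}$, and $\hat\delta$ satisfies the integrability condition $$q_i\frac{\partial}{\partial q_i}\hat\omega_j=q_j\frac{\partial}{\partial q_j}\hat\omega_i\qquad(1\le i,j\le r).$$ -/

import Mathlib

open scoped TensorProduct ContDiff

noncomputable section

namespace QuantumDModule

/-! ### Polynomial rings -/

/-- The ring `ℂ[q₁, …, q_r]`. -/
abbrev QRing (r : ℕ) : Type := MvPolynomial (Fin r) ℂ

/-- The ring `ℂ[q₁, …, q_r, h]`, realised as `ℂ[h][q₁, …, q_r]`. -/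
abbrev QHRing (r : ℕ) : Type := MvPolynomial (Fin r) (Polynomial ℂ)

/-- The ring `ℂ[b₁, …, b_r, q₁, …, q_r]`, realised as `ℂ[q][b]`. -/
abbrev BQRing (r : ℕ) : Type := MvPolynomial (Fin r) (QRing r)

/-- The ring `ℂ[b₁, …, b_r, q₁, …, q_r, h]`, realised as `ℂ[q, h][b]`. -/
abbrev BQHRing (r : ℕ) : Type := MvPolynomial (Fin r) (QHRing r)

/-- The element `h` of `ℂ[q, h]`. -/
def hVar (r : ℕ) : QHRing r := MvPolynomial.C Polynomial.X

/-- `ℂ[q, h] → ℂ[q]`, `h ↦ 0`. -/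
def hZero (r : ℕ) : QHRing r →+* QRing r :=
  MvPolynomial.map (Polynomial.evalRingHom (0 : ℂ))

/-- `ℂ[q, h] → ℂ[h]`, `q ↦ 0`. -/
def qZeroH (r : ℕ) : QHRing r →+* Polynomial ℂ := MvPolynomial.constantCoeff

/-- `ℂ[b, q] → ℂ[b]`, `q ↦ 0`. -/
def qZero (r : ℕ) : BQRing r →+* MvPolynomial (Fin r) ℂ :=
  MvPolynomial.map MvPolynomial.constantCoeff

/-- `ℂ[b, q, h] → ℂ[b, q]`, `h ↦ 0`. -/
def symbolHZero (r : ℕ) : BQHRing r →+* BQRing r := MvPolynomial.map (hZero r)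

/-- `ℂ[b, q, h] → ℂ[b, h]`, `q ↦ 0`. -/
def symbolQZero (r : ℕ) : BQHRing r →+* MvPolynomial (Fin r) (Polynomial ℂ) :=
  MvPolynomial.map (qZeroH r)

/-- `c ∈ ℂ[b, q]` is homogeneous of degree `n`, where `deg bᵢ = 2` and `deg qᵢ = 4`. -/
def IsHomog {r : ℕ} (c : BQRing r) (n : ℕ) : Prop :=
  ∀ α d : Fin r →₀ ℕ, (c.coeff α).coeff d ≠ 0 → 2 * α.degree + 4 * d.degree = n

/-- `σ ∈ ℂ[b, q, h]` is homogeneous of degree `n`, where `deg bᵢ = 2`, `deg qᵢ = 4`, `deg h = 2`. -/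
def IsHomogH {r : ℕ} (σ : BQHRing r) (n : ℕ) : Prop :=
  ∀ (α d : Fin r →₀ ℕ) (k : ℕ),
    ((σ.coeff α).coeff d).coeff k ≠ 0 → 2 * α.degree + 4 * d.degree + 2 * k = n

/-! ### The algebra of differential operators `D^h` -/

/-- Multiplication by `f` as an operator on `ℂ[q, h]`. -/
def mulEnd (r : ℕ) : QHRing r →+* Module.End ℂ (QHRing r) :=
  (Algebra.lmul ℂ (QHRing r)).toRingHom

/-- The operator `h ∂ᵢ = h qᵢ ∂/∂qᵢ` on `ℂ[q, h]`. -/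
def hPartial {r : ℕ} (i : Fin r) : Module.End ℂ (QHRing r) :=
  mulEnd r (hVar r * MvPolynomial.X i) * (MvPolynomial.pderiv i).toLinearMap.restrictScalars ℂ

/-- The algebra `D^h` of differential operators generated by `h ∂₁, …, h ∂_r` with coefficients
in `ℂ[q, h]`, as an algebra of operators on `ℂ[q, h]`, on which it acts faithfully. -/
def Dh (r : ℕ) : Subring (Module.End ℂ (QHRing r)) :=
  Subring.closure (Set.range (mulEnd r) ∪ Set.range hPartial)

/-- A polynomial in `q, h` as a multiplication operator in `D^h`. -/
def mulOp (r : ℕ) : QHRing r →+* Dh r :=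
  (mulEnd r).codRestrict (Dh r) fun f => Subring.subset_closure (Or.inl ⟨f, rfl⟩)

/-- `h ∂ᵢ` as an element of `D^h`. -/
def hd {r : ℕ} (i : Fin r) : Dh r := ⟨hPartial i, Subring.subset_closure (Or.inr ⟨i, rfl⟩)⟩

/-- `(h ∂)^α = (h ∂₁)^{α₁} ⋯ (h ∂_r)^{α_r}`. -/
def hdMonomial {r : ℕ} (α : Fin r →₀ ℕ) : Dh r :=
  ((List.finRange r).map fun i => hd i ^ α i).prod

/-- The operator `∑ f_α(q, h) (h ∂)^α` with symbol `σ = ∑ f_α(q, h) b^α`. Every element of `D^h`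
is `op σ` for exactly one `σ`, the result `S(op σ) = σ` of replacing `h ∂ᵢ` by `bᵢ` in it. -/
def op {r : ℕ} (σ : BQHRing r) : Dh r :=
  ∑ α ∈ σ.support, mulOp r (σ.coeff α) * hdMonomial α

/-- `D^h` is a left module over `ℂ[q, h]` by left multiplication. -/
instance instModuleDh (r : ℕ) : Module (QHRing r) (Dh r) :=
  Module.compHom (Dh r) (mulOp r)

instance instTowerDh (r : ℕ) : IsScalarTower (QHRing r) (Dh r) (Dh r) where
  smul_assoc f x y := mul_assoc (mulOp r f) x y

/-- The left ideal `(D₁^h, …, D_u^h)` generated by the operators with symbols `σ₁, …, σ_u`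
(an `Ideal` of a noncommutative ring is a left ideal). -/
def leftIdeal {r u : ℕ} (σ : Fin u → BQHRing r) : Ideal (Dh r) :=
  Ideal.span (Set.range fun i => op (σ i))

/-- The left cyclic `D^h`-module `M^h = D^h / (D₁^h, …, D_u^h)`. -/
abbrev Mh {r u : ℕ} (σ : Fin u → BQHRing r) : Type := Dh r ⧸ leftIdeal σ

/-- The class `[P]` in `M^h`. -/
def mhClass {r u : ℕ} (σ : Fin u → BQHRing r) (P : Dh r) : Mh σ :=
  Submodule.Quotient.mk (p := leftIdeal σ) P

/-- The matrix `h Ωᵢ^h` of the action of `h ∂ᵢ` on `M^h`: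
`h ∂ᵢ • P_j = ∑ₖ (h Ωᵢ^h)ₖⱼ P_k`. -/
def hOmega {r u n : ℕ} {σ : Fin u → BQHRing r}
    (P : Module.Basis (Fin n) (QHRing r) (Mh σ)) (i : Fin r) :
    Matrix (Fin n) (Fin n) (QHRing r) :=
  Matrix.of fun k j => P.repr (hd i • P j) k

/-! ### Cohomology and quantum cohomology algebras -/

/-- `QH = ℂ[b, q] / (R₁, …, R_u)`. -/
abbrev QH {r u : ℕ} (R : Fin u → BQRing r) : Type := BQRing r ⧸ Ideal.span (Set.range R)

/-- `H = ℂ[b] / (R₁|_{q=0}, …, R_u|_{q=0})`. -/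
abbrev H {r u : ℕ} (R : Fin u → BQRing r) : Type :=
  MvPolynomial (Fin r) ℂ ⧸ Ideal.span (Set.range fun i => qZero r (R i))

/-- `H ⊗ ℂ[q]` as a `ℂ[q]`-algebra. -/
abbrev HQ {r u : ℕ} (R : Fin u → BQRing r) : Type := QRing r ⊗[ℂ] H R

/-- The class `[c]` of `c ∈ ℂ[b, q]` in `QH`. -/
def qhClass {r u : ℕ} (R : Fin u → BQRing r) (c : BQRing r) : QH R :=
  Ideal.Quotient.mk (Ideal.span (Set.range R)) c

/-- The class `[c]` of `c ∈ ℂ[b]` in `H`. -/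
def hClass {r u : ℕ} (R : Fin u → BQRing r) (c : MvPolynomial (Fin r) ℂ) : H R :=
  Ideal.Quotient.mk (Ideal.span (Set.range fun i => qZero r (R i))) c

/-- The element `[[c]]` of `H ⊗ ℂ[q]` given by `c ∈ ℂ[b, q]`. -/
def hqClass {r u : ℕ} (R : Fin u → BQRing r) : BQRing r →ₐ[QRing r] HQ R :=
  MvPolynomial.aeval fun i => (1 : QRing r) ⊗ₜ[ℂ] hClass R (MvPolynomial.X i)

/-- The restriction `H ⊗ ℂ[q] → H` to `q = 0`. -/
def hqAtZero {r u : ℕ} (R : Fin u → BQRing r) : HQ R →ₗ[ℂ] H R :=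
  (TensorProduct.lid ℂ (H R)).toLinearMap ∘ₗ
    LinearMap.rTensor (H R)
      (MvPolynomial.aeval (fun _ : Fin r => (0 : ℂ)) : QRing r →ₐ[ℂ] ℂ).toLinearMap

/-- `q`-independent polynomials in `b`, seen in `ℂ[b, q]`. -/
def constQ (r : ℕ) : MvPolynomial (Fin r) ℂ →+* BQRing r := MvPolynomial.map MvPolynomial.C

/-- The module `M^h = D^h / (D₁^h, …, D_u^h)`, where `Dᵢ^h` has symbol `σᵢ`, is a quantization of
`QH = ℂ[b, q] / (R₁, …, R_u)`: it is free over `ℂ[q, h]` of rank `dim H`, and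
`lim_{h → 0} S(Dᵢ^h) = Rᵢ`. -/
structure IsQuantization {r u : ℕ} (R : Fin u → BQRing r) (σ : Fin u → BQHRing r) : Prop where
  free : Module.Free (QHRing r) (Mh σ)
  rank : Module.finrank (QHRing r) (Mh σ) = Module.finrank ℂ (H R)
  limit : ∀ i, symbolHZero r (σ i) = R i

/-- `δ : QH → H ⊗ ℂ[q]` is an (abstract) quantum evaluation map. -/
structure IsQuantumEvaluation {r u : ℕ} (R : Fin u → BQRing r)
    (δ : QH R →ₗ[QRing r] HQ R) : Prop where
  bijective : Function.Bijective δ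
  map_one : δ (qhClass R 1) = hqClass R 1
  map_b : ∀ i, δ (qhClass R (MvPolynomial.X i)) = hqClass R (MvPolynomial.X i)
  degree : ∀ (n : ℕ) (c : BQRing r), IsHomog c n →
    ∃ c' : BQRing r, IsHomog c' n ∧ δ (qhClass R c) = hqClass R c'
  at_zero : ∀ c : BQRing r, hqAtZero R (δ (qhClass R c)) = hClass R (qZero r c)

/-- The matrix of multiplication by `[bᵢ]` on `QH` with respect to the basis `e`. -/
def mulMatrix {r u n : ℕ} {R : Fin u → BQRing r}
    (e : Module.Basis (Fin n) (QRing r) (QH R)) (i : Fin r) :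
    Matrix (Fin n) (Fin n) (QRing r) :=
  Matrix.of fun k j => e.repr (qhClass R (MvPolynomial.X i) * e j) k

/-- `qᵢ ∂/∂qᵢ` on `ℂ[q]`. -/
def qPartial {r : ℕ} (i : Fin r) (f : QRing r) : QRing r :=
  MvPolynomial.X i * MvPolynomial.pderiv i f

/-- The integrability condition `qᵢ ∂ω_j/∂qᵢ = q_j ∂ωᵢ/∂q_j` for all `i, j`, where `ωᵢ` is the
matrix of multiplication by `[bᵢ]` with respect to the basis `e` of `QH`. -/
def Integrability {r u n : ℕ} {R : Fin u → BQRing r}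
    (e : Module.Basis (Fin n) (QRing r) (QH R)) : Prop :=
  ∀ i j : Fin r, (mulMatrix e j).map (qPartial i) = (mulMatrix e i).map (qPartial j)

/-- The polynomial `ĉ_j = ∑ₖ (B₀⁻¹)ₖⱼ c_k`, where `c_k` is the monomial `b^{m k}`. -/
def cHat {r n : ℕ} (m : Fin n → Fin r →₀ ℕ) (B₀ : Matrix (Fin n) (Fin n) (QRing r))
    (j : Fin n) : BQRing r :=
  ∑ k, MvPolynomial.monomial (m k) (B₀⁻¹ k j)

/-! ### Loops and Birkhoff factorization -/

/-- A holomorphic map `t ↦ γ t` from the open set `U ⊆ ℂ^r` to the smooth loop group of `GL_n ℂ`. -/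
structure IsLoopFamily {r n : ℕ} (U : Set (Fin r → ℂ))
    (γ : (Fin r → ℂ) → Circle → Matrix (Fin n) (Fin n) ℂ) : Prop where
  isUnit : ∀ t ∈ U, ∀ h, IsUnit (γ t h)
  smooth : ∀ a b, ContDiffOn ℝ ∞
    (fun p : (Fin r → ℂ) × ℝ => γ p.1 (Circle.exp p.2) a b) (U ×ˢ Set.univ)
  holomorphic : ∀ a b, ∀ h, DifferentiableOn ℂ (fun t => γ t h a b) U

/-- `F` is continuous on the closed unit disc, holomorphic inside, with values in `GL_n ℂ`. -/
def IsDiscMap {n : ℕ} (F : ℂ → Matrix (Fin n) (Fin n) ℂ) : Prop :=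
  (∀ a b, DiffContOnCl ℂ (fun z => F z a b) (Metric.ball 0 1)) ∧
    ∀ z ∈ Metric.closedBall (0 : ℂ) 1, IsUnit (F z)

/-- The loop `γ(h) = B₀ + h B₁ + h² B₂ + ⋯` is the boundary value of a holomorphic map from
`|h| < 1` to `GL_n ℂ`, with constant term `B₀`. -/
def IsPlusLoop {n : ℕ} (γ : Circle → Matrix (Fin n) (Fin n) ℂ)
    (B₀ : Matrix (Fin n) (Fin n) ℂ) : Prop :=
  ∃ F, IsDiscMap F ∧ F 0 = B₀ ∧ ∀ h : Circle, γ h = F h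

/-- The loop `γ(h) = I + h⁻¹ A₁ + h⁻² A₂ + ⋯` is the boundary value of a holomorphic map from
`1 < |h| ≤ ∞` to `GL_n ℂ` with value `I` at `∞`. -/
def IsMinusLoop {n : ℕ} (γ : Circle → Matrix (Fin n) (Fin n) ℂ) : Prop :=
  ∃ F, IsDiscMap F ∧ F 0 = 1 ∧ ∀ h : Circle, γ h = F (h : ℂ)⁻¹

/-- The entrywise partial derivative `∂f/∂tᵢ` of a matrix function of `t ∈ ℂ^r`. -/
def tPartial {r n : ℕ} (i : Fin r) (f : (Fin r → ℂ) → Matrix (Fin n) (Fin n) ℂ)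
    (t : Fin r → ℂ) : Matrix (Fin n) (Fin n) ℂ :=
  Matrix.of fun a b => fderiv ℂ (fun t' => f t' a b) t (Pi.single i 1)

/-- The connection `d + ∑ Θᵢ dtᵢ` has holomorphic coefficients and zero curvature on `U`. -/
def IsFlatOn {r n : ℕ} (U : Set (Fin r → ℂ))
    (Θ : Fin r → (Fin r → ℂ) → Matrix (Fin n) (Fin n) ℂ) : Prop :=
  (∀ i a b, DifferentiableOn ℂ (fun t => Θ i t a b) U) ∧
    ∀ i j, ∀ t ∈ U,
      tPartial i (Θ j) t - tPartial j (Θ i) t + (Θ i t * Θ j t - Θ j t * Θ i t) = 0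

/-- Evaluation of a polynomial in `q` at `qᵢ = exp tᵢ`. -/
def evalT {r : ℕ} (t : Fin r → ℂ) : QRing r →+* ℂ :=
  MvPolynomial.eval fun i => Complex.exp (t i)

/-- Evaluation of a polynomial in `q, h` at `qᵢ = exp tᵢ` and a complex number `h`. -/
def evalTH {r : ℕ} (t : Fin r → ℂ) (h : ℂ) : QHRing r →+* ℂ :=
  MvPolynomial.eval₂Hom (Polynomial.evalRingHom h) fun i => Complex.exp (t i)

/-- The connection matrix `Ωᵢ^h` at the point `t`, given `h Ωᵢ^h`. -/
def connection {r n : ℕ} (A : Fin r → Matrix (Fin n) (Fin n) (QHRing r)) (i : Fin r)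
    (t : Fin r → ℂ) (h : Circle) : Matrix (Fin n) (Fin n) ℂ :=
  (h : ℂ)⁻¹ • (A i).map (evalTH t (h : ℂ))

/-- On `U`, the family of loops `L` solves `L⁻¹ dL = Ω^h` (where `A i = h Ωᵢ^h`) and
`L = L₋ L₊` is its Birkhoff factorization, where `L₊ = B₀ + O(h)`. -/
structure IsBirkhoff {r n : ℕ} (A : Fin r → Matrix (Fin n) (Fin n) (QHRing r))
    (U : Set (Fin r → ℂ)) (L Lm Lp : (Fin r → ℂ) → Circle → Matrix (Fin n) (Fin n) ℂ)
    (B₀ : (Fin r → ℂ) → Matrix (Fin n) (Fin n) ℂ) : Prop where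
  loop : IsLoopFamily U L
  loop_minus : IsLoopFamily U Lm
  loop_plus : IsLoopFamily U Lp
  gauge : ∀ i, ∀ t ∈ U, ∀ h : Circle,
    (L t h)⁻¹ * tPartial i (fun t' => L t' h) t = connection A i t h
  minus : ∀ t ∈ U, IsMinusLoop (Lm t)
  plus : ∀ t ∈ U, IsPlusLoop (Lp t) (B₀ t)
  factor : ∀ t ∈ U, ∀ h, L t h = Lm t h * Lp t h

/-- The matrix `ω̂ᵢ = B₀ ωᵢ B₀⁻¹` at the point `t`, where `ωᵢ` is the matrix of multiplication by
`[bᵢ]` on `QH` with respect to the basis `c`. -/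
def omegaHat {r u n : ℕ} {R : Fin u → BQRing r}
    (c : Module.Basis (Fin n) (QRing r) (QH R))
    (B₀ : (Fin r → ℂ) → Matrix (Fin n) (Fin n) ℂ) (i : Fin r) (t : Fin r → ℂ) :
    Matrix (Fin n) (Fin n) ℂ :=
  B₀ t * (mulMatrix c i).map (evalT t) * (B₀ t)⁻¹

/-- `h ↦ 0` in a matrix over `ℂ[q, h]`: the constant term of a polynomial `L₊`. -/
def constTerm {r n : ℕ} (Lp : Matrix (Fin n) (Fin n) (QHRing r)) :
    Matrix (Fin n) (Fin n) (QRing r) :=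
  Lp.map (hZero r)

/-- The polynomial matrix `L₊` in `q, h` is, over `U`, the `+`-factor of a solution `L` of
`L⁻¹ dL = Ω^h`. -/
def IsPolynomialPlusFactor {r n : ℕ} (A : Fin r → Matrix (Fin n) (Fin n) (QHRing r))
    (U : Set (Fin r → ℂ)) (Lp : Matrix (Fin n) (Fin n) (QHRing r)) : Prop :=
  ∃ L Lm, IsBirkhoff A U L Lm (fun t h => Lp.map (evalTH t (h : ℂ)))
    (fun t => (constTerm Lp).map (evalT t))

end QuantumDModule

end

noncomputable section

namespace QuantumDModule

/-! ### Normal ordering in `D^h` -/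

/-! Normal ordering identifies D^h with ℂ[b,q,h] as a ℂ[q,h]-module (`opEquiv`), and every
commutator [h∂ᵢ, f] is divisible by h. A specialization of ℂ[q,h] that kills these commutators turns
the symbol into a ring homomorphism (`symbolHom`). At h = 0 this carries M^h to QH: a ℂ[q]-relation
among the c_j lifts to an element of M^h divisible by h, so it is trivial, and ωᵢ is hΩᵢ at h = 0.
At q = 0 it yields H.

Part (a). Inserting L = L₋L₊ in L⁻¹dL = Ω^h gives L₋⁻¹dL₋ = h⁻¹L₊(hΩ^h)L₊⁻¹ − dL₊L₊⁻¹. The left side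
has only negative powers of h and the right side none below h⁻¹. Hence both equal h⁻¹ times the
value of L₊(hΩ^h)L₊⁻¹ at h = 0, which is ω̂ (`IsBirkhoff.minus_gauge`). The ω̂ᵢ commute, and L₋ at h
= 1 solves dF = Fω̂, so equality of mixed partials gives dω̂ = 0.

Part (b). L₊ is constructed algebraically, as a gauge transformation to a connection W without h. It
suffices to treat the Euler direction ∑ h∂ᵢ, which acts on q-degree k as multiplication by kh.
Dividing by kh − [·, N], where N is the part at q = 0, solves the gauge equation degree by degree in
q (`exists_gauge_mod`), and the grading bounds the q-degree, so that the procedure stops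
(`exists_euler_gauge`). Flatness then removes h from every Wᵢ: the Euler operator raises the
h-degree while commutators with the Euler component of W do not (`exists_normalizing_gauge`). The
same count of h-degrees gives uniqueness (`eq_one_of_gauge`).

Flatness of the h-independent connection splits into WᵢWⱼ = WⱼWᵢ and closedness of W. Therefore dF =
zFW has a fundamental solution entire in z, and F(t, 1/h) serves as L₋
(`isPolynomialPlusFactor_of_gauge`). Setting h = 0 shows Wᵢ = ω̂ᵢ, so closedness of W is the
integrability condition. The normalizations of the evaluation map at 1 and bᵢ hold because deg q = 4
exceeds the degrees 0 and 2. -/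

/-- The derivation `qᵢ ∂/∂qᵢ` of `ℂ[q, h]`. -/
def qDeriv {r : ℕ} (i : Fin r) : Derivation (Polynomial ℂ) (QHRing r) (QHRing r) :=
  (MvPolynomial.X i : QHRing r) • MvPolynomial.pderiv i

theorem qDeriv_apply {r : ℕ} (i : Fin r) (f : QHRing r) :
    qDeriv i f = MvPolynomial.X i * MvPolynomial.pderiv i f := rfl

theorem qDeriv_monomial {r : ℕ} (i : Fin r) (n : Fin r →₀ ℕ) (a : Polynomial ℂ) :
    qDeriv i (MvPolynomial.monomial n a) = MvPolynomial.monomial n ((n i : Polynomial ℂ) * a) := by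
  rw [qDeriv_apply, MvPolynomial.X_mul_pderiv_monomial, nsmul_eq_mul, ← MvPolynomial.C_mul_monomial]
  simp

theorem coeff_qDeriv {r : ℕ} (i : Fin r) (f : QHRing r) (d : Fin r →₀ ℕ) :
    (qDeriv i f).coeff d = (d i : Polynomial ℂ) * f.coeff d := by
  classical
  induction f using MvPolynomial.induction_on' with
  | monomial n a =>
    rw [qDeriv_monomial, MvPolynomial.coeff_monomial, MvPolynomial.coeff_monomial]
    split_ifs with h
    · rw [h]
    · simp
  | add p q hp hq => rw [map_add, MvPolynomial.coeff_add, hp, hq, MvPolynomial.coeff_add, mul_add]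

theorem hPartial_apply {r : ℕ} (i : Fin r) (f : QHRing r) :
    hPartial i f = hVar r * qDeriv i f := by
  rw [qDeriv_apply, ← mul_assoc]; rfl

theorem mulEnd_apply {r : ℕ} (f g : QHRing r) : mulEnd r f g = f * g := rfl

theorem coe_mulOp {r : ℕ} (f : QHRing r) :
    ((mulOp r f : Dh r) : Module.End ℂ (QHRing r)) = mulEnd r f := rfl

theorem coe_hd {r : ℕ} (i : Fin r) : ((hd i : Dh r) : Module.End ℂ (QHRing r)) = hPartial i := rfl

theorem smul_Dh_def {r : ℕ} (f : QHRing r) (D : Dh r) : f • D = mulOp r f * D := rfl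

/-- By the Leibniz rule. The commutator carries a factor h, so all noncommutativity of D^h
disappears in the limit h = 0. -/
theorem hd_mul_mulOp {r : ℕ} (i : Fin r) (f : QHRing r) :
    hd i * mulOp r f = mulOp r f * hd i + mulOp r (hVar r * qDeriv i f) := by
  refine Subtype.ext (LinearMap.ext fun g => ?_)
  change hPartial i (f * g) = f * hPartial i g + hVar r * qDeriv i f * g
  rw [hPartial_apply, hPartial_apply, Derivation.leibniz, smul_eq_mul, smul_eq_mul]
  ring

theorem hPartial_monomial {r : ℕ} (i : Fin r) (n : Fin r →₀ ℕ) (a : Polynomial ℂ) :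
    hPartial i (MvPolynomial.monomial n a) =
      MvPolynomial.monomial n (Polynomial.X * (n i : Polynomial ℂ) * a) := by
  rw [hPartial_apply, qDeriv_monomial, hVar, MvPolynomial.C_mul_monomial, mul_assoc]

theorem hPartial_pow_monomial {r : ℕ} (i : Fin r) (k : ℕ) (n : Fin r →₀ ℕ) (a : Polynomial ℂ) :
    (hPartial i ^ k) (MvPolynomial.monomial n a) =
      MvPolynomial.monomial n ((Polynomial.X * (n i : Polynomial ℂ)) ^ k * a) := by
  induction k with
  | zero => simp
  | succ k ih => rw [pow_succ', Module.End.mul_apply, ih, hPartial_monomial, pow_succ']; ring_nf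

/-- The monomials q^n are joint eigenvectors of the h∂ᵢ with eigenvalues h nᵢ. Identities between
operators thus reduce to evaluations of polynomials at the points h n. -/
theorem hdMonomial_monomial {r : ℕ} (α n : Fin r →₀ ℕ) (a : Polynomial ℂ) :
    (hdMonomial α : Module.End ℂ (QHRing r)) (MvPolynomial.monomial n a) =
      MvPolynomial.monomial n
        (MvPolynomial.eval (fun i => Polynomial.X * (n i : Polynomial ℂ))
          (MvPolynomial.monomial α 1) * a) := by
  have key : ∀ l : List (Fin r),
      (((l.map fun i => hd i ^ α i).prod : Dh r) : Module.End ℂ (QHRing r))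
        (MvPolynomial.monomial n a) = MvPolynomial.monomial n
          ((l.map fun i => (Polynomial.X * (n i : Polynomial ℂ)) ^ α i).prod * a) := by
    intro l
    induction l with
    | nil => simp
    | cons i l ih =>
      rw [List.map_cons, List.prod_cons, Subring.coe_mul, Module.End.mul_apply, ih, Subring.coe_pow,
        coe_hd, hPartial_pow_monomial, List.map_cons, List.prod_cons, mul_assoc]
  rw [hdMonomial, key, MvPolynomial.eval_monomial, one_mul,
    Finsupp.prod_fintype _ _ (fun _ => pow_zero _), Fin.prod_univ_def]

theorem Dh_ext {r : ℕ} {D E : Dh r}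
    (h : ∀ n a, (D : Module.End ℂ (QHRing r)) (MvPolynomial.monomial n a) =
      (E : Module.End ℂ (QHRing r)) (MvPolynomial.monomial n a)) : D = E := by
  refine Subtype.ext (LinearMap.ext fun f => ?_)
  induction f using MvPolynomial.induction_on' with
  | monomial n a => exact h n a
  | add p q hp hq => rw [map_add, map_add, hp, hq]

theorem hd_mul_hdMonomial {r : ℕ} (i : Fin r) (α : Fin r →₀ ℕ) :
    hd i * hdMonomial α = hdMonomial (Finsupp.single i 1 + α) := by
  refine Dh_ext fun n a => ?_
  have hX : MvPolynomial.monomial (Finsupp.single i 1 + α) (1 : Polynomial ℂ) =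
      MvPolynomial.X i * MvPolynomial.monomial α 1 := by
    rw [MvPolynomial.X, MvPolynomial.monomial_mul, one_mul]
  rw [Subring.coe_mul, Module.End.mul_apply, hdMonomial_monomial, coe_hd, hPartial_monomial,
    hdMonomial_monomial, hX, MvPolynomial.eval_mul, MvPolynomial.eval_X, mul_assoc]
  simp only [mul_assoc]

theorem hdMonomial_zero {r : ℕ} : hdMonomial (0 : Fin r →₀ ℕ) = 1 := by
  refine Dh_ext fun n a => ?_
  rw [hdMonomial_monomial]
  simp

theorem hd_commute {r : ℕ} (i j : Fin r) : hd i * hd j = hd j * hd i := by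
  refine Dh_ext fun n a => ?_
  simp only [Subring.coe_mul, Module.End.mul_apply, coe_hd, hPartial_monomial]
  congr 1; ring

/-- `op` as a linear map. -/
def opLin (r : ℕ) : BQHRing r →ₗ[QHRing r] Dh r :=
  (MvPolynomial.basisMonomials (Fin r) (QHRing r)).constr ℕ fun α => hdMonomial α

theorem opLin_apply {r : ℕ} (σ : BQHRing r) : opLin r σ = op σ := by
  rw [opLin, Module.Basis.constr_apply, op]
  rfl

theorem op_monomial {r : ℕ} (α : Fin r →₀ ℕ) (f : QHRing r) :
    op (MvPolynomial.monomial α f) = mulOp r f * hdMonomial α := by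
  have h : opLin r (MvPolynomial.monomial α 1) = hdMonomial α :=
    Module.Basis.constr_basis (MvPolynomial.basisMonomials (Fin r) (QHRing r)) ℕ _ α
  have hf : (MvPolynomial.monomial α f : BQHRing r) = f • MvPolynomial.monomial α 1 := by
    rw [MvPolynomial.smul_monomial, smul_eq_mul, mul_one]
  rw [← opLin_apply, hf, map_smul, h, smul_Dh_def]

theorem op_monomial_apply {r : ℕ} (σ : BQHRing r) (n : Fin r →₀ ℕ) :
    (op σ : Module.End ℂ (QHRing r)) (MvPolynomial.monomial n 1) =
      MvPolynomial.eval (fun i => hVar r * (n i : QHRing r)) σ * MvPolynomial.monomial n 1 := by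
  rw [← opLin_apply]
  induction σ using MvPolynomial.induction_on' with
  | monomial α f =>
    rw [opLin_apply, op_monomial, Subring.coe_mul, Module.End.mul_apply, hdMonomial_monomial,
      coe_mulOp, mulEnd_apply, mul_one, ← mul_one (MvPolynomial.eval _ _),
      ← MvPolynomial.C_mul_monomial, ← mul_assoc]
    congr 1
    rw [MvPolynomial.eval_monomial, MvPolynomial.eval_monomial, one_mul, map_finsuppProd]
    congr 1
    refine Finsupp.prod_congr fun i _ => ?_
    simp [hVar]
  | add p q hp hq => rw [map_add, Subring.coe_add, LinearMap.add_apply, hp, hq, map_add, add_mul]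

/-- The operator with symbol σ multiplies q^n by σ(h n), and a polynomial over a domain that
vanishes on the grid (hℕ)^r, a product of infinite sets, is zero. -/
theorem opLin_injective (r : ℕ) : Function.Injective (opLin r) := by
  rw [injective_iff_map_eq_zero]
  intro σ hσ
  refine MvPolynomial.funext_set (fun _ => Set.range fun n : ℕ => hVar r * (n : QHRing r)) (fun _ =>
    Set.infinite_range_of_injective fun a b hab => ?_) fun x hx => ?_
  · refine Nat.cast_injective (R := QHRing r) (mul_left_cancel₀ ?_ hab)
    rw [hVar, Ne, MvPolynomial.C_eq_zero]
    exact Polynomial.X_ne_zero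
  · choose n hn using fun i => hx i (Set.mem_univ i)
    have h := op_monomial_apply σ (Finsupp.equivFunOnFinite.symm n)
    rw [← opLin_apply, hσ, Subring.coe_zero, LinearMap.zero_apply, eq_comm, mul_eq_zero] at h
    rcases h with h | h
    · rw [map_zero, ← h]
      congr 2
      exact funext fun i => (hn i).symm
    · simp at h

theorem hd_mul_op_monomial {r : ℕ} (i : Fin r) (α : Fin r →₀ ℕ) (f : QHRing r) :
    hd i * op (MvPolynomial.monomial α f) =
      op (MvPolynomial.monomial (Finsupp.single i 1 + α) f +
        MvPolynomial.monomial α (hVar r * qDeriv i f)) := by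
  rw [← opLin_apply (_ + _), map_add, opLin_apply, opLin_apply, op_monomial, op_monomial,
    op_monomial, ← mul_assoc, hd_mul_mulOp, add_mul, mul_assoc, hd_mul_hdMonomial]

theorem Dh_induction {r : ℕ} {p : Dh r → Prop} (hmul : ∀ f, p (mulOp r f)) (hhd : ∀ i, p (hd i))
    (hadd : ∀ D E, p D → p E → p (D + E)) (hneg : ∀ D, p D → p (-D))
    (hprod : ∀ D E, p D → p E → p (D * E)) (D : Dh r) : p D := by
  obtain ⟨D, hD⟩ := D
  induction hD using Subring.closure_induction with
  | mem x hx =>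
    rcases hx with ⟨f, rfl⟩ | ⟨i, rfl⟩
    · exact hmul f
    · exact hhd i
  | zero => have h := hmul 0; rw [map_zero] at h; exact h
  | one => have h := hmul 1; rw [map_one] at h; exact h
  | add x y hx hy h1 h2 => exact hadd ⟨x, hx⟩ ⟨y, hy⟩ h1 h2
  | neg x hx h => exact hneg ⟨x, hx⟩ h
  | mul x y hx hy h1 h2 => exact hprod ⟨x, hx⟩ ⟨y, hy⟩ h1 h2

theorem op_one {r : ℕ} : op (1 : BQHRing r) = 1 := by
  have := op_monomial (0 : Fin r →₀ ℕ) (1 : QHRing r)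
  rw [hdMonomial_zero, (mulOp r).map_one, mul_one] at this
  exact this

/-- The image contains 1 and is stable under left multiplication by the generators, because moving
h∂ᵢ past a coefficient yields normally ordered terms again. -/
theorem opLin_surjective (r : ℕ) : Function.Surjective (opLin r) := by
  have key : ∀ D : Dh r, ∀ σ : BQHRing r, ∃ τ, opLin r τ = D * opLin r σ := by
    intro D
    induction D using Dh_induction with
    | hmul f => exact fun σ => ⟨f • σ, by rw [map_smul, smul_Dh_def]⟩
    | hhd i =>
      intro σ
      induction σ using MvPolynomial.induction_on' with
      | monomial α f => 
        rw [opLin_apply, hd_mul_op_monomial]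
        exact ⟨_, opLin_apply _⟩
      | add p q hp hq =>
        obtain ⟨τ, hτ⟩ := hp
        obtain ⟨τ', hτ'⟩ := hq
        exact ⟨τ + τ', by rw [map_add, map_add, hτ, hτ', mul_add]⟩
    | hadd D E hD hE =>
      intro σ
      obtain ⟨τ, hτ⟩ := hD σ
      obtain ⟨τ', hτ'⟩ := hE σ
      exact ⟨τ + τ', by rw [map_add, hτ, hτ', add_mul]⟩
    | hneg D hD =>
      intro σ
      obtain ⟨τ, hτ⟩ := hD σ
      exact ⟨-τ, by rw [map_neg, hτ, neg_mul]⟩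
    | hprod D E hD hE =>
      intro σ
      obtain ⟨τ, hτ⟩ := hE σ
      obtain ⟨τ', hτ'⟩ := hD τ
      exact ⟨τ', by rw [hτ', hτ, mul_assoc]⟩
  intro D
  obtain ⟨τ, hτ⟩ := key D 1
  exact ⟨τ, by rw [hτ, opLin_apply, op_one, mul_one]⟩

/-- `op` as an equivalence; its inverse is the symbol map `S`. -/
def opEquiv (r : ℕ) : BQHRing r ≃ₗ[QHRing r] Dh r :=
  LinearEquiv.ofBijective (opLin r) ⟨opLin_injective r, opLin_surjective r⟩

theorem opEquiv_apply {r : ℕ} (σ : BQHRing r) : opEquiv r σ = op σ := opLin_apply σ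

/-! ### Specialized symbols -/

section Symbol

variable {r : ℕ} {B : Type*} [CommRing B] (φ : QHRing r →+* B)
  (hφ : ∀ i f, φ (hVar r * qDeriv i f) = 0)

-- The correction term of normal ordering is exactly what `hφ` kills. The two cases of interest are
-- h = 0, and q = 0 with h an arbitrary number.
include hφ in
theorem map_symm_hd_mul (i : Fin r) (D : Dh r) :
    MvPolynomial.map φ ((opEquiv r).symm (hd i * D)) =
      MvPolynomial.X i * MvPolynomial.map φ ((opEquiv r).symm D) := by
  obtain ⟨σ, rfl⟩ := (opEquiv r).surjective D
  induction σ using MvPolynomial.induction_on' with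
  | monomial α f =>
    rw [opEquiv_apply, hd_mul_op_monomial, ← opEquiv_apply, ← opEquiv_apply,
      LinearEquiv.symm_apply_apply, LinearEquiv.symm_apply_apply, map_add, MvPolynomial.map_monomial,
      MvPolynomial.map_monomial, hφ, MvPolynomial.monomial_zero, add_zero,
      MvPolynomial.map_monomial, MvPolynomial.X, MvPolynomial.monomial_mul, one_mul]
  | add p q hp hq => rw [map_add, mul_add, map_add, map_add, hp, hq, map_add, map_add, mul_add]

/-- The symbol followed by a specialization `φ` of `ℂ[q, h]` that makes `h ∂ᵢ` commute with
coefficients. It is a ring homomorphism. -/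
def symbolHom : Dh r →+* MvPolynomial (Fin r) B where
  toFun D := MvPolynomial.map φ ((opEquiv r).symm D)
  map_zero' := by simp
  map_one' := by rw [← op_one, ← opEquiv_apply, LinearEquiv.symm_apply_apply, map_one]
  map_add' D E := by rw [map_add, map_add]
  map_mul' D := by
    have hone : MvPolynomial.map φ ((opEquiv r).symm 1) = 1 := by
      rw [← op_one, ← opEquiv_apply, LinearEquiv.symm_apply_apply, map_one]
    have hsmul : ∀ f (E : Dh r), MvPolynomial.map φ ((opEquiv r).symm (mulOp r f * E)) =
        MvPolynomial.C (φ f) * MvPolynomial.map φ ((opEquiv r).symm E) := by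
      intro f E
      rw [← smul_Dh_def, map_smul, MvPolynomial.smul_eq_C_mul, map_mul, MvPolynomial.map_C]
    -- Multiplicativity against all right factors is inherited by sums and products of left factors,
    -- so it is enough to check the generators on the left.
    induction D using Dh_induction with
    | hmul f =>
      intro E
      have h := hsmul f 1
      rw [mul_one, hone, mul_one] at h
      rw [hsmul, h]
    | hhd i =>
      intro E
      have h := map_symm_hd_mul φ hφ i 1
      rw [mul_one, hone, mul_one] at h
      rw [map_symm_hd_mul φ hφ, h]
    | hadd D E hD hE => intro F; rw [add_mul, map_add, map_add, hD, hE, map_add, map_add, add_mul]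
    | hneg D hD => intro F; rw [neg_mul, map_neg, map_neg, hD, map_neg, map_neg, neg_mul]
    | hprod D E hD hE => intro F; rw [mul_assoc, hD, hE, hD, mul_assoc]

theorem symbolHom_op (σ : BQHRing r) : symbolHom φ hφ (op σ) = MvPolynomial.map φ σ := by
  change MvPolynomial.map φ ((opEquiv r).symm (op σ)) = _
  rw [← opEquiv_apply, LinearEquiv.symm_apply_apply]

theorem symbolHom_hdMonomial (α : Fin r →₀ ℕ) :
    symbolHom φ hφ (hdMonomial α) = MvPolynomial.monomial α 1 := by
  have := symbolHom_op φ hφ (MvPolynomial.monomial α 1)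
  rwa [op_monomial, map_one, one_mul, MvPolynomial.map_monomial, map_one] at this

theorem symbolHom_mulOp (f : QHRing r) : symbolHom φ hφ (mulOp r f) = MvPolynomial.C (φ f) := by
  have := symbolHom_op φ hφ (MvPolynomial.monomial 0 f)
  rwa [op_monomial, hdMonomial_zero, mul_one, MvPolynomial.map_monomial] at this

theorem symbolHom_hd (i : Fin r) : symbolHom φ hφ (hd i) = MvPolynomial.X i := by
  have := map_symm_hd_mul φ hφ i 1
  rw [mul_one, ← op_one, ← opEquiv_apply, LinearEquiv.symm_apply_apply, map_one, mul_one] at this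
  exact this

end Symbol

/-! ### Specialization at `h = 0` and at `q = 0` -/

/-- The inclusion `ℂ[q] → ℂ[q, h]`. -/
def constH (r : ℕ) : QRing r →+* QHRing r := MvPolynomial.map Polynomial.C

theorem coeff_constH {r : ℕ} (g : QRing r) (d : Fin r →₀ ℕ) :
    (constH r g).coeff d = Polynomial.C (g.coeff d) := MvPolynomial.coeff_map _ _ _

theorem coeff_hZero {r : ℕ} (f : QHRing r) (d : Fin r →₀ ℕ) :
    (hZero r f).coeff d = (f.coeff d).coeff 0 := by
  rw [hZero, MvPolynomial.coeff_map, Polynomial.coe_evalRingHom, ← Polynomial.coeff_zero_eq_eval_zero]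

theorem qZeroH_apply {r : ℕ} (f : QHRing r) : qZeroH r f = f.coeff 0 := rfl

theorem hZero_constH {r : ℕ} (g : QRing r) : hZero r (constH r g) = g := by
  ext d
  rw [coeff_hZero, coeff_constH, Polynomial.coeff_C_zero]

theorem hZero_hVar {r : ℕ} : hZero r (hVar r) = 0 := by
  simp [hZero, hVar]

theorem coeff_hVar_mul {r : ℕ} (f : QHRing r) (d : Fin r →₀ ℕ) :
    (hVar r * f).coeff d = Polynomial.X * f.coeff d := MvPolynomial.coeff_C_mul _ _ _

theorem hVar_dvd_of_hZero_eq_zero {r : ℕ} {f : QHRing r} (h : hZero r f = 0) : hVar r ∣ f := by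
  rw [hVar, MvPolynomial.C_dvd_iff_dvd_coeff]
  intro d
  rw [Polynomial.X_dvd_iff, ← coeff_hZero, h, MvPolynomial.coeff_zero]

theorem hZero_hVar_mul_qDeriv {r : ℕ} (i : Fin r) (f : QHRing r) :
    hZero r (hVar r * qDeriv i f) = 0 := by
  rw [map_mul, hZero_hVar, zero_mul]

/-- `ℂ[q, h] → ℂ`, `q ↦ 0`, `h ↦ z`. -/
def qZeroEval (r : ℕ) (z : ℂ) : QHRing r →+* ℂ := (Polynomial.evalRingHom z).comp (qZeroH r)

/-- The derivation multiplies the coefficient of q^d by dᵢ, hence annihilates the constant term; no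
condition on h is needed at q = 0. -/
theorem qZeroEval_hVar_mul_qDeriv {r : ℕ} (z : ℂ) (i : Fin r) (f : QHRing r) :
    qZeroEval r z (hVar r * qDeriv i f) = 0 := by
  rw [qZeroEval, RingHom.comp_apply, qZeroH_apply, coeff_hVar_mul, coeff_qDeriv]
  simp

/-! ### The D-module M^h, its flat connection and its specializations. -/

section Mh

variable {r u n : ℕ} {σ : Fin u → BQHRing r}

theorem mhClass_mul (D E : Dh r) : mhClass σ (D * E) = D • mhClass σ E := rfl

theorem mhClass_smul (f : QHRing r) (E : Dh r) : mhClass σ (f • E) = f • mhClass σ E := rfl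

theorem mhClass_eq_zero {D : Dh r} : mhClass σ D = 0 ↔ D ∈ leftIdeal σ :=
  Submodule.Quotient.mk_eq_zero _

theorem mulOp_smul_Mh (f : QHRing r) (x : Mh σ) : mulOp r f • x = f • x := by
  obtain ⟨D, rfl⟩ := Submodule.Quotient.mk_surjective _ x
  rfl

theorem hd_smul_smul (i : Fin r) (f : QHRing r) (x : Mh σ) :
    hd i • f • x = f • hd i • x + (hVar r * qDeriv i f) • x := by
  rw [← mulOp_smul_Mh f, ← mulOp_smul_Mh f, ← mulOp_smul_Mh (_ * _), ← mul_smul, ← mul_smul,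
    ← add_smul, hd_mul_mulOp]

variable (P : Module.Basis (Fin n) (QHRing r) (Mh σ))

theorem hd_smul_basis (i : Fin r) (j : Fin n) : hd i • P j = ∑ k, hOmega P i k j • P k :=
  (P.sum_repr (hd i • P j)).symm

/-- The connection `d + Ω^h` is flat. -/
theorem hOmega_flat (i j : Fin r) :
    hOmega P i * hOmega P j + (hOmega P j).map (fun f => hVar r * qDeriv i f) =
      hOmega P j * hOmega P i + (hOmega P i).map (fun f => hVar r * qDeriv j f) := by
  -- Flatness is the commutation of h∂ᵢ and h∂ⱼ on M^h: both orders are expanded in the basis and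
  -- their coordinates compared.
  have key : ∀ (i j : Fin r) (k : Fin n), hd i • hd j • P k =
      ∑ l, (hOmega P i * hOmega P j + (hOmega P j).map (fun f => hVar r * qDeriv i f)) l k • P l := by
    intro i j k
    rw [hd_smul_basis P j k, Finset.smul_sum]
    simp only [hd_smul_smul, Finset.sum_add_distrib, Matrix.add_apply, add_smul, Matrix.mul_apply,
      Matrix.map_apply, Finset.sum_smul]
    congr 1
    rw [Finset.sum_comm]
    refine Finset.sum_congr rfl fun a _ => ?_
    rw [hd_smul_basis P i a, Finset.smul_sum]
    exact Finset.sum_congr rfl fun l _ => by rw [← mul_smul, mul_comm]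
  ext1 l k
  have h := key i j k
  rw [← mul_smul, hd_commute, mul_smul, key j i k] at h
  have hl := congrArg (fun x => P.repr x l) h
  simp only [Module.Basis.repr_sum_self] at hl
  exact hl.symm

variable {m : Fin n → Fin r →₀ ℕ} (hP : ∀ j, P j = mhClass σ (hdMonomial (m j)))

include hP in
theorem sub_sum_mem_leftIdeal (D : Dh r) :
    D - ∑ j, mulOp r (P.repr (mhClass σ D) j) * hdMonomial (m j) ∈ leftIdeal σ := by
  rw [← mhClass_eq_zero]
  change mhClass σ D - mhClass σ (∑ j, mulOp r (P.repr (mhClass σ D) j) * hdMonomial (m j)) = 0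
  have hsum : mhClass σ (∑ j, mulOp r (P.repr (mhClass σ D) j) * hdMonomial (m j)) =
      ∑ j, P.repr (mhClass σ D) j • P j := by
    rw [mhClass, ← Submodule.mkQ_apply, map_sum]
    refine Finset.sum_congr rfl fun j _ => ?_
    rw [hP]
    rfl
  rw [hsum, P.sum_repr, sub_self]

variable {B : Type*} [CommRing B] (φ : QHRing r →+* B)
  (hφ : ∀ i f, φ (hVar r * qDeriv i f) = 0) {J : Ideal (MvPolynomial (Fin r) B)}
  (hJ : ∀ i, MvPolynomial.map φ (σ i) ∈ J)

include hJ in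
theorem symbolHom_mem {D : Dh r} (hD : D ∈ leftIdeal σ) : symbolHom φ hφ D ∈ J := by
  have : leftIdeal σ ≤ J.comap (symbolHom φ hφ) := by
    rw [leftIdeal, Ideal.span_le]
    rintro _ ⟨i, rfl⟩
    change symbolHom φ hφ (op (σ i)) ∈ J
    rw [symbolHom_op]
    exact hJ i
  exact this hD

-- Reduction to normal form in M^h, followed by the specialized symbol, is reduction modulo `J`: the
-- difference lies in the left ideal, whose specialized symbols lie in `J`. This transports the
-- basis and the connection matrices both to QH and to H.
include hP hJ in
theorem mk_symbolHom (D : Dh r) : Ideal.Quotient.mk J (symbolHom φ hφ D) =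
    ∑ j, Ideal.Quotient.mk J (MvPolynomial.monomial (m j) (φ (P.repr (mhClass σ D) j))) := by
  rw [← map_sum, Ideal.Quotient.eq]
  have h := symbolHom_mem φ hφ hJ (sub_sum_mem_leftIdeal P hP D)
  rw [map_sub, map_sum] at h
  convert! h using 3 with j
  rw [map_mul, symbolHom_mulOp, symbolHom_hdMonomial, MvPolynomial.C_mul_monomial, mul_one]

end Mh

/-! ### The basis of QH and the multiplication matrices. -/

section QuantumBasis

variable {r u n : ℕ} {R : Fin u → BQRing r} {σ : Fin u → BQHRing r}
  (hR : ∀ i, symbolHZero r (σ i) = R i)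
  {m : Fin n → Fin r →₀ ℕ} {P : Module.Basis (Fin n) (QHRing r) (Mh σ)}
  (hP : ∀ j, P j = mhClass σ (hdMonomial (m j)))

theorem smul_qhClass (g : QRing r) (c : BQRing r) :
    g • qhClass R c = qhClass R (MvPolynomial.C g * c) := by
  rw [← MvPolynomial.smul_eq_C_mul]; rfl

theorem smul_qhClass_monomial (g : QRing r) (α : Fin r →₀ ℕ) :
    g • qhClass R (MvPolynomial.monomial α 1) = qhClass R (MvPolynomial.monomial α g) := by
  rw [smul_qhClass, MvPolynomial.C_mul_monomial, mul_one]

include hR hP in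
theorem qhClass_symbolHom (D : Dh r) :
    qhClass R (symbolHom (hZero r) hZero_hVar_mul_qDeriv D) =
      ∑ j, hZero r (P.repr (mhClass σ D) j) • qhClass R (MvPolynomial.monomial (m j) 1) := by
  simp only [smul_qhClass_monomial]
  refine mk_symbolHom P hP (hZero r) hZero_hVar_mul_qDeriv (fun i => ?_) D
  exact (hR i).symm ▸ Ideal.subset_span ⟨i, rfl⟩

theorem map_hZero_map_constH (c : BQRing r) :
    MvPolynomial.map (hZero r) (MvPolynomial.map (constH r) c) = c := by
  rw [MvPolynomial.map_map]
  have : (hZero r).comp (constH r) = RingHom.id _ := RingHom.ext fun g => hZero_constH g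
  rw [this, MvPolynomial.map_id]

-- A relation ∑ gⱼcⱼ = ∑ aᵢRᵢ is lifted to operators, replacing Rᵢ by Dᵢ^h. The lifted difference
-- has zero symbol at h = 0, so it is h times an operator, and in M^h the element ∑ gⱼPⱼ becomes
-- divisible by h. As the gⱼ do not involve h, they vanish.
include hR hP in
theorem linearIndependent_qhClass :
    LinearIndependent (QRing r) fun j => qhClass R (MvPolynomial.monomial (m j) 1) := by
  rw [Fintype.linearIndependent_iff]
  intro g hg
  simp only [smul_qhClass_monomial] at hg
  have hmem : ∑ j, MvPolynomial.monomial (m j) (g j) ∈ Ideal.span (Set.range R) := by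
    rw [← Ideal.Quotient.eq_zero_iff_mem, map_sum]
    exact hg
  obtain ⟨a, ha⟩ := (Submodule.mem_span_range_iff_exists_fun _).1 hmem
  set E : Dh r := ∑ i, op (MvPolynomial.map (constH r) (a i)) * op (σ i) with hE
  set D : Dh r := ∑ j, mulOp r (constH r (g j)) * hdMonomial (m j) with hD
  have hEmem : E ∈ leftIdeal σ :=
    Submodule.sum_mem _ fun i _ => Ideal.mul_mem_left _ _ (Ideal.subset_span ⟨i, rfl⟩)
  have hsymb : symbolHom (hZero r) hZero_hVar_mul_qDeriv (D - E) = 0 := by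
    rw [map_sub, hD, hE, map_sum, map_sum, sub_eq_zero]
    simp only [map_mul, symbolHom_mulOp, symbolHom_hdMonomial, symbolHom_op, hZero_constH,
      map_hZero_map_constH, MvPolynomial.C_mul_monomial, mul_one]
    rw [← ha]
    refine Finset.sum_congr rfl fun i _ => ?_
    rw [← hR i]; rfl
  obtain ⟨τ, hτ⟩ := (opEquiv r).surjective (D - E)
  -- The normally ordered symbol of D − E vanishes at h = 0, coefficient by coefficient.
  have hdvd : MvPolynomial.C (hVar r) ∣ τ := by
    rw [MvPolynomial.C_dvd_iff_dvd_coeff]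
    intro α
    refine hVar_dvd_of_hZero_eq_zero ?_
    rw [← hτ, opEquiv_apply, symbolHom_op] at hsymb
    rw [← MvPolynomial.coeff_map, hsymb, MvPolynomial.coeff_zero]
  obtain ⟨τ', rfl⟩ := hdvd
  have hclass : ∑ j, constH r (g j) • P j = hVar r • mhClass σ (op τ') := by
    have h1 : mhClass σ (D - E) = mhClass σ D := by
      rw [eq_comm, ← sub_eq_zero]
      have : mhClass σ (D - (D - E)) = 0 := by
        rw [mhClass_eq_zero, sub_sub_cancel]; exact hEmem
      exact this
    have h2 : mhClass σ D = ∑ j, constH r (g j) • P j := by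
      rw [hD, mhClass, ← Submodule.mkQ_apply, map_sum]
      refine Finset.sum_congr rfl fun j _ => ?_
      rw [hP]
      rfl
    rw [← h2, ← h1, ← hτ, ← MvPolynomial.smul_eq_C_mul, map_smul, mhClass_smul, opEquiv_apply]
  intro j
  have hj := congrArg (fun x => hZero r (P.repr x j)) hclass
  simpa [map_sum, map_smul, Finsupp.single_apply, hZero_constH, hZero_hVar] using hj

include hR hP in
theorem top_le_span_qhClass : ⊤ ≤ Submodule.span (QRing r)
    (Set.range fun j => qhClass R (MvPolynomial.monomial (m j) 1)) := by
  rintro x -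
  obtain ⟨c, rfl⟩ := Ideal.Quotient.mk_surjective x
  have h := qhClass_symbolHom hR hP (op (MvPolynomial.map (constH r) c))
  rw [symbolHom_op, map_hZero_map_constH] at h
  change qhClass R c ∈ _
  rw [h]
  exact Submodule.sum_mem _ fun j _ => Submodule.smul_mem _ _ (Submodule.subset_span ⟨j, rfl⟩)

/-- The classes of the symbols of a monomial basis of `M^h` form a basis of `QH`. -/
def qhBasis : Module.Basis (Fin n) (QRing r) (QH R) :=
  Module.Basis.mk (linearIndependent_qhClass hR hP) (top_le_span_qhClass hR hP)

theorem qhBasis_apply (j : Fin n) :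
    qhBasis hR hP j = qhClass R (MvPolynomial.monomial (m j) 1) :=
  Module.Basis.mk_apply _ _ _

include hP in
theorem symbolHom_hd_mul_basis {B : Type*} [CommRing B] (φ : QHRing r →+* B)
    (hφ : ∀ i f, φ (hVar r * qDeriv i f) = 0) {J : Ideal (MvPolynomial (Fin r) B)}
    (hJ : ∀ i, MvPolynomial.map φ (σ i) ∈ J) (i : Fin r) (j : Fin n) :
    Ideal.Quotient.mk J (MvPolynomial.X i * MvPolynomial.monomial (m j) 1) =
      ∑ k, Ideal.Quotient.mk J (MvPolynomial.monomial (m k) (φ (hOmega P i k j))) := by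
  have h := mk_symbolHom P hP φ hφ hJ (hd i * hdMonomial (m j))
  rw [map_mul, symbolHom_hd, symbolHom_hdMonomial] at h
  rw [h, mhClass_mul, ← hP]
  rfl

theorem mulMatrix_qhBasis (i : Fin r) :
    mulMatrix (qhBasis hR hP) i = (hOmega P i).map (hZero r) := by
  ext1 k j
  have h := symbolHom_hd_mul_basis hP (hZero r) hZero_hVar_mul_qDeriv
    (J := Ideal.span (Set.range R)) (fun i => (hR i).symm ▸ Ideal.subset_span ⟨i, rfl⟩) i j
  have h' : qhClass R (MvPolynomial.X i) * qhBasis hR hP j =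
      ∑ k, hZero r (hOmega P i k j) • qhBasis hR hP k := by
    simp only [qhBasis_apply, smul_qhClass_monomial]
    exact ((Ideal.Quotient.mk _).map_mul _ _).symm.trans h
  rw [mulMatrix, Matrix.of_apply, h', Module.Basis.repr_sum_self, Matrix.map_apply]

end QuantumBasis

/-! ### The basis of H and the connection at q = 0. -/

section ClassicalBasis

variable {r u n : ℕ} {R : Fin u → BQRing r} {σ : Fin u → BQHRing r}
  (hσ : ∀ i, symbolQZero r (σ i) = MvPolynomial.map Polynomial.C (qZero r (R i)))
  {m : Fin n → Fin r →₀ ℕ} {P : Module.Basis (Fin n) (QHRing r) (Mh σ)}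
  (hP : ∀ j, P j = mhClass σ (hdMonomial (m j)))
  (hrank : n = Module.finrank ℂ (H R))

theorem smul_hClass_monomial (a : ℂ) (α : Fin r →₀ ℕ) :
    a • hClass R (MvPolynomial.monomial α 1) = hClass R (MvPolynomial.monomial α a) := by
  have : (MvPolynomial.monomial α a : MvPolynomial (Fin r) ℂ) = a • MvPolynomial.monomial α 1 := by
    rw [MvPolynomial.smul_monomial, smul_eq_mul, mul_one]
  rw [this]
  rfl

include hσ in
theorem map_qZeroEval_mem (z : ℂ) (i : Fin u) :
    MvPolynomial.map (qZeroEval r z) (σ i) ∈ Ideal.span (Set.range fun i => qZero r (R i)) := by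
  have h : MvPolynomial.map (qZeroEval r z) (σ i) = qZero r (R i) := by
    rw [qZeroEval, ← MvPolynomial.map_map]
    change MvPolynomial.map _ (symbolQZero r (σ i)) = _
    rw [hσ, MvPolynomial.map_map]
    convert! MvPolynomial.map_id (qZero r (R i))
    ext1 a
    simp
  rw [h]
  exact Ideal.subset_span ⟨i, rfl⟩

-- Normal forms in M^h specialize at q = 0, h = 0 to combinations of the monomials. Linear
-- independence then follows by counting, since the rank of M^h is dim H.
include hσ hP in
theorem top_le_span_hClass : ⊤ ≤ Submodule.span ℂ
    (Set.range fun j => hClass R (MvPolynomial.monomial (m j) 1)) := by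
  rintro x -
  obtain ⟨c, rfl⟩ := Ideal.Quotient.mk_surjective x
  have h := mk_symbolHom P hP (qZeroEval r 0) (qZeroEval_hVar_mul_qDeriv 0)
    (map_qZeroEval_mem hσ 0) (op (MvPolynomial.map (MvPolynomial.C.comp Polynomial.C) c))
  rw [symbolHom_op, MvPolynomial.map_map] at h
  have hc : MvPolynomial.map ((qZeroEval r 0).comp (MvPolynomial.C.comp Polynomial.C)) c = c := by
    refine (congrArg (fun g => MvPolynomial.map g c) (RingHom.ext fun a => ?_)).trans (MvPolynomial.map_id c)
    simp [qZeroEval, qZeroH]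
  rw [hc] at h
  rw [h]
  refine Submodule.sum_mem _ fun j _ => ?_
  have := smul_hClass_monomial (R := R) (qZeroEval r 0 (P.repr (mhClass σ
    (op (MvPolynomial.map (MvPolynomial.C.comp Polynomial.C) c))) j)) (m j)
  rw [hClass, hClass] at this
  rw [← this]
  exact Submodule.smul_mem _ _ (Submodule.subset_span ⟨j, rfl⟩)

/-- The classes of the symbols of a monomial basis of `M^h` form a basis of `H`. -/
def hBasis : Module.Basis (Fin n) ℂ (H R) :=
  basisOfTopLeSpanOfCardEqFinrank _ (top_le_span_hClass hσ hP)
    (by rw [Fintype.card_fin, hrank])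

theorem hBasis_apply (j : Fin n) :
    hBasis hσ hP hrank j = hClass R (MvPolynomial.monomial (m j) 1) := by
  rw [hBasis, coe_basisOfTopLeSpanOfCardEqFinrank]

include hσ hP hrank in
/-- At `q = 0` the connection matrix does not depend on `h`. -/
theorem coeff_zero_hOmega (i : Fin r) (k j : Fin n) :
    (hOmega P i k j).coeff 0 = Polynomial.C (((hOmega P i k j).coeff 0).coeff 0) := by
  -- For every value h = z the specialized relations are those of H, so the specialized matrix
  -- consists of the structure constants of H in one fixed basis. A polynomial in h with constant
  -- values is constant.
  have key : ∀ z : ℂ, qZeroEval r z (hOmega P i k j) =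
      (hBasis hσ hP hrank).repr (hClass R (MvPolynomial.X i * MvPolynomial.monomial (m j) 1)) k := by
    intro z
    have h := symbolHom_hd_mul_basis hP (qZeroEval r z) (qZeroEval_hVar_mul_qDeriv z)
      (map_qZeroEval_mem hσ z) i j
    have h' : hClass R (MvPolynomial.X i * MvPolynomial.monomial (m j) 1) =
        ∑ k, qZeroEval r z (hOmega P i k j) • hBasis hσ hP hrank k := by
      simp only [hBasis_apply, smul_hClass_monomial]
      exact h
    rw [h', Module.Basis.repr_sum_self]
  refine Polynomial.funext fun z => ?_
  rw [Polynomial.eval_C, Polynomial.coeff_zero_eq_eval_zero]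
  exact (key z).trans (key 0).symm

end ClassicalBasis

/-! ### Homogeneity of the connection matrices -/

/-- The rescaling `qᵢ ↦ z⁴ qᵢ`, `h ↦ z² h` of `ℂ[q, h]`. -/
def scaleH (r : ℕ) (z : ℂ) : QHRing r →ₐ[ℂ] QHRing r :=
  MvPolynomial.aevalTower (Polynomial.aeval (z ^ 2 • hVar r)) fun i => z ^ 4 • MvPolynomial.X i

theorem scaleH_monomial {r : ℕ} (z : ℂ) (d : Fin r →₀ ℕ) (k : ℕ) (a : ℂ) :
    scaleH r z (MvPolynomial.monomial d (Polynomial.monomial k a)) =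
      z ^ (4 * d.degree + 2 * k) • MvPolynomial.monomial d (Polynomial.monomial k a) := by
  have hX : (MvPolynomial.monomial d (Polynomial.monomial k a) : QHRing r) =
      MvPolynomial.C (Polynomial.monomial k a) * d.prod fun i e => MvPolynomial.X i ^ e := by
    rw [MvPolynomial.monomial_eq]
  have hk : (MvPolynomial.C (Polynomial.monomial k a) : QHRing r) = a • hVar r ^ k := by
    rw [hVar, ← map_pow, Algebra.smul_def,
      IsScalarTower.algebraMap_apply ℂ (Polynomial ℂ) (QHRing r), MvPolynomial.algebraMap_eq,
      ← map_mul, Polynomial.algebraMap_eq, Polynomial.C_mul_X_pow_eq_monomial]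
  rw [hX, map_mul, scaleH, MvPolynomial.aevalTower_C, Polynomial.aeval_monomial, map_finsuppProd]
  simp only [map_pow, MvPolynomial.aevalTower_X, smul_pow, ← pow_mul]
  rw [Finsupp.prod, Finset.prod_smul, Finset.prod_pow_eq_pow_sum, ← Finset.mul_sum, hk, pow_add]
  change _ = (z ^ (4 * ∑ i ∈ d.support, d i) * _) • _
  rw [← Algebra.smul_def, Finsupp.prod]
  simp only [smul_mul_assoc, mul_smul_comm, smul_smul]
  ring_nf

theorem coeff_scaleH {r : ℕ} (z : ℂ) (f : QHRing r) (d : Fin r →₀ ℕ) (k : ℕ) :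
    ((scaleH r z f).coeff d).coeff k = z ^ (4 * d.degree + 2 * k) * (f.coeff d).coeff k := by
  classical
  induction f using MvPolynomial.induction_on' with
  | monomial d' p =>
    induction p using Polynomial.induction_on' with
    | monomial k' a =>
      rw [scaleH_monomial, MvPolynomial.coeff_smul, Polynomial.coeff_smul, smul_eq_mul,
        MvPolynomial.coeff_monomial]
      split_ifs with hd
      · rw [Polynomial.coeff_monomial]
        split_ifs with hk
        · rw [hd, hk]
        · simp
      · simp
    | add p q hp hq =>
      simp only [map_add, MvPolynomial.coeff_add, Polynomial.coeff_add, hp, hq, mul_add]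
  | add p q hp hq =>
    simp only [map_add, MvPolynomial.coeff_add, Polynomial.coeff_add, hp, hq, mul_add]

theorem QHRing_ext {r : ℕ} {f g : QHRing r}
    (h : ∀ d k, (f.coeff d).coeff k = (g.coeff d).coeff k) : f = g :=
  MvPolynomial.ext _ _ fun d => Polynomial.ext fun k => h d k

theorem scaleH_surjective (r : ℕ) {z : ℂ} (hz : z ≠ 0) : Function.Surjective (scaleH r z) :=
  fun f => ⟨scaleH r z⁻¹ f, QHRing_ext fun d k => by
    rw [coeff_scaleH, coeff_scaleH, ← mul_assoc, ← mul_pow, mul_inv_cancel₀ hz, one_pow, one_mul]⟩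

theorem scaleH_qDeriv {r : ℕ} (z : ℂ) (i : Fin r) (f : QHRing r) :
    scaleH r z (hVar r * qDeriv i f) = z ^ 2 • (hVar r * qDeriv i (scaleH r z f)) := by
  refine QHRing_ext fun d k => ?_
  rw [coeff_scaleH, MvPolynomial.coeff_smul, Polynomial.coeff_smul, coeff_hVar_mul, coeff_hVar_mul,
    coeff_qDeriv, coeff_qDeriv, smul_eq_mul]
  cases k with
  | zero => simp
  | succ k =>
    rw [Polynomial.coeff_X_mul, Polynomial.coeff_X_mul, Polynomial.coeff_natCast_mul,
      Polynomial.coeff_natCast_mul, coeff_scaleH]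
    ring

/-- A complex number as an element of `ℂ[q, h]`. -/
def scalar (r : ℕ) : ℂ →+* QHRing r := algebraMap ℂ (QHRing r)

theorem scalar_mul_eq_smul {r : ℕ} (z : ℂ) (f : QHRing r) : scalar r z * f = z • f :=
  (Algebra.smul_def z f).symm

/-- `D'` is the conjugate of `D` by the rescaling of `ℂ[q, h]`. -/
def IsRescaling {r : ℕ} (z : ℂ) (D D' : Dh r) : Prop :=
  ∀ f, (D' : Module.End ℂ (QHRing r)) (scaleH r z f) =
    scaleH r z ((D : Module.End ℂ (QHRing r)) f)

namespace IsRescaling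

variable {r : ℕ} {z : ℂ} {D D' E E' : Dh r}

theorem add (hD : IsRescaling z D D') (hE : IsRescaling z E E') :
    IsRescaling z (D + E) (D' + E') := fun f => by
  rw [Subring.coe_add, Subring.coe_add, LinearMap.add_apply, LinearMap.add_apply, hD, hE, map_add]

theorem neg (hD : IsRescaling z D D') : IsRescaling z (-D) (-D') := fun f => by
  rw [Subring.coe_neg, Subring.coe_neg, LinearMap.neg_apply, LinearMap.neg_apply, hD, map_neg]

theorem mul (hD : IsRescaling z D D') (hE : IsRescaling z E E') :
    IsRescaling z (D * E) (D' * E') := fun f => by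
  rw [Subring.coe_mul, Subring.coe_mul, Module.End.mul_apply, Module.End.mul_apply, hE, hD]

theorem zero : IsRescaling z (0 : Dh r) 0 := fun f => by
  rw [Subring.coe_zero, LinearMap.zero_apply, LinearMap.zero_apply, map_zero]

theorem one : IsRescaling z (1 : Dh r) 1 := fun _ => rfl

theorem sum {ι : Type*} (s : Finset ι) {D D' : ι → Dh r} (h : ∀ i, IsRescaling z (D i) (D' i)) :
    IsRescaling z (∑ i ∈ s, D i) (∑ i ∈ s, D' i) := by
  classical
  induction s using Finset.induction_on with
  | empty => simpa using zero
  | insert a s ha ih => rw [Finset.sum_insert ha, Finset.sum_insert ha]; exact (h a).add ih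

theorem mulOp (f : QHRing r) : IsRescaling z (mulOp r f) (mulOp r (scaleH r z f)) := fun g => by
  rw [coe_mulOp, coe_mulOp, mulEnd_apply, mulEnd_apply, map_mul]

theorem hd (i : Fin r) :
    IsRescaling z (hd i) (QuantumDModule.mulOp r (scalar r (z ^ 2)) * QuantumDModule.hd i) :=
  fun g => by
    rw [Subring.coe_mul, Module.End.mul_apply, coe_mulOp, mulEnd_apply, coe_hd, hPartial_apply,
      hPartial_apply, scaleH_qDeriv, scalar_mul_eq_smul]

theorem unique (hz : z ≠ 0) (hD : IsRescaling z D D') (hE : IsRescaling z D E') : D' = E' := by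
  refine Subtype.ext (LinearMap.ext fun f => ?_)
  obtain ⟨g, rfl⟩ := scaleH_surjective r hz f
  rw [hD, hE]

theorem exists_rescaling (z : ℂ) (D : Dh r) : ∃ D', IsRescaling z D D' := by
  induction D using Dh_induction with
  | hmul f => exact ⟨_, mulOp f⟩
  | hhd i => exact ⟨_, hd i⟩
  | hadd D E hD hE => exact ⟨_, hD.choose_spec.add hE.choose_spec⟩
  | hneg D hD => exact ⟨_, hD.choose_spec.neg⟩
  | hprod D E hD hE => exact ⟨_, hD.choose_spec.mul hE.choose_spec⟩

end IsRescaling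

theorem mulOp_scalar_commute {r : ℕ} (z : ℂ) (D : Dh r) :
    D * mulOp r (scalar r z) = mulOp r (scalar r z) * D := by
  refine Subtype.ext (LinearMap.ext fun f => ?_)
  rw [Subring.coe_mul, Module.End.mul_apply, Subring.coe_mul, Module.End.mul_apply, coe_mulOp,
    mulEnd_apply, mulEnd_apply, scalar_mul_eq_smul, scalar_mul_eq_smul, map_smul]

theorem mulOp_scalar_mul_mul {r : ℕ} (a b : ℂ) (D E : Dh r) :
    mulOp r (scalar r a) * D * (mulOp r (scalar r b) * E) =
      mulOp r (scalar r (a * b)) * (D * E) := by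
  rw [mul_assoc, ← mul_assoc D, mulOp_scalar_commute, mul_assoc, ← mul_assoc, ← map_mul, ← map_mul]

theorem isRescaling_hdMonomial {r : ℕ} (z : ℂ) (α : Fin r →₀ ℕ) :
    IsRescaling z (hdMonomial α)
      (mulOp r (scalar r (z ^ (2 * α.degree))) * hdMonomial α) := by
  induction α using Finsupp.induction_linear with
  | zero =>
    rw [hdMonomial_zero, mul_one, map_zero, mul_zero, pow_zero, map_one, map_one]
    exact .one
  | add α β hα hβ =>
    have hmul : hdMonomial (α + β) = hdMonomial α * hdMonomial β := by
      refine Dh_ext fun n a => ?_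
      rw [Subring.coe_mul, Module.End.mul_apply, hdMonomial_monomial, hdMonomial_monomial,
        hdMonomial_monomial, ← mul_assoc, ← MvPolynomial.eval_mul, MvPolynomial.monomial_mul, one_mul]
    have h := hα.mul hβ
    rwa [mulOp_scalar_mul_mul, ← pow_add, ← mul_add, ← map_add, ← hmul] at h
  | single i k =>
    induction k with
    | zero =>
      rw [Finsupp.single_zero, hdMonomial_zero, mul_one, map_zero, mul_zero, pow_zero, map_one,
        map_one]
      exact .one
    | succ k ih =>
      have h := (IsRescaling.hd i).mul ih
      rw [mulOp_scalar_mul_mul, ← pow_add, hd_mul_hdMonomial, ← Finsupp.single_add,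
        Finsupp.degree_single] at h
      rw [add_comm k 1, Finsupp.degree_single, mul_add]
      exact h

theorem isRescaling_op {r : ℕ} (z : ℂ) {σ : BQHRing r} {n : ℕ} (hσ : IsHomogH σ n) :
    IsRescaling z (op σ) (mulOp r (scalar r (z ^ n)) * op σ) := by
  rw [op, Finset.mul_sum]
  refine .sum _ fun α => ?_
  have h := (IsRescaling.mulOp (z := z) (σ.coeff α)).mul (isRescaling_hdMonomial z α)
  suffices heq : scaleH r z (σ.coeff α) * scalar r (z ^ (2 * α.degree)) =
      scalar r (z ^ n) * σ.coeff α by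
    rw [← mul_assoc, ← map_mul, heq, map_mul, mul_assoc] at h
    exact h
  rw [mul_comm, scalar_mul_eq_smul, scalar_mul_eq_smul]
  refine QHRing_ext fun d k => ?_
  rw [MvPolynomial.coeff_smul, Polynomial.coeff_smul, MvPolynomial.coeff_smul,
    Polynomial.coeff_smul, coeff_scaleH, smul_eq_mul, smul_eq_mul, ← mul_assoc, ← pow_add]
  by_cases h : ((σ.coeff α).coeff d).coeff k = 0
  · rw [h, mul_zero, mul_zero]
  · rw [← hσ α d k h]
    ring

/-- Rescaling acts on D^h by conjugation, a ring automorphism under which the homogeneous generators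
of the ideal are eigenvectors. -/
theorem rescaling_mem_leftIdeal {r u : ℕ} {σ : Fin u → BQHRing r}
    (hσ : ∀ i, ∃ n, IsHomogH (σ i) n) {z : ℂ} (hz : z ≠ 0) {D D' : Dh r} (hD : D ∈ leftIdeal σ)
    (h : IsRescaling z D D') : D' ∈ leftIdeal σ := by
  rw [leftIdeal, Ideal.span] at hD
  induction hD using Submodule.span_induction generalizing D' with
  | mem x hx =>
    obtain ⟨i, rfl⟩ := hx
    obtain ⟨n, hn⟩ := hσ i
    rw [h.unique hz (isRescaling_op z hn)]
    exact Ideal.mul_mem_left _ _ (Ideal.subset_span ⟨i, rfl⟩)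
  | zero => rw [h.unique hz .zero]; exact zero_mem _
  | add x y _ _ hx hy =>
    obtain ⟨x', hx'⟩ := IsRescaling.exists_rescaling z x
    obtain ⟨y', hy'⟩ := IsRescaling.exists_rescaling z y
    rw [h.unique hz (hx'.add hy')]
    exact add_mem (hx hx') (hy hy')
  | smul a x _ hx =>
    obtain ⟨a', ha'⟩ := IsRescaling.exists_rescaling z a
    obtain ⟨x', hx'⟩ := IsRescaling.exists_rescaling z x
    rw [h.unique hz (ha'.mul hx')]
    exact Ideal.mul_mem_left _ _ (hx hx')

theorem mhClass_sum_mulOp_mul {r u n : ℕ} {σ : Fin u → BQHRing r} {m : Fin n → Fin r →₀ ℕ}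
    {P : Module.Basis (Fin n) (QHRing r) (Mh σ)} (hP : ∀ j, P j = mhClass σ (hdMonomial (m j)))
    (f : Fin n → QHRing r) :
    mhClass σ (∑ k, mulOp r (f k) * hdMonomial (m k)) = ∑ k, f k • P k := by
  rw [mhClass, ← Submodule.mkQ_apply, map_sum]
  refine Finset.sum_congr rfl fun k _ => ?_
  rw [Submodule.mkQ_apply, hP k]
  rfl

/-- The relation expressing h∂ᵢPⱼ in the basis is rescaled, which is allowed because the left ideal
is stable; coordinates are then compared. -/
theorem scaleH_hOmega {r u n : ℕ} {σ : Fin u → BQHRing r} {m : Fin n → Fin r →₀ ℕ}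
    {P : Module.Basis (Fin n) (QHRing r) (Mh σ)} (hP : ∀ j, P j = mhClass σ (hdMonomial (m j)))
    (hσ : ∀ i, ∃ n, IsHomogH (σ i) n) {z : ℂ} (hz : z ≠ 0) (i : Fin r) (k j : Fin n) :
    z ^ (2 + 2 * (m j).degree) • hOmega P i k j =
      z ^ (2 * (m k).degree) • scaleH r z (hOmega P i k j) := by
  have hmem := sub_sum_mem_leftIdeal P hP (hd i * hdMonomial (m j))
  rw [sub_eq_add_neg] at hmem
  have hresc := rescaling_mem_leftIdeal hσ hz hmem (((IsRescaling.hd i).mul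
    (isRescaling_hdMonomial z (m j))).add (IsRescaling.sum Finset.univ fun k =>
      (IsRescaling.mulOp _).mul (isRescaling_hdMonomial z (m k))).neg)
  have hlead : mulOp r (scalar r (z ^ 2)) * hd i *
      (mulOp r (scalar r (z ^ (2 * (m j).degree))) * hdMonomial (m j)) =
      scalar r (z ^ (2 + 2 * (m j).degree)) • (hd i * hdMonomial (m j)) := by
    rw [mulOp_scalar_mul_mul, ← pow_add, smul_Dh_def]
  simp only [← mul_assoc (mulOp r (scaleH r z _)), ← map_mul (mulOp r)] at hresc
  rw [hlead, ← sub_eq_add_neg, ← mhClass_eq_zero] at hresc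
  have heq : scalar r (z ^ (2 + 2 * (m j).degree)) • hd i • P j =
      ∑ k, (scaleH r z (hOmega P i k j) * scalar r (z ^ (2 * (m k).degree))) • P k := by
    have hsub : ∀ D E : Dh r, mhClass σ (D - E) = mhClass σ D - mhClass σ E := fun _ _ => rfl
    rw [hsub, mhClass_sum_mulOp_mul hP, mhClass_smul, mhClass_mul, ← hP, sub_eq_zero] at hresc
    exact hresc
  have hk := congrArg (fun x => P.repr x k) heq
  simp only [Module.Basis.repr_sum_self, map_smul, Finsupp.smul_apply, smul_eq_mul] at hk
  rw [mul_comm (scaleH _ _ _), scalar_mul_eq_smul, scalar_mul_eq_smul] at hk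
  exact hk

/-- If the relations are homogeneous, so are the entries of the connection matrices. -/
theorem hOmega_homogeneous {r u n : ℕ} {σ : Fin u → BQHRing r} {m : Fin n → Fin r →₀ ℕ}
    {P : Module.Basis (Fin n) (QHRing r) (Mh σ)} (hP : ∀ j, P j = mhClass σ (hdMonomial (m j)))
    (hσ : ∀ i, ∃ n, IsHomogH (σ i) n) (i : Fin r) (k j : Fin n) (d : Fin r →₀ ℕ) (l : ℕ)
    (h : ((hOmega P i k j).coeff d).coeff l ≠ 0) :
    2 * d.degree + l + (m k).degree = (m j).degree + 1 := by
  -- A single scaling factor z = 2 detects the degree, as distinct powers of 2 differ. The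
  -- conclusion uses half of each degree.
  have hc := congrArg (fun f : QHRing r => (f.coeff d).coeff l)
    (scaleH_hOmega hP hσ two_ne_zero i k j)
  simp only [MvPolynomial.coeff_smul, Polynomial.coeff_smul, smul_eq_mul, coeff_scaleH,
    ← mul_assoc, ← pow_add] at hc
  have hpow : (2 : ℕ) ^ (2 + 2 * (m j).degree) =
      2 ^ (2 * (m k).degree + (4 * d.degree + 2 * l)) := by
    exact_mod_cast mul_right_cancel₀ h hc
  have := Nat.pow_right_injective (le_refl 2) hpow
  lia

/-! ### Support conditions on matrices over `ℂ[q, h]` -/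

section Support

variable {r n : ℕ}

/-- Matrices over `ℂ[q, h]` in which the monomial `q^d h^l` may occur in the entry `(a, b)` only if
`S a b d l` holds. -/
def matSupp (S : Fin n → Fin n → (Fin r →₀ ℕ) → ℕ → Prop) :
    Submodule ℂ (Matrix (Fin n) (Fin n) (QHRing r)) where
  carrier := {M | ∀ a b d l, ((M a b).coeff d).coeff l ≠ 0 → S a b d l}
  zero_mem' a b d l h := absurd (by simp) h
  add_mem' {M N} hM hN a b d l h := by
    rw [Matrix.add_apply, MvPolynomial.coeff_add, Polynomial.coeff_add] at h
    by_cases h0 : ((M a b).coeff d).coeff l = 0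
    · rw [h0, zero_add] at h
      exact hN a b d l h
    · exact hM a b d l h0
  smul_mem' c M hM a b d l h := by
    rw [Matrix.smul_apply, MvPolynomial.coeff_smul, Polynomial.coeff_smul, smul_eq_mul] at h
    exact hM a b d l (right_ne_zero_of_mul h)

theorem mem_matSupp {S : Fin n → Fin n → (Fin r →₀ ℕ) → ℕ → Prop}
    {M : Matrix (Fin n) (Fin n) (QHRing r)} :
    M ∈ matSupp S ↔ ∀ a b d l, ((M a b).coeff d).coeff l ≠ 0 → S a b d l := Iff.rfl

theorem matSupp_mono {S T : Fin n → Fin n → (Fin r →₀ ℕ) → ℕ → Prop}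
    {M : Matrix (Fin n) (Fin n) (QHRing r)} (hM : M ∈ matSupp S)
    (h : ∀ a b d l, S a b d l → T a b d l) : M ∈ matSupp T :=
  fun a b d l hl => h a b d l (hM a b d l hl)

theorem mul_mem_matSupp {S T V : Fin n → Fin n → (Fin r →₀ ℕ) → ℕ → Prop}
    {M N : Matrix (Fin n) (Fin n) (QHRing r)} (hM : M ∈ matSupp S) (hN : N ∈ matSupp T)
    (h : ∀ a c b d₁ d₂ l₁ l₂, S a c d₁ l₁ → T c b d₂ l₂ → V a b (d₁ + d₂) (l₁ + l₂)) :
    M * N ∈ matSupp V := by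
  classical
  intro a b d l hl
  rw [Matrix.mul_apply, MvPolynomial.coeff_sum, Polynomial.finsetSum_coeff] at hl
  obtain ⟨c, -, hc⟩ := Finset.exists_ne_zero_of_sum_ne_zero hl
  rw [MvPolynomial.coeff_mul, Polynomial.finsetSum_coeff] at hc
  obtain ⟨⟨d₁, d₂⟩, hd, hc⟩ := Finset.exists_ne_zero_of_sum_ne_zero hc
  rw [Polynomial.coeff_mul] at hc
  obtain ⟨⟨l₁, l₂⟩, hl', hc⟩ := Finset.exists_ne_zero_of_sum_ne_zero hc
  rw [Finset.HasAntidiagonal.mem_antidiagonal] at hd hl'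
  dsimp only at hd hl' hc
  rw [← hd, ← hl']
  exact h a c b d₁ d₂ l₁ l₂ (hM _ _ _ _ (left_ne_zero_of_mul hc)) (hN _ _ _ _ (right_ne_zero_of_mul hc))

theorem one_mem_matSupp {S : Fin n → Fin n → (Fin r →₀ ℕ) → ℕ → Prop} (h : ∀ a, S a a 0 0) :
    (1 : Matrix (Fin n) (Fin n) (QHRing r)) ∈ matSupp S := by
  classical
  intro a b d l hl
  rw [Matrix.one_apply] at hl
  split_ifs at hl with hab
  · rw [MvPolynomial.coeff_one] at hl
    split_ifs at hl with hd
    · rw [Polynomial.coeff_one] at hl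
      split_ifs at hl with hl0
      · rw [← hab, ← hd, hl0]; exact h a
      · exact absurd rfl hl
    · simp at hl
  · simp at hl

theorem eq_zero_of_mem_matSupp {S : Fin n → Fin n → (Fin r →₀ ℕ) → ℕ → Prop}
    {M : Matrix (Fin n) (Fin n) (QHRing r)} (hM : M ∈ matSupp S) (h : ∀ a b d l, ¬ S a b d l) :
    M = 0 := by
  ext1 a b
  refine QHRing_ext fun d l => ?_
  by_contra hne
  exact h a b d l (hM a b d l (by simpa using hne))

/-- The operator `h qᵢ ∂/∂qᵢ` on matrices. -/
def hDer (i : Fin r) (M : Matrix (Fin n) (Fin n) (QHRing r)) : Matrix (Fin n) (Fin n) (QHRing r) :=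
  M.map fun f => hVar r * qDeriv i f

theorem coeff_hDer_zero (i : Fin r) (M : Matrix (Fin n) (Fin n) (QHRing r)) (a b : Fin n)
    (d : Fin r →₀ ℕ) : ((hDer i M a b).coeff d).coeff 0 = 0 := by
  rw [hDer, Matrix.map_apply, coeff_hVar_mul, Polynomial.coeff_X_mul_zero]

theorem coeff_hDer_succ (i : Fin r) (M : Matrix (Fin n) (Fin n) (QHRing r)) (a b : Fin n)
    (d : Fin r →₀ ℕ) (l : ℕ) :
    ((hDer i M a b).coeff d).coeff (l + 1) = (d i : ℂ) * ((M a b).coeff d).coeff l := by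
  rw [hDer, Matrix.map_apply, coeff_hVar_mul, Polynomial.coeff_X_mul, coeff_qDeriv,
    Polynomial.coeff_natCast_mul]

theorem hDer_add (i : Fin r) (M N : Matrix (Fin n) (Fin n) (QHRing r)) :
    hDer i (M + N) = hDer i M + hDer i N := by
  ext1 a b
  simp only [hDer, Matrix.map_apply, Matrix.add_apply, map_add, mul_add]

theorem hDer_sub (i : Fin r) (M N : Matrix (Fin n) (Fin n) (QHRing r)) :
    hDer i (M - N) = hDer i M - hDer i N := by
  ext1 a b
  simp only [hDer, Matrix.map_apply, Matrix.sub_apply, map_sub, mul_sub]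

theorem hDer_sum {ι : Type*} (s : Finset ι) (i : Fin r)
    (M : ι → Matrix (Fin n) (Fin n) (QHRing r)) :
    hDer i (∑ j ∈ s, M j) = ∑ j ∈ s, hDer i (M j) := by
  ext1 a b
  simp only [hDer, Matrix.map_apply, Matrix.sum_apply, map_sum, Finset.mul_sum]

theorem hDer_mul (i : Fin r) (M N : Matrix (Fin n) (Fin n) (QHRing r)) :
    hDer i (M * N) = hDer i M * N + M * hDer i N := by
  ext1 a b
  simp only [hDer, Matrix.map_apply, Matrix.add_apply, Matrix.mul_apply, map_sum, Finset.mul_sum,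
    ← Finset.sum_add_distrib, Derivation.leibniz, smul_eq_mul]
  exact Finset.sum_congr rfl fun c _ => by ring

theorem hDer_one (i : Fin r) : hDer i (1 : Matrix (Fin n) (Fin n) (QHRing r)) = 0 := by
  have h := hDer_mul i (1 : Matrix (Fin n) (Fin n) (QHRing r)) 1
  rwa [mul_one, mul_one, one_mul, left_eq_add] at h

theorem hDer_comm (i j : Fin r) (M : Matrix (Fin n) (Fin n) (QHRing r)) :
    hDer i (hDer j M) = hDer j (hDer i M) := by
  ext1 a b
  refine QHRing_ext fun d l => ?_
  rcases l with _ | _ | l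
  · rw [coeff_hDer_zero, coeff_hDer_zero]
  · rw [coeff_hDer_succ, coeff_hDer_succ, coeff_hDer_zero, coeff_hDer_zero, mul_zero, mul_zero]
  · simp only [coeff_hDer_succ]; ring

/-- The sum of all h qᵢ∂/∂qᵢ is h times the Euler operator in q. It shifts the h-degree by one and
is injective in positive q-degree; both facts drive the construction and the uniqueness of the gauge
transformation. -/
theorem coeff_sum_hDer_succ (M : Matrix (Fin n) (Fin n) (QHRing r)) (a b : Fin n)
    (d : Fin r →₀ ℕ) (l : ℕ) :
    (((∑ i, hDer i M) a b).coeff d).coeff (l + 1) = (d.degree : ℂ) * ((M a b).coeff d).coeff l := by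
  rw [Matrix.sum_apply, MvPolynomial.coeff_sum, Polynomial.finsetSum_coeff]
  simp only [coeff_hDer_succ]
  rw [← Finset.sum_mul, Finsupp.degree_eq_sum, Nat.cast_sum]

theorem hDer_mem_matSupp {S T : Fin n → Fin n → (Fin r →₀ ℕ) → ℕ → Prop} (i : Fin r)
    {M : Matrix (Fin n) (Fin n) (QHRing r)} (hM : M ∈ matSupp S)
    (h : ∀ a b d l, S a b d l → T a b d (l + 1)) : hDer i M ∈ matSupp T := by
  intro a b d l hl
  cases l with
  | zero => exact absurd (coeff_hDer_zero i M a b d) hl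
  | succ l =>
    rw [coeff_hDer_succ] at hl
    exact h _ _ _ _ (hM _ _ _ _ (right_ne_zero_of_mul hl))

theorem exists_hDegree_le (M : Matrix (Fin n) (Fin n) (QHRing r)) :
    ∃ N, M ∈ matSupp fun _ _ _ l => l ≤ N := by
  refine ⟨Finset.univ.sup fun a => Finset.univ.sup fun b => (M a b).support.sup fun d =>
    ((M a b).coeff d).natDegree, fun a b d l hl => ?_⟩
  have hd : d ∈ (M a b).support := by
    rw [MvPolynomial.mem_support_iff]
    rintro h
    simp [h] at hl
  calc l ≤ ((M a b).coeff d).natDegree := Polynomial.le_natDegree_of_ne_zero hl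
    _ ≤ (M a b).support.sup fun d => ((M a b).coeff d).natDegree :=
      Finset.le_sup (f := fun d => ((M a b).coeff d).natDegree) hd
    _ ≤ Finset.univ.sup fun b => (M a b).support.sup fun d => ((M a b).coeff d).natDegree :=
      Finset.le_sup (f := fun b => (M a b).support.sup fun d => ((M a b).coeff d).natDegree)
        (Finset.mem_univ b)
    _ ≤ _ := Finset.le_sup (f := fun a => Finset.univ.sup fun b => (M a b).support.sup fun d =>
        ((M a b).coeff d).natDegree) (Finset.mem_univ a)

/-- Splitting off the part of degree zero in `h`. -/
theorem exists_eq_add_hVar_smul (M : Matrix (Fin n) (Fin n) (QHRing r)) :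
    ∃ M', M = (M.map (hZero r)).map (constH r) + hVar r • M' ∧
      ∀ a b d l, ((M' a b).coeff d).coeff l = ((M a b).coeff d).coeff (l + 1) := by
  have h : ∀ a b, hVar r ∣ M a b - constH r (hZero r (M a b)) := fun a b =>
    hVar_dvd_of_hZero_eq_zero (by rw [map_sub, hZero_constH, sub_self])
  choose M' hM' using h
  refine ⟨Matrix.of M', ?_, fun a b d l => ?_⟩
  · ext1 a b
    rw [Matrix.add_apply, Matrix.map_apply, Matrix.map_apply, Matrix.smul_apply, Matrix.of_apply,
      smul_eq_mul, ← hM', add_sub_cancel]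
  · have := congrArg (fun f : QHRing r => (f.coeff d).coeff (l + 1)) (hM' a b)
    simp only [MvPolynomial.coeff_sub, Polynomial.coeff_sub, coeff_hVar_mul, Polynomial.coeff_X_mul,
      coeff_constH, Polynomial.coeff_C_succ, sub_zero] at this
    exact this.symm

theorem map_constH_map_hZero_mem {S T : Fin n → Fin n → (Fin r →₀ ℕ) → ℕ → Prop}
    {M : Matrix (Fin n) (Fin n) (QHRing r)} (hM : M ∈ matSupp S)
    (h : ∀ a b d, S a b d 0 → T a b d 0) : (M.map (hZero r)).map (constH r) ∈ matSupp T := by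
  intro a b d l hl
  rw [Matrix.map_apply, Matrix.map_apply, coeff_constH] at hl
  cases l with
  | zero =>
    rw [Polynomial.coeff_C_zero, coeff_hZero] at hl
    exact h _ _ _ (hM _ _ _ _ hl)
  | succ l => exact absurd (Polynomial.coeff_C_succ) hl

theorem map_constH_map_hZero_of_hDegree {M : Matrix (Fin n) (Fin n) (QHRing r)}
    (hM : M ∈ matSupp fun _ _ _ l => l = 0) : (M.map (hZero r)).map (constH r) = M := by
  ext1 a b
  refine QHRing_ext fun d l => ?_
  rw [Matrix.map_apply, Matrix.map_apply, coeff_constH]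
  cases l with
  | zero => rw [Polynomial.coeff_C_zero, coeff_hZero]
  | succ l =>
    rw [Polynomial.coeff_C_succ]
    by_contra h
    exact absurd (hM _ _ _ _ (Ne.symm h)) (Nat.succ_ne_zero l)

end Support

/-! ### The normalizing gauge transformation -/

section Gauge

variable {r n : ℕ}

/-- Entries `(a, b)` of degree `w b - w a + e`, where `deg qᵢ = 2`, `deg h = 1`. -/
def wtSupp (w : Fin n → ℕ) (e : ℕ) : Fin n → Fin n → (Fin r →₀ ℕ) → ℕ → Prop :=
  fun a b d l => 2 * d.degree + l + w a = w b + e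

theorem wtSupp_mul {w : Fin n → ℕ} {e e' : ℕ} {M N : Matrix (Fin n) (Fin n) (QHRing r)}
    (hM : M ∈ matSupp (wtSupp w e)) (hN : N ∈ matSupp (wtSupp w e')) :
    M * N ∈ matSupp (wtSupp w (e + e')) := by
  refine mul_mem_matSupp hM hN fun a c b d₁ d₂ l₁ l₂ h₁ h₂ => ?_
  simp only [wtSupp, map_add] at *
  lia

/-- Division with remainder by the operator `k h - [·, N]`. -/
theorem exists_division {w : Fin n → ℕ} {N : Matrix (Fin n) (Fin n) (QHRing r)}
    (hN : N ∈ matSupp (wtSupp w 1)) (hN0 : N ∈ matSupp fun _ _ d l => d.degree = 0 ∧ l = 0) {k : ℕ}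
    (hk : k ≠ 0) (K : ℕ) (E : Matrix (Fin n) (Fin n) (QHRing r)) (hE : E ∈ matSupp (wtSupp w 1))
    (hE' : E ∈ matSupp fun _ _ d l => d.degree = k ∧ l ≤ K) :
    ∃ L ∈ matSupp (wtSupp w 0), ∃ W ∈ matSupp (wtSupp w 1),
      L ∈ matSupp (fun _ _ d _ => d.degree = k) ∧
      W ∈ matSupp (fun _ _ d l => d.degree = k ∧ l = 0) ∧
      E = (k : ℂ) • hVar r • L - (L * N - N * L) + W := by
  induction K generalizing E with
  | zero =>
    exact ⟨0, zero_mem _, E, hE, zero_mem _, matSupp_mono hE' fun _ _ _ _ h => ⟨h.1, by lia⟩, by simp⟩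
  | succ K ih =>
    obtain ⟨E', hEE', hcoeff⟩ := exists_eq_add_hVar_smul E
    have h1 : E' ∈ matSupp (wtSupp w 0) := by
      intro a b d l hl
      rw [hcoeff] at hl
      have := hE _ _ _ _ hl
      simp only [wtSupp] at *
      lia
    have h2 : E' ∈ matSupp fun _ _ d l => d.degree = k ∧ l ≤ K := by
      intro a b d l hl
      rw [hcoeff] at hl
      have := hE' _ _ _ _ hl
      exact ⟨this.1, by lia⟩
    -- Writing E = E₀ + hE', the choice L₁ = E'/k absorbs hE'. The new error [L₁, N] has smaller
    -- h-degree because N does not involve h, so the induction hypothesis applies to it.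
    set L₁ := (k : ℂ)⁻¹ • E' with hL₁
    have h1' : L₁ ∈ matSupp (wtSupp w 0) := Submodule.smul_mem _ _ h1
    have h2' : L₁ ∈ matSupp fun _ _ d l => d.degree = k ∧ l ≤ K := Submodule.smul_mem _ _ h2
    obtain ⟨L₂, hL₂, W₂, hW₂, hL₂', hW₂', hE₂⟩ := ih (L₁ * N - N * L₁)
      (Submodule.sub_mem _ (wtSupp_mul h1' hN) (by simpa using wtSupp_mul hN h1'))
      (Submodule.sub_mem _
        (mul_mem_matSupp h2' hN0 fun _ _ _ _ _ _ _ h h' => ⟨by rw [map_add, h.1, h'.1, add_zero],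
          by rw [h'.2]; exact h.2⟩)
        (mul_mem_matSupp hN0 h2' fun _ _ _ _ _ _ _ h h' => ⟨by rw [map_add, h.1, h'.1, zero_add],
          by rw [h.2, zero_add]; exact h'.2⟩))
    refine ⟨L₁ + L₂, Submodule.add_mem _ h1' hL₂, (E.map (hZero r)).map (constH r) + W₂,
      Submodule.add_mem _ (map_constH_map_hZero_mem hE fun _ _ _ h => h) hW₂,
      Submodule.add_mem _ (matSupp_mono h2' fun _ _ _ _ h => h.1) hL₂',
      Submodule.add_mem _ (map_constH_map_hZero_mem hE' fun _ _ _ h => ⟨h.1, rfl⟩) hW₂', ?_⟩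
    have hkL : (k : ℂ) • hVar r • L₁ = hVar r • E' := by
      rw [hL₁, smul_comm, smul_smul, mul_inv_cancel₀ (Nat.cast_ne_zero.2 hk), one_smul]
    rw [smul_add, smul_add, hkL, add_mul, mul_add]
    nth_rw 1 [hEE']
    rw [eq_comm, ← sub_eq_zero]
    rw [← sub_eq_zero] at hE₂
    rw [← neg_eq_zero, ← hE₂]
    abel

/-- The coefficients of `q`-degree `k`. -/
theorem exists_homogeneous_component (k : ℕ) {S : Fin n → Fin n → (Fin r →₀ ℕ) → ℕ → Prop}
    {M : Matrix (Fin n) (Fin n) (QHRing r)} (hM : M ∈ matSupp S) :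
    ∃ E, E ∈ matSupp (fun a b d l => S a b d l ∧ d.degree = k) ∧
      M - E ∈ matSupp fun a b d l => S a b d l ∧ d.degree ≠ k := by
  classical
  refine ⟨M.map (MvPolynomial.homogeneousComponent k), fun a b d l hl => ?_, fun a b d l hl => ?_⟩
  · rw [Matrix.map_apply, MvPolynomial.coeff_homogeneousComponent] at hl
    split_ifs at hl with h
    · exact ⟨hM _ _ _ _ hl, h⟩
    · simp at hl
  · rw [Matrix.sub_apply, Matrix.map_apply, MvPolynomial.coeff_sub,
      MvPolynomial.coeff_homogeneousComponent] at hl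
    split_ifs at hl with h
    · simp at hl
    · rw [sub_zero] at hl
      exact ⟨hM _ _ _ _ hl, h⟩

variable {w : Fin n → ℕ} {A : Matrix (Fin n) (Fin n) (QHRing r)}

/-- Change of the error under a correction (L', W'). The first bracket is the linearized equation,
solved by division; in the application every remaining product has one factor of positive q-degree
besides the correction. -/
theorem gauge_error_identity {S : Type*} [Ring S] (A L L' D D' W W' N : S) :
    (L + L') * A - (D + D') - (W + W') * (L + L') =
      (L * A - D - W * L - (D' - (L' * N - N * L') + W')) + L' * (A - N) - W' * (L - 1) -
        (W - N) * L' - W' * L' := by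
  noncomm_ring

theorem gauge_sub_identity {S : Type*} [Ring S] {A L D W : S} (h : L * A - D = W * L) :
    W - A = (L - 1) * A - D - W * (L - 1) := by
  rw [mul_sub, mul_one, sub_mul, one_mul, ← h]
  abel

/-- Successive approximation in the q-degree: the lowest part of the error is removed by a
correction in that degree. The weight is preserved throughout, which later makes the procedure
finite. -/
theorem exists_gauge_mod (hA : A ∈ matSupp (wtSupp w 1))
    (hA0 : A ∈ matSupp fun _ _ d l => d.degree = 0 → l = 0) (K : ℕ) :
    ∃ L ∈ matSupp (wtSupp w 0), ∃ W ∈ matSupp (wtSupp w 1),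
      W ∈ matSupp (fun _ _ _ l => l = 0) ∧ L - 1 ∈ matSupp (fun _ _ d _ => 1 ≤ d.degree) ∧
      W - A ∈ matSupp (fun _ _ d _ => 1 ≤ d.degree) ∧
      L * A - ∑ i, hDer i L - W * L ∈ matSupp (fun _ _ d _ => K + 1 ≤ d.degree) := by
  -- N is the restriction of A to q = 0; it does not involve h by `hA0`, as required for the
  -- division.
  obtain ⟨N, hN, hAN⟩ := exists_homogeneous_component 0
    (S := fun a b d l => wtSupp w 1 a b d l ∧ (d.degree = 0 → l = 0)) (M := A)
    fun a b d l hl => ⟨hA a b d l hl, hA0 a b d l hl⟩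
  have hN1 : N ∈ matSupp (wtSupp w 1) := matSupp_mono hN fun _ _ _ _ h => h.1.1
  have hN0 : N ∈ matSupp fun _ _ d l => d.degree = 0 ∧ l = 0 :=
    matSupp_mono hN fun _ _ _ _ h => ⟨h.2, h.1.2 h.2⟩
  have hAN' : A - N ∈ matSupp fun _ _ d _ => 1 ≤ d.degree :=
    matSupp_mono hAN fun _ _ _ _ h => Nat.one_le_iff_ne_zero.2 h.2
  have hone : (1 : Matrix (Fin n) (Fin n) (QHRing r)) ∈ matSupp (wtSupp w 0) :=
    one_mem_matSupp fun a => by simp [wtSupp]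
  induction K with
  | zero =>
    refine ⟨1, hone, N, hN1, matSupp_mono hN0 fun _ _ _ _ h => h.2, ?_, ?_, ?_⟩
    · rw [sub_self]; exact zero_mem _
    · rw [← neg_sub]; exact neg_mem hAN'
    · simpa [hDer_one] using hAN'
  | succ K ih =>
    obtain ⟨L, hL, W, hW, hW0, hL1, hWA, hErr⟩ := ih
    set Err := L * A - ∑ i, hDer i L - W * L with hErrdef
    have hErrwt : Err ∈ matSupp (wtSupp w 1) := by
      refine Submodule.sub_mem _ (Submodule.sub_mem _ (by simpa using wtSupp_mul hL hA)
        (Submodule.sum_mem _ fun i _ => hDer_mem_matSupp i hL fun a b d l h => ?_))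
        (wtSupp_mul hW hL)
      simp only [wtSupp] at *
      lia
    obtain ⟨E, hE, hErrE⟩ := exists_homogeneous_component (K + 1)
      (S := fun a b d l => wtSupp w 1 a b d l ∧ K + 1 ≤ d.degree) (M := Err)
      fun a b d l hl => ⟨hErrwt a b d l hl, hErr a b d l hl⟩
    obtain ⟨B, hB⟩ := exists_hDegree_le E
    -- The multiples of (K+1)h − [·, N] in E go into L, and the h-free remainder goes into W.
    obtain ⟨L', hL', W', hW', hL'k, hW'k, hdiv⟩ := exists_division hN1 hN0 (Nat.succ_ne_zero K) B E
      (matSupp_mono hE fun _ _ _ _ h => h.1.1)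
      (fun a b d l hl => ⟨(hE a b d l hl).2, hB a b d l hl⟩)
    have hL'1 : L' ∈ matSupp fun _ _ d _ => 1 ≤ d.degree :=
      matSupp_mono hL'k fun _ _ _ _ h => by rw [h]; lia
    have hW'1 : W' ∈ matSupp fun _ _ d _ => 1 ≤ d.degree :=
      matSupp_mono hW'k fun _ _ _ _ h => by rw [h.1]; lia
    have hmul : ∀ {M M' : Matrix (Fin n) (Fin n) (QHRing r)},
        M ∈ matSupp (fun _ _ d _ => 1 ≤ d.degree) →
        M' ∈ matSupp (fun _ _ d _ => d.degree = K + 1) →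
        M * M' ∈ matSupp (fun _ _ d _ => K + 1 + 1 ≤ d.degree) ∧
        M' * M ∈ matSupp (fun _ _ d _ => K + 1 + 1 ≤ d.degree) := fun hM hM' =>
      ⟨mul_mem_matSupp hM hM' fun _ _ _ _ _ _ _ h h' => by rw [map_add]; lia,
        mul_mem_matSupp hM' hM fun _ _ _ _ _ _ _ h h' => by rw [map_add]; lia⟩
    have hW'k' : W' ∈ matSupp (fun _ _ d _ => d.degree = K + 1) :=
      matSupp_mono hW'k fun _ _ _ _ h => h.1
    have hWN : W - N ∈ matSupp fun _ _ d _ => 1 ≤ d.degree := by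
      have := add_mem hWA hAN'
      rwa [sub_add_sub_cancel] at this
    have hder : ∑ i, hDer i L' = ((K + 1 : ℕ) : ℂ) • hVar r • L' := by
      ext1 a b
      refine QHRing_ext fun d l => ?_
      rw [Matrix.smul_apply, Matrix.smul_apply, MvPolynomial.coeff_smul, Polynomial.coeff_smul,
        smul_eq_mul, smul_eq_mul, coeff_hVar_mul]
      cases l with
      | zero =>
        rw [Polynomial.coeff_X_mul_zero, mul_zero, Matrix.sum_apply, MvPolynomial.coeff_sum,
          Polynomial.finsetSum_coeff]
        exact Finset.sum_eq_zero fun i _ => coeff_hDer_zero i L' a b d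
      | succ l =>
        rw [coeff_sum_hDer_succ, Polynomial.coeff_X_mul]
        by_cases h : ((L' a b).coeff d).coeff l = 0
        · rw [h, mul_zero, mul_zero]
        · rw [hL'k _ _ _ _ h]
    refine ⟨L + L', add_mem hL hL', W + W', add_mem hW hW',
      add_mem hW0 (matSupp_mono hW'k fun _ _ _ _ h => h.2), ?_, ?_, ?_⟩
    · rw [add_sub_right_comm]; exact add_mem hL1 hL'1
    · rw [add_sub_right_comm]; exact add_mem hWA hW'1
    · have key : (L + L') * A - ∑ i, hDer i (L + L') - (W + W') * (L + L') =
          (Err - E) + L' * (A - N) - W' * (L - 1) - (W - N) * L' - W' * L' := by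
        simp only [hDer_add, Finset.sum_add_distrib, hder]
        rw [hErrdef, hdiv]
        exact gauge_error_identity _ _ _ _ _ _ _ _
      rw [key]
      refine sub_mem (sub_mem (sub_mem (add_mem ?_ (hmul hAN' hL'k).2) (hmul hL1 hW'k').2)
        (hmul hWN hL'k).1) (hmul hW'1 hL'k).1
      exact matSupp_mono hErrE fun _ _ _ _ h => by lia

/-- Nonnegativity of degrees makes L block triangular for the grading `w`. Inside a diagonal block
the entries have degree zero, hence agree with the identity, and the determinant is 1. -/
theorem isUnit_of_wtSupp {L : Matrix (Fin n) (Fin n) (QHRing r)} (hL : L ∈ matSupp (wtSupp w 0))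
    (hL1 : L - 1 ∈ matSupp (fun _ _ d _ => 1 ≤ d.degree)) : IsUnit L := by
  rw [Matrix.isUnit_iff_isUnit_det]
  have htri : L.BlockTriangular w := by
    intro a b hab
    refine QHRing_ext fun d l => ?_
    by_contra h
    have := hL a b d l (by simpa using h)
    simp only [wtSupp] at this
    lia
  rw [htri.det]
  have hblock : ∀ c, L.toSquareBlock w c = 1 := by
    intro c
    ext1 ⟨a, ha⟩ ⟨b, hb⟩
    rw [Matrix.toSquareBlock_def, Matrix.of_apply]
    have h1 : (1 : Matrix {a // w a = c} {a // w a = c} (QHRing r)) ⟨a, ha⟩ ⟨b, hb⟩ =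
        (1 : Matrix (Fin n) (Fin n) (QHRing r)) a b := by
      simp [Matrix.one_apply]
    rw [h1, ← sub_eq_zero, ← Matrix.sub_apply]
    refine QHRing_ext fun d l => ?_
    by_contra h
    have hne : (((L - 1) a b).coeff d).coeff l ≠ 0 := by simpa using h
    have h2 := hL1 a b d l hne
    have h3 := sub_mem hL (one_mem_matSupp (r := r) fun a => by simp [wtSupp]) a b d l hne
    simp only [wtSupp] at h3
    lia
  simp [hblock]

/-- The approximation becomes exact: the error has weight 1, so 2|d| ≤ w b + 1 in the entry (a, b),
which is incompatible with a q-degree beyond max w + 1. This is why the gauge transformation is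
polynomial. -/
theorem exists_euler_gauge (hA : A ∈ matSupp (wtSupp w 1))
    (hA0 : A ∈ matSupp fun _ _ d l => d.degree = 0 → l = 0) :
    ∃ L ∈ matSupp (wtSupp w 0), ∃ W ∈ matSupp (fun _ _ _ l => l = 0),
      L - 1 ∈ matSupp (fun _ _ d _ => 1 ≤ d.degree) ∧ L * A - ∑ i, hDer i L = W * L := by
  obtain ⟨L, hL, W, hW, hW0, hL1, -, hErr⟩ :=
    exists_gauge_mod hA hA0 (Finset.univ.sup w + 1)
  refine ⟨L, hL, W, hW0, hL1, ?_⟩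
  rw [← sub_eq_zero]
  have hwt : L * A - ∑ i, hDer i L - W * L ∈ matSupp (wtSupp w 1) := by
    refine Submodule.sub_mem _ (Submodule.sub_mem _ (by simpa using wtSupp_mul hL hA)
      (Submodule.sum_mem _ fun i _ => hDer_mem_matSupp i hL fun a b d l h => ?_))
      (wtSupp_mul hW hL)
    simp only [wtSupp] at *
    lia
  refine eq_zero_of_mem_matSupp (S := fun a b d l => wtSupp w 1 a b d l ∧
    Finset.univ.sup w + 1 + 1 ≤ d.degree) (fun a b d l h => ⟨hwt a b d l h, hErr a b d l h⟩) ?_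
  rintro a b d l ⟨h, h'⟩
  have hb : w b ≤ Finset.univ.sup w := Finset.le_sup (f := w) (Finset.mem_univ b)
  simp only [wtSupp] at h
  lia

/-- Gauge transformations preserve flatness. -/
theorem flat_of_gauge {L : Matrix (Fin n) (Fin n) (QHRing r)} (hL : IsUnit L)
    {A W : Fin r → Matrix (Fin n) (Fin n) (QHRing r)}
    (hflat : ∀ i j, A i * A j + hDer i (A j) = A j * A i + hDer j (A i))
    (hW : ∀ i, L * A i - hDer i L = W i * L) (i j : Fin r) :
    W i * W j + hDer i (W j) = W j * W i + hDer j (W i) := by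
  -- The terms on the right other than the first are symmetric in i and j, and the first becomes so
  -- by flatness of A.
  have key : ∀ i j, (W i * W j + hDer i (W j)) * L = L * (A i * A j + hDer i (A j)) -
      (W i * hDer j L + W j * hDer i L) - hDer i (hDer j L) := by
    intro i j
    have h1 : hDer i (W j) * L = hDer i (W j * L) - W j * hDer i L := by
      rw [hDer_mul, add_sub_cancel_right]
    rw [add_mul, h1, ← hW, mul_assoc, ← hW j, hDer_sub, hDer_mul]
    have h2 := hW i
    rw [sub_eq_iff_eq_add] at h2
    have h3 : W i * (L * A j) = L * A i * A j - hDer i L * A j := by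
      rw [h2]; noncomm_ring
    rw [mul_sub, h3]
    noncomm_ring
  refine hL.mul_left_injective ?_
  change (W i * W j + hDer i (W j)) * L = (W j * W i + hDer j (W i)) * L
  rw [key, key, hflat i j, hDer_comm, add_comm (W i * hDer j L)]

/-- A flat homogeneous connection whose restriction to `q = 0` does not depend on `h` is
polynomially gauge equivalent to one that does not depend on `h`. -/
theorem exists_normalizing_gauge {A : Fin r → Matrix (Fin n) (Fin n) (QHRing r)}
    (hflat : ∀ i j, A i * A j + hDer i (A j) = A j * A i + hDer j (A i))
    (hA : ∀ i, A i ∈ matSupp (wtSupp w 1))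
    (hA0 : ∀ i, A i ∈ matSupp fun _ _ d l => d.degree = 0 → l = 0) :
    ∃ L ∈ matSupp (wtSupp w 0), IsUnit L ∧ L - 1 ∈ matSupp (fun _ _ d _ => 1 ≤ d.degree) ∧
      ∃ W : Fin r → Matrix (Fin n) (Fin n) (QHRing r), (∀ i, W i ∈ matSupp fun _ _ _ l => l = 0) ∧
        ∀ i, L * A i - hDer i L = W i * L := by
  -- Only the Euler component is normalized; the other components follow from flatness.
  obtain ⟨L, hL, V, hV, hL1, hE⟩ := exists_euler_gauge (A := ∑ i, A i)
    (Submodule.sum_mem _ fun i _ => hA i) (Submodule.sum_mem _ fun i _ => hA0 i)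
  have hunit := isUnit_of_wtSupp hL hL1
  obtain ⟨L', hL'⟩ : ∃ L', L' * L = 1 := ⟨_, Matrix.nonsing_inv_mul _
    ((Matrix.isUnit_iff_isUnit_det _).1 hunit)⟩
  obtain ⟨W, hW⟩ : ∃ W : Fin r → Matrix (Fin n) (Fin n) (QHRing r),
      ∀ i, L * A i - hDer i L = W i * L :=
    ⟨fun i => (L * A i - hDer i L) * L', fun i => by rw [mul_assoc, hL', mul_one]⟩
  refine ⟨L, hL, hunit, hL1, W, fun i => ?_, hW⟩
  have hflatW := flat_of_gauge hunit hflat hW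
  have hsumW : ∑ j, W j = V := by
    refine hunit.mul_left_injective ?_
    change (∑ j, W j) * L = V * L
    rw [← hE, Finset.sum_mul, Finset.mul_sum, ← Finset.sum_sub_distrib]
    exact Finset.sum_congr rfl fun j _ => (hW j).symm
  -- Flatness summed over j: an evolution equation for Wᵢ in the Euler direction, in which V = ∑ Wⱼ
  -- is free of h.
  have heuler : ∑ j, hDer j (W i) = W i * V + hDer i V - V * W i := by
    have := Finset.sum_congr (rfl : (Finset.univ : Finset (Fin r)) = _) fun j _ => hflatW i j
    rw [Finset.sum_add_distrib, Finset.sum_add_distrib, ← Finset.mul_sum, ← Finset.sum_mul,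
      ← hDer_sum, hsumW] at this
    exact eq_sub_iff_add_eq'.2 this.symm
  have hW0 : W i ∈ matSupp fun _ _ d l => d.degree = 0 → l = 0 := by
    have hdiff : W i - A i = (L - 1) * A i - hDer i L - W i * (L - 1) :=
      gauge_sub_identity (hW i)
    have hLd : hDer i L ∈ matSupp fun _ _ d _ => 1 ≤ d.degree := by
      rw [← sub_zero (hDer i L), ← hDer_one i, ← hDer_sub]
      exact hDer_mem_matSupp i hL1 fun _ _ _ _ h => h
    have htriv : ∀ M : Matrix (Fin n) (Fin n) (QHRing r), M ∈ matSupp fun _ _ _ _ => True :=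
      fun M _ _ _ _ _ => trivial
    have h1 : W i - A i ∈ matSupp fun _ _ d _ => 1 ≤ d.degree := by
      rw [hdiff]
      exact sub_mem (sub_mem (mul_mem_matSupp hL1 (htriv _) fun _ _ _ _ _ _ _ h _ => by
        rw [map_add]; lia) hLd) (mul_mem_matSupp (htriv _) hL1 fun _ _ _ _ _ _ _ _ h => by
        rw [map_add]; lia)
    rw [← sub_add_cancel (W i) (A i)]
    exact add_mem (matSupp_mono h1 fun _ _ _ _ h h' => by lia) (hA0 i)
  obtain ⟨N, hN⟩ := exists_hDegree_le (W i)
  -- Descent on the h-degree. In `heuler` the left side raises the degree by one and the right side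
  -- does not, so |d| times the top coefficient vanishes. At d = 0 the matrix Wᵢ coincides with Aᵢ,
  -- which has no h there.
  induction N with
  | zero => exact matSupp_mono hN fun _ _ _ _ h => Nat.le_zero.1 h
  | succ N ih =>
    refine ih fun a b d l hl => ?_
    by_contra hlN
    have hle := hN a b d l hl
    obtain rfl : l = N + 1 := by lia
    have hcoeff := coeff_sum_hDer_succ (W i) a b d (N + 1)
    have hmem : W i * V + hDer i V - V * W i ∈ matSupp fun _ _ _ l => l ≤ N + 1 :=
      sub_mem (add_mem (mul_mem_matSupp hN hV fun _ _ _ _ _ _ _ h h' => by lia)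
        (hDer_mem_matSupp i hV fun _ _ _ _ h => by lia))
        (mul_mem_matSupp hV hN fun _ _ _ _ _ _ _ h h' => by lia)
    rw [heuler] at hcoeff
    have hzero : (((W i * V + hDer i V - V * W i) a b).coeff d).coeff (N + 1 + 1) = 0 := by
      by_contra h
      have := hmem a b d _ h
      lia
    rw [hzero, eq_comm, mul_eq_zero] at hcoeff
    rcases hcoeff with h | h
    · have := hW0 a b d _ hl (by exact_mod_cast h)
      lia
    · exact hl h

/-- The coefficient of `h^l` in an element of `ℂ[q, h]`. -/
def hCoeff (l : ℕ) (f : QHRing r) : QRing r :=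
  ∑ d ∈ f.support, MvPolynomial.monomial d ((f.coeff d).coeff l)

theorem coeff_hCoeff (l : ℕ) (f : QHRing r) (d : Fin r →₀ ℕ) :
    (hCoeff l f).coeff d = (f.coeff d).coeff l := by
  classical
  rw [hCoeff, MvPolynomial.coeff_sum]
  simp only [MvPolynomial.coeff_monomial, Finset.sum_ite_eq']
  split_ifs with h
  · rfl
  · rw [MvPolynomial.notMem_support_iff.1 h, Polynomial.coeff_zero]

theorem hCoeff_constH_mul (l : ℕ) (g : QRing r) (f : QHRing r) :
    hCoeff l (constH r g * f) = g * hCoeff l f := by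
  classical
  ext d
  rw [coeff_hCoeff, MvPolynomial.coeff_mul, MvPolynomial.coeff_mul, Polynomial.finsetSum_coeff]
  exact Finset.sum_congr rfl fun x _ => by
    rw [coeff_constH, Polynomial.coeff_C_mul, coeff_hCoeff]

/-- Since ℂ[q] is a domain, multiplication by a nonzero polynomial in q alone kills no coefficient
in h. This permits clearing denominators such as det B₀. -/
theorem hDegree_le_of_constH_smul {g : QRing r} (hg : g ≠ 0)
    {M : Matrix (Fin n) (Fin n) (QHRing r)} {N : ℕ}
    (h : constH r g • M ∈ matSupp fun _ _ _ l => l ≤ N) : M ∈ matSupp fun _ _ _ l => l ≤ N := by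
  intro a b d l hl
  by_contra hlN
  have hzero : hCoeff l (constH r g * M a b) = 0 := by
    ext d
    rw [coeff_hCoeff, MvPolynomial.coeff_zero]
    by_contra hne
    exact hlN (h a b d l hne)
  rw [hCoeff_constH_mul, mul_eq_zero, or_iff_right hg] at hzero
  rw [← coeff_hCoeff, hzero, MvPolynomial.coeff_zero] at hl
  exact hl rfl

/-- Uniqueness of the normalized gauge transformation. -/
theorem eq_one_of_gauge {X : Matrix (Fin n) (Fin n) (QHRing r)} {g : QRing r} (hg : g ≠ 0)
    {V Z : Matrix (Fin n) (Fin n) (QHRing r)} (hV : V ∈ matSupp fun _ _ _ l => l = 0)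
    (hZ : Z ∈ matSupp fun _ _ _ l => l = 0) (hX : X.map (qZeroH r) = 1)
    (h : constH r g • ∑ i, hDer i X = constH r g • (X * V) - Z * X) : X = 1 := by
  classical
  have hX0 : ∀ a b, (X a b).coeff 0 = (1 : Matrix (Fin n) (Fin n) (Polynomial ℂ)) a b := by
    intro a b
    rw [← hX, Matrix.map_apply, qZeroH_apply]
  -- The Euler operator would produce h^(N+1) from a top coefficient at d ≠ 0, while the right side
  -- of the equation has h-degree at most N. So the top coefficient lives at q = 0, where X is the
  -- identity.
  have htop : ∀ N, X ∈ matSupp (fun _ _ _ l => l ≤ N) →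
      ∀ a b d, ((X a b).coeff d).coeff N ≠ 0 → d = 0 := by
    intro N hN a b d hne
    have hS : ∑ i, hDer i X ∈ matSupp fun _ _ _ l => l ≤ N := by
      refine hDegree_le_of_constH_smul hg ?_
      rw [h, ← Matrix.smul_mul]
      refine sub_mem (mul_mem_matSupp (S := fun _ _ _ l => l ≤ N) ?_ hV fun _ _ _ _ _ _ _ h h' => by lia)
        (mul_mem_matSupp hZ hN fun _ _ _ _ _ _ _ h h' => by lia)
      intro a b d l hl
      by_contra hlN
      have : hCoeff l (constH r g * X a b) = 0 := by
        rw [hCoeff_constH_mul]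
        convert! mul_zero g
        ext d
        rw [coeff_hCoeff, MvPolynomial.coeff_zero]
        by_contra hne
        exact hlN (hN a b d l hne)
      rw [Matrix.smul_apply, smul_eq_mul, ← coeff_hCoeff, this, MvPolynomial.coeff_zero] at hl
      exact hl rfl
    have hc := coeff_sum_hDer_succ X a b d N
    have hz : (((∑ i, hDer i X) a b).coeff d).coeff (N + 1) = 0 := by
      by_contra hne
      have := hS a b d _ hne
      lia
    rw [hz, eq_comm, mul_eq_zero, or_iff_left hne, Nat.cast_eq_zero, Finsupp.degree_eq_zero_iff] at hc
    exact hc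
  obtain ⟨N, hN⟩ := exists_hDegree_le X
  induction N with
  | zero =>
    rw [← sub_eq_zero]
    ext1 a b
    refine QHRing_ext fun d l => ?_
    rw [Matrix.sub_apply, MvPolynomial.coeff_sub, Polynomial.coeff_sub, Matrix.zero_apply,
      MvPolynomial.coeff_zero, Polynomial.coeff_zero, sub_eq_zero]
    by_cases hd : d = 0
    · rw [hd, hX0, Matrix.one_apply, Matrix.one_apply]
      split_ifs <;> simp
    · have h1 : (((1 : Matrix (Fin n) (Fin n) (QHRing r)) a b).coeff d).coeff l = 0 := by
        rw [Matrix.one_apply]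
        split_ifs
        · rw [MvPolynomial.coeff_one, if_neg (Ne.symm hd), Polynomial.coeff_zero]
        · simp
      rw [h1]
      by_contra hne
      obtain rfl : l = 0 := Nat.le_zero.1 (hN a b d l hne)
      exact hd (htop 0 hN a b d hne)
  | succ N ih =>
    refine ih fun a b d l hl => ?_
    by_contra hlN
    obtain rfl : l = N + 1 := by
      have := hN a b d l hl
      lia
    have hd := htop _ hN a b d hl
    rw [hd, hX0, Matrix.one_apply] at hl
    split_ifs at hl
    · rw [Polynomial.coeff_one, if_neg (Nat.succ_ne_zero N)] at hl
      exact hl rfl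
    · exact hl (Polynomial.coeff_zero _)

end Gauge

/-! ### Fourier coefficients of functions on the circle -/

section CircleCoeff

open Real MeasureTheory

/-- `2π` times the `k`-th Fourier coefficient of a function on the unit circle. -/
def circleCoeff (k : ℤ) (g : Circle → ℂ) : ℂ :=
  ∫ θ in (0 : ℝ)..2 * π, (Circle.exp θ : ℂ) ^ (-k) * g (Circle.exp θ)

theorem circleCoeff_zpow_mul (k j : ℤ) (g : Circle → ℂ) :
    circleCoeff k (fun h => (h : ℂ) ^ j * g h) = circleCoeff (k - j) g := by
  refine intervalIntegral.integral_congr fun θ _ => ?_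
  dsimp only
  rw [← mul_assoc, ← zpow_add₀ (Circle.coe_ne_zero _)]
  congr 2
  ring

theorem continuous_zpow_circleExp (k : ℤ) : Continuous fun θ : ℝ => (Circle.exp θ : ℂ) ^ k :=
  (continuous_subtype_val.comp Circle.exp.continuous).zpow₀ k fun _ => Or.inl (Circle.coe_ne_zero _)

theorem circleCoeff_sub (k : ℤ) {f g : Circle → ℂ} (hf : Continuous fun θ : ℝ => f (Circle.exp θ))
    (hg : Continuous fun θ : ℝ => g (Circle.exp θ)) :
    circleCoeff k (fun h => f h - g h) = circleCoeff k f - circleCoeff k g := by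
  rw [circleCoeff, circleCoeff, circleCoeff, ← intervalIntegral.integral_sub]
  · simp only [mul_sub]
  · exact ((continuous_zpow_circleExp _).mul hf).intervalIntegrable _ _
  · exact ((continuous_zpow_circleExp _).mul hg).intervalIntegrable _ _

theorem circleMap_zero_one_eq (θ : ℝ) : circleMap 0 1 θ = Circle.exp θ := by
  rw [circleMap, Circle.coe_exp, zero_add, Complex.ofReal_one, one_mul]

/-- Cauchy's theorem for z^j F with j = −k − 1; the missing power of z comes from dz = i z dθ. -/
theorem circleCoeff_disc_of_neg {F : ℂ → ℂ} (hF : DiffContOnCl ℂ F (Metric.ball 0 1)) {k : ℤ}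
    (hk : k < 0) : circleCoeff k (fun h => F h) = 0 := by
  obtain ⟨j, hj⟩ : ∃ j : ℕ, -k = j + 1 := ⟨(-k - 1).toNat, by lia⟩
  have hd : DiffContOnCl ℂ (fun z => z ^ j • F z) (Metric.ball 0 1) :=
    (Differentiable.diffContOnCl (by fun_prop)).smul hF
  have h := hd.circleIntegral_eq_zero zero_le_one
  rw [circleIntegral] at h
  have h' : Complex.I * circleCoeff k (fun h => F h) = 0 := by
    rw [← h, circleCoeff, ← intervalIntegral.integral_const_mul]
    refine intervalIntegral.integral_congr fun θ _ => ?_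
    rw [deriv_circleMap, circleMap_zero_one_eq, hj, smul_eq_mul, smul_eq_mul, zpow_add_one₀
      (Circle.coe_ne_zero _), zpow_natCast]
    ring
  exact (mul_eq_zero.1 h').resolve_left Complex.I_ne_zero

theorem circleCoeff_disc_zero {F : ℂ → ℂ} (hF : DiffContOnCl ℂ F (Metric.ball 0 1)) :
    circleCoeff 0 (fun h => F h) = 2 * π * F 0 := by
  have h := hF.circleIntegral_sub_inv_smul (Metric.mem_ball_self one_pos)
  rw [circleIntegral] at h
  refine mul_left_cancel₀ Complex.I_ne_zero ?_
  have h2 : Complex.I * (2 * π * F 0) = (2 * π * Complex.I : ℂ) • F 0 := by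
    rw [smul_eq_mul]; ring
  rw [h2, ← h, circleCoeff, ← intervalIntegral.integral_const_mul]
  refine intervalIntegral.integral_congr fun θ _ => ?_
  rw [deriv_circleMap, circleMap_zero_one_eq, neg_zero, zpow_zero, smul_eq_mul, smul_eq_mul,
    sub_zero]
  have := Circle.coe_ne_zero (Circle.exp θ)
  field_simp

theorem circleCoeff_comp_inv (k : ℤ) (g : Circle → ℂ) :
    circleCoeff k (fun h => g h⁻¹) = circleCoeff (-k) g := by
  have hper : Function.Periodic (fun θ : ℝ => (Circle.exp θ : ℂ) ^ (- -k) * g (Circle.exp θ))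
      (2 * π) := fun θ => by
    dsimp only
    rw [Circle.periodic_exp θ]
  have h := hper.intervalIntegral_add_eq (-(2 * π)) 0
  rw [neg_add_cancel, zero_add] at h
  rw [circleCoeff, circleCoeff, ← h]
  have h2 := intervalIntegral.integral_comp_neg (a := 0) (b := 2 * π)
    (fun θ : ℝ => (Circle.exp θ : ℂ) ^ (- -k) * g (Circle.exp θ))
  rw [neg_zero] at h2
  rw [← h2]
  refine intervalIntegral.integral_congr fun θ _ => ?_
  rw [Circle.exp_neg, Circle.coe_inv, inv_zpow', neg_neg]

/-- A Fourier series with zero coefficients is summable, so it converges pointwise to the continuous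
function it comes from. -/
theorem eq_zero_of_circleCoeff_eq_zero {g : Circle → ℂ}
    (hg : Continuous fun θ : ℝ => g (Circle.exp θ)) (h : ∀ k, circleCoeff k g = 0) (x : Circle) :
    g x = 0 := by
  have : Fact (0 < 2 * π) := ⟨Real.two_pi_pos⟩
  have hmk : ∀ θ : ℝ, AddCircle.toCircle (T := 2 * π) (θ : AddCircle (2 * π)) = Circle.exp θ := by
    intro θ
    rw [AddCircle.toCircle_apply_mk, div_self Real.two_pi_pos.ne', one_mul]
  have hcont : Continuous fun y : AddCircle (2 * π) => g (AddCircle.toCircle y) := by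
    refine (QuotientAddGroup.isQuotientMap_mk (N := AddSubgroup.zmultiples (2 * π))).continuous_iff.2 ?_
    convert! hg using 2 with θ
    exact congrArg g (hmk θ)
  let f : C(AddCircle (2 * π), ℂ) := ⟨_, hcont⟩
  have hcoeff : fourierCoeff f = 0 := by
    ext k
    rw [fourierCoeff_eq_intervalIntegral _ _ 0, zero_add, Pi.zero_apply]
    convert! smul_zero (1 / (2 * π))
    rw [← h k, circleCoeff]
    refine intervalIntegral.integral_congr fun θ _ => ?_
    rw [smul_eq_mul, fourier_apply, AddCircle.toCircle_zsmul, hmk, Circle.coe_zpow]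
    congr 1
    exact congrArg g (hmk θ)
  have hsum := has_pointwise_sum_fourier_series_of_summable (f := f)
    (by rw [hcoeff]; exact summable_zero) ((Complex.arg x : ℝ) : AddCircle (2 * π))
  rw [hcoeff] at hsum
  have h0 := hsum.unique (by simp only [Pi.zero_apply, zero_smul]; exact hasSum_zero)
  have hx : f ((Complex.arg x : ℝ) : AddCircle (2 * π)) = g x := by
    change g _ = g x
    rw [hmk, Circle.exp_arg]
  rw [← hx, h0]

end CircleCoeff

/-! ### Matrix functions on the disc -/

/-- Functions that are continuous on the closed unit disc and holomorphic inside. -/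
def discAlgebra : Subalgebra ℂ (ℂ → ℂ) where
  carrier := {F | DiffContOnCl ℂ F (Metric.ball 0 1)}
  mul_mem' hf hg := hf.smul hg
  add_mem' hf hg := hf.add hg
  algebraMap_mem' _ := diffContOnCl_const

/-- Matrix functions that are continuous on the closed unit disc and holomorphic inside. -/
def IsDiscFun {n : ℕ} (F : ℂ → Matrix (Fin n) (Fin n) ℂ) : Prop :=
  ∀ a b, DiffContOnCl ℂ (fun z => F z a b) (Metric.ball 0 1)

theorem IsDiscFun.mul {n : ℕ} {F G : ℂ → Matrix (Fin n) (Fin n) ℂ} (hF : IsDiscFun F)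
    (hG : IsDiscFun G) : IsDiscFun fun z => F z * G z := fun a b => by
  have h : ∑ c, (fun z => F z a c) * (fun z => G z c b) ∈ discAlgebra :=
    sum_mem fun c _ => mul_mem (S := Subalgebra ℂ (ℂ → ℂ)) (hF a c) (hG c b)
  convert! show DiffContOnCl ℂ _ _ from h using 1
  ext z
  simp [Matrix.mul_apply]

/-- Cramer's rule: determinant and adjugate are polynomial in the entries, so only the scalar
determinant has to be inverted. It serves both for functions on the disc and for holomorphic
functions on U. -/
theorem inv_apply_mem_subalgebra {X : Type*} {n : ℕ} (𝒜 : Subalgebra ℂ (X → ℂ)) {S : Set X}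
    (hinv : ∀ f ∈ 𝒜, (∀ x ∈ S, f x ≠ 0) → (fun x => (f x)⁻¹) ∈ 𝒜)
    {F : X → Matrix (Fin n) (Fin n) ℂ} (hF : ∀ a b, (fun x => F x a b) ∈ 𝒜)
    (hu : ∀ x ∈ S, IsUnit (F x)) (a b : Fin n) : (fun x => (F x)⁻¹ a b) ∈ 𝒜 := by
  let M : Matrix (Fin n) (Fin n) 𝒜 := Matrix.of fun a b => ⟨fun x => F x a b, hF a b⟩
  let ev : X → 𝒜 →+* ℂ := fun x => (Pi.evalRingHom (fun _ => ℂ) x).comp 𝒜.subtype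
  have hM : ∀ x, (ev x).mapMatrix M = F x := fun x => rfl
  have hdet : (fun x => (F x).det) ∈ 𝒜 := by
    convert! M.det.2 using 1
    ext x
    rw [← hM x, ← RingHom.map_det]
    rfl
  have hadj : (fun x => (F x).adjugate a b) ∈ 𝒜 := by
    convert! (M.adjugate a b).2 using 1
    ext x
    rw [← hM x, ← RingHom.map_adjugate]
    rfl
  convert! mul_mem (hinv _ hdet fun x hx =>
    ((Matrix.isUnit_iff_isUnit_det _).1 (hu x hx)).ne_zero) hadj using 1
  ext x
  change (F x)⁻¹ a b = (F x).det⁻¹ • (F x).adjugate a b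
  rw [Matrix.inv_def, Matrix.smul_apply, Ring.inverse_eq_inv']

theorem IsDiscFun.inv {n : ℕ} {F : ℂ → Matrix (Fin n) (Fin n) ℂ} (hF : IsDiscFun F)
    (hu : ∀ z ∈ Metric.closedBall (0 : ℂ) 1, IsUnit (F z)) : IsDiscFun fun z => (F z)⁻¹ :=
  inv_apply_mem_subalgebra discAlgebra (S := closure (Metric.ball (0 : ℂ) 1))
    (fun _ hf h0 => DiffContOnCl.inv hf h0) hF
    (by rwa [closure_ball _ one_ne_zero])

theorem IsDiscFun.continuous {n : ℕ} {F : ℂ → Matrix (Fin n) (Fin n) ℂ} (hF : IsDiscFun F)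
    (a b : Fin n) : Continuous fun θ : ℝ => F (Circle.exp θ : ℂ) a b := by
  refine (hF a b).continuousOn_ball.comp_continuous
    (continuous_subtype_val.comp Circle.exp.continuous) fun θ => ?_
  simp

/-! ### Differentiation of Fourier coefficients -/

section Family

open Real MeasureTheory

variable {r : ℕ} {U : Set (Fin r → ℂ)}

/-- Joint regularity in (t, θ) is available only in the real sense. Identifying the complex
derivative in t with a real directional derivative makes it jointly continuous. -/
theorem fderiv_apply_eq_fderiv_prod {g : (Fin r → ℂ) → Circle → ℂ}
    (hsmooth : ContDiffOn ℝ ∞ (fun p : (Fin r → ℂ) × ℝ => g p.1 (Circle.exp p.2)) (U ×ˢ Set.univ))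
    (hU : IsOpen U) (hhol : ∀ h, DifferentiableOn ℂ (fun t => g t h) U) {t : Fin r → ℂ} (ht : t ∈ U)
    (θ : ℝ) (v : Fin r → ℂ) :
    fderiv ℂ (fun t' => g t' (Circle.exp θ)) t v =
      fderiv ℝ (fun p : (Fin r → ℂ) × ℝ => g p.1 (Circle.exp p.2)) (t, θ) (v, 0) := by
  have hV : IsOpen (U ×ˢ (Set.univ : Set ℝ)) := hU.prod isOpen_univ
  have h1 := (hsmooth.differentiableOn (by simp) (t, θ) ⟨ht, trivial⟩).differentiableAt
    (hV.mem_nhds ⟨ht, trivial⟩)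
  have h2 := h1.hasFDerivAt.comp t (hasFDerivAt_prodMk_left (𝕜 := ℝ) t θ)
  have h3 := (((hhol (Circle.exp θ)) t ht).differentiableAt (hU.mem_nhds ht)).hasFDerivAt
  have h4 := (h3.restrictScalars ℝ).unique h2
  exact congrArg (fun f => f v) h4

theorem continuousOn_fderiv_family {g : (Fin r → ℂ) → Circle → ℂ}
    (hsmooth : ContDiffOn ℝ ∞ (fun p : (Fin r → ℂ) × ℝ => g p.1 (Circle.exp p.2)) (U ×ˢ Set.univ))
    (hU : IsOpen U) (hhol : ∀ h, DifferentiableOn ℂ (fun t => g t h) U) (v : Fin r → ℂ) :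
    ContinuousOn (fun p : (Fin r → ℂ) × ℝ => fderiv ℂ (fun t' => g t' (Circle.exp p.2)) p.1 v)
      (U ×ˢ Set.univ) := by
  have hV : IsOpen (U ×ˢ (Set.univ : Set ℝ)) := hU.prod isOpen_univ
  refine ((hsmooth.continuousOn_fderiv_of_isOpen hV (by simp)).clm_apply
    (continuousOn_const (c := (v, (0 : ℝ))))).congr fun p hp => ?_
  exact fderiv_apply_eq_fderiv_prod hsmooth hU hhol hp.1 p.2 v

/-- Differentiation under the integral sign along a real line in direction `v`. The weights `w` are
frozen: for L₋(t)⁻¹L₋(t') only t' moves, and its Fourier coefficients of nonnegative index are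
constant in t'. -/
theorem circleCoeff_fderiv_eq_zero {ι : Type*} [Fintype ι] {w : ι → Circle → ℂ}
    {g : ι → (Fin r → ℂ) → Circle → ℂ} (hw : ∀ l, Continuous fun θ : ℝ => w l (Circle.exp θ))
    (hsmooth : ∀ l, ContDiffOn ℝ ∞ (fun p : (Fin r → ℂ) × ℝ => g l p.1 (Circle.exp p.2))
      (U ×ˢ Set.univ))
    (hU : IsOpen U) (hhol : ∀ l h, DifferentiableOn ℂ (fun t => g l t h) U) {t : Fin r → ℂ}
    (ht : t ∈ U) (v : Fin r → ℂ) {k : ℤ} {c : ℂ}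
    (hc : ∀ t ∈ U, circleCoeff k (fun h => ∑ l, w l h * g l t h) = c) :
    circleCoeff k (fun h => ∑ l, w l h * fderiv ℂ (fun t' => g l t' h) t v) = 0 := by
  have hpath : Continuous fun ε : ℝ => t + ε • v := by fun_prop
  obtain ⟨δ, hδ, hδU⟩ : ∃ δ > 0, ∀ ε ∈ Metric.closedBall (0 : ℝ) δ, t + ε • v ∈ U := by
    have hnhds : (fun ε : ℝ => t + ε • v) ⁻¹' U ∈ nhds 0 :=
      (hU.preimage hpath).mem_nhds (by simpa using ht)
    obtain ⟨δ, hδ, h⟩ := Metric.nhds_basis_closedBall.mem_iff.1 hnhds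
    exact ⟨δ, hδ, fun ε hε => h hε⟩
  set F : ℝ → ℝ → ℂ := fun ε θ => (Circle.exp θ : ℂ) ^ (-k) *
    ∑ l, w l (Circle.exp θ) * g l (t + ε • v) (Circle.exp θ) with hF
  set F' : ℝ → ℝ → ℂ := fun ε θ => (Circle.exp θ : ℂ) ^ (-k) *
    ∑ l, w l (Circle.exp θ) * fderiv ℂ (fun t' => g l t' (Circle.exp θ)) (t + ε • v) v with hF'
  have hgcont : ∀ l, ∀ t ∈ U, Continuous fun θ : ℝ => g l t (Circle.exp θ) := fun l t ht =>
    (hsmooth l).continuousOn.comp_continuous (f := fun θ : ℝ => (t, θ)) (by fun_prop)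
      fun θ => ⟨ht, trivial⟩
  have hFcont : ∀ ε ∈ Metric.closedBall (0 : ℝ) δ, Continuous (F ε) := fun ε hε =>
    (continuous_zpow_circleExp _).mul
      (continuous_finsetSum _ fun l _ => (hw l).mul (hgcont l _ (hδU ε hε)))
  have hF'cont : ContinuousOn (Function.uncurry F') (Metric.closedBall 0 δ ×ˢ Set.univ) := by
    refine ((continuous_zpow_circleExp _).comp continuous_snd).continuousOn.mul
      (continuousOn_finsetSum _ fun l _ => ((hw l).comp continuous_snd).continuousOn.mul ?_)
    exact (continuousOn_fderiv_family (hsmooth l) hU (hhol l) v).comp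
      (f := fun p : ℝ × ℝ => (t + p.1 • v, p.2)) (by fun_prop) fun p hp => ⟨hδU _ hp.1, trivial⟩
  have hball : Metric.closedBall (0 : ℝ) δ ∈ nhds 0 := Metric.closedBall_mem_nhds _ hδ
  obtain ⟨C, hC⟩ := ((isCompact_closedBall (0 : ℝ) δ).prod
    (isCompact_Icc (a := (0 : ℝ)) (b := 2 * π))).exists_bound_of_continuousOn
    (hF'cont.mono (Set.prod_mono_right (Set.subset_univ _)))
  have hder := (intervalIntegral.hasDerivAt_integral_of_dominated_loc_of_deriv_le (𝕜 := ℝ)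
    (μ := volume) (a := 0) (b := 2 * π) (F := F) (F' := F') (x₀ := 0) (bound := fun _ => C) hball
    (Filter.eventually_of_mem hball fun ε hε => (hFcont ε hε).aestronglyMeasurable)
    ((hFcont 0 (Metric.mem_closedBall_self hδ.le)).intervalIntegrable _ _)
    ((hF'cont.comp_continuous (f := fun θ : ℝ => ((0 : ℝ), θ)) (by fun_prop) fun θ =>
      ⟨Metric.mem_closedBall_self hδ.le, trivial⟩).aestronglyMeasurable)
    (Filter.Eventually.of_forall fun θ hθ ε hε => by
      rw [Set.uIoc_of_le Real.two_pi_pos.le] at hθ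
      exact hC (ε, θ) ⟨hε, hθ.1.le, hθ.2⟩)
    intervalIntegrable_const
    (Filter.Eventually.of_forall fun θ _ ε hε => by
      refine (HasDerivAt.fun_sum fun l _ => ?_).const_mul _
      refine HasDerivAt.const_mul _ ?_
      have h1 := (((hhol l (Circle.exp θ)) _ (hδU ε hε)).differentiableAt
        (hU.mem_nhds (hδU ε hε))).hasFDerivAt.restrictScalars ℝ
      have h2 : HasDerivAt (fun ε : ℝ => t + ε • v) v ε := by
        simpa using ((hasDerivAt_id ε).smul_const v).const_add t
      exact h1.comp_hasDerivAt ε h2)).2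
  have hconst : (fun ε => ∫ θ in (0 : ℝ)..2 * π, F ε θ) =ᶠ[nhds 0] fun _ => c :=
    Filter.eventually_of_mem hball fun ε hε => hc _ (hδU ε hε)
  have h0 := hder.unique ((hasDerivAt_const (0 : ℝ) c).congr_of_eventuallyEq hconst)
  rw [← h0, circleCoeff]
  simp only [hF', zero_smul, add_zero]

end Family

/-! ### Evaluation of polynomials in `q, h` -/

section Evaluation

variable {r n : ℕ}

theorem contDiff_evalTH (f : QHRing r) :
    ContDiff ℂ ∞ fun p : (Fin r → ℂ) × ℂ => evalTH p.1 p.2 f := by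
  induction f using MvPolynomial.induction_on with
  | C p =>
    have : (fun x : (Fin r → ℂ) × ℂ => evalTH x.1 x.2 (MvPolynomial.C p)) =
        fun x => p.eval x.2 := by
      ext x
      simp [evalTH]
    rw [this]
    exact (Polynomial.contDiff_aeval p ∞).comp contDiff_snd
  | add p q hp hq =>
    simp only [map_add]
    exact hp.add hq
  | mul_X p i hp =>
    simp only [map_mul]
    refine hp.mul ?_
    have : (fun x : (Fin r → ℂ) × ℂ => evalTH x.1 x.2 (MvPolynomial.X i)) =
        fun x => Complex.exp (x.1 i) := by
      ext x
      simp [evalTH]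
    rw [this]
    fun_prop

theorem evalTH_constH (t : Fin r → ℂ) (z : ℂ) (g : QRing r) :
    evalTH t z (constH r g) = evalT t g := by
  rw [evalTH, constH, MvPolynomial.coe_eval₂Hom, MvPolynomial.eval₂_map, evalT, MvPolynomial.eval,
    MvPolynomial.coe_eval₂Hom]
  congr 1
  ext1 a
  simp

theorem evalTH_zero (t : Fin r → ℂ) (f : QHRing r) : evalTH t 0 f = evalT t (hZero r f) := by
  rw [evalTH, hZero, evalT, MvPolynomial.eval_map, MvPolynomial.coe_eval₂Hom]

theorem evalTH_hVar (t : Fin r → ℂ) (z : ℂ) : evalTH t z (hVar r) = z := by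
  simp [evalTH, hVar]

theorem differentiableAt_evalTH (z : ℂ) (f : QHRing r) (t : Fin r → ℂ) :
    DifferentiableAt ℂ (fun t => evalTH t z f) t :=
  ((contDiff_evalTH f).comp (contDiff_prodMk_left z)).contDiffAt.differentiableAt (by simp)

theorem fderiv_evalTH (z : ℂ) (f : QHRing r) (t : Fin r → ℂ) (i : Fin r) :
    fderiv ℂ (fun t => evalTH t z f) t (Pi.single i 1) = evalTH t z (qDeriv i f) := by
  induction f using MvPolynomial.induction_on with
  | C p =>
    have h1 : (fun t : Fin r → ℂ => evalTH t z (MvPolynomial.C p)) = fun _ => p.eval z := by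
      ext t
      simp [evalTH]
    have h2 : qDeriv i (MvPolynomial.C p : QHRing r) = 0 := by
      rw [qDeriv_apply, MvPolynomial.pderiv_C, mul_zero]
    rw [h1, h2, map_zero, fderiv_fun_const]
    rfl
  | add p q hp hq =>
    simp only [map_add]
    rw [fderiv_fun_add (differentiableAt_evalTH z p t) (differentiableAt_evalTH z q t), ← hp, ← hq]
    rfl
  | mul_X p j hp =>
    have hX : ∀ t : Fin r → ℂ, evalTH t z (MvPolynomial.X j) = Complex.exp (t j) := fun t => by
      simp [evalTH]
    have hd : HasFDerivAt (fun t : Fin r → ℂ => Complex.exp (t j))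
        (Complex.exp (t j) • ContinuousLinearMap.proj (R := ℂ) j) t :=
      (hasFDerivAt_apply (𝕜 := ℂ) j t).cexp
    have hXd : HasFDerivAt (fun t : Fin r → ℂ => evalTH t z (MvPolynomial.X j))
        (Complex.exp (t j) • ContinuousLinearMap.proj (R := ℂ) j) t := by
      simp only [hX]
      exact hd
    have hprod := (differentiableAt_evalTH z p t).hasFDerivAt.mul hXd
    simp only [map_mul]
    have hfd := hprod.fderiv
    change fderiv ℂ (fun t => evalTH t z p * evalTH t z (MvPolynomial.X j)) t = _ at hfd
    rw [hfd, Derivation.leibniz, map_add, smul_eq_mul, smul_eq_mul, map_mul, map_mul, ← hp]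
    simp only [add_apply, smul_apply, smul_eq_mul, ContinuousLinearMap.proj_apply]
    congr 2
    rw [qDeriv_apply, MvPolynomial.pderiv_X, map_mul]
    by_cases hij : j = i
    · subst hij
      simp [hX]
    · simp [hij]

theorem isDiscFun_evalTH (t : Fin r → ℂ) (M : Matrix (Fin n) (Fin n) (QHRing r)) :
    IsDiscFun fun z => M.map (evalTH t z) := fun a b =>
  (((contDiff_evalTH (M a b)).comp (contDiff_prodMk_right t)).differentiable (by simp)).diffContOnCl

end Evaluation

/-! ### Partial derivatives of matrix functions -/

section TPartial

variable {r n : ℕ} {U : Set (Fin r → ℂ)}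

theorem tPartial_mul {f g : (Fin r → ℂ) → Matrix (Fin n) (Fin n) ℂ} {t : Fin r → ℂ}
    (hf : ∀ a b, DifferentiableAt ℂ (fun t => f t a b) t)
    (hg : ∀ a b, DifferentiableAt ℂ (fun t => g t a b) t) (i : Fin r) :
    tPartial i (fun t => f t * g t) t = tPartial i f t * g t + f t * tPartial i g t := by
  ext1 a b
  simp only [tPartial, Matrix.of_apply, Matrix.add_apply, Matrix.mul_apply]
  rw [fderiv_fun_sum fun c _ => (hf a c).fun_mul (hg c b), sum_apply,
    ← Finset.sum_add_distrib]
  refine Finset.sum_congr rfl fun c _ => ?_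
  rw [fderiv_fun_mul (hf a c) (hg c b)]
  simp only [add_apply, smul_apply, smul_eq_mul]
  ring

theorem tPartial_congr {f g : (Fin r → ℂ) → Matrix (Fin n) (Fin n) ℂ} {t : Fin r → ℂ}
    (hU : IsOpen U) (ht : t ∈ U) (h : ∀ t ∈ U, f t = g t) (i : Fin r) :
    tPartial i f t = tPartial i g t := by
  ext1 a b
  simp only [tPartial, Matrix.of_apply]
  rw [Filter.EventuallyEq.fderiv_eq (Filter.eventually_of_mem (hU.mem_nhds ht) fun t ht => by
    rw [h t ht])]

theorem tPartial_evalTH (i : Fin r) (M : Matrix (Fin n) (Fin n) (QHRing r)) (z : ℂ)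
    (t : Fin r → ℂ) :
    tPartial i (fun t => M.map (evalTH t z)) t = (M.map (qDeriv i)).map (evalTH t z) := by
  ext1 a b
  exact fderiv_evalTH z (M a b) t i

theorem two_le_infty : (2 : WithTop ℕ∞) ≤ ∞ :=
  WithTop.coe_le_coe.2 (le_top (a := (2 : ℕ∞)))

/-- Partial derivatives of a smooth holomorphic function are holomorphic and commute. -/
theorem differentiableAt_fderiv_apply {f : (Fin r → ℂ) → ℂ} (hU : IsOpen U)
    (hsmooth : ContDiffOn ℝ ∞ f U) (hhol : DifferentiableOn ℂ f U) {t : Fin r → ℂ} (ht : t ∈ U)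
    (v : Fin r → ℂ) : DifferentiableAt ℂ (fun t => fderiv ℂ f t v) t ∧
      ∀ u, fderiv ℂ (fun t => fderiv ℂ f t v) t u = fderiv ℝ (fderiv ℝ f) t u v := by
  have hreal : ∀ t ∈ U, ∀ v, fderiv ℂ f t v = fderiv ℝ f t v := fun t ht v => by
    rw [((hhol t ht).differentiableAt (hU.mem_nhds ht)).hasFDerivAt.restrictScalars ℝ |>.fderiv]
    rfl
  have hCt : ContDiffAt ℝ ∞ f t := hsmooth.contDiffAt (hU.mem_nhds ht)
  have hsymm : IsSymmSndFDerivAt ℝ f t := hCt.isSymmSndFDerivAt (by simpa using two_le_infty)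
  have hD : DifferentiableAt ℝ (fderiv ℝ f) t :=
    (hCt.fderiv_right (m := 1) (one_add_one_eq_two.trans_le two_le_infty)).differentiableAt (by simp)
  have hev : ∀ v, (fun t => fderiv ℂ f t v) =ᶠ[nhds t] fun t => fderiv ℝ f t v := fun v =>
    Filter.eventually_of_mem (hU.mem_nhds ht) fun t ht => hreal t ht v
  have hder : ∀ v, HasFDerivAt (fun t => fderiv ℂ f t v) ((fderiv ℝ (fderiv ℝ f) t).flip v) t :=
    fun v => by
      refine HasFDerivAt.congr_of_eventuallyEq ?_ (hev v)
      have := hD.hasFDerivAt.clm_apply (hasFDerivAt_const v t)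
      convert! this using 1
      ext u
      simp
  -- The second derivative is complex linear in the slot coming from the complex first derivative;
  -- its symmetry transfers this to the other slot, which gives complex differentiability.
  have hlin : ∀ (c : ℂ) (u : Fin r → ℂ), fderiv ℝ (fderiv ℝ f) t (c • u) v =
      c * fderiv ℝ (fderiv ℝ f) t u v := by
    intro c u
    rw [hsymm.eq, hsymm.eq u v]
    have h1 := hder (c • u)
    have h2 : HasFDerivAt (fun t => fderiv ℂ f t (c • u))
        (c • (fderiv ℝ (fderiv ℝ f) t).flip u) t := by
      have := (hder u).const_smul c
      convert! this using 1
      ext t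
      simp
    exact congrArg (fun L => L v) (h1.unique h2)
  let L : (Fin r → ℂ) →L[ℂ] ℂ :=
    { toFun := fun u => fderiv ℝ (fderiv ℝ f) t u v
      map_add' := fun a b => by simp
      map_smul' := hlin
      cont := ((fderiv ℝ (fderiv ℝ f) t).flip v).cont }
  have hL : HasFDerivAt (fun t => fderiv ℂ f t v) L t := by
    refine hasFDerivAt_of_restrictScalars ℝ (hder v) ?_
    ext u
    rfl
  exact ⟨hL.differentiableAt, fun u => by rw [hL.fderiv]; rfl⟩

theorem tPartial_comm {f : (Fin r → ℂ) → Matrix (Fin n) (Fin n) ℂ} (hU : IsOpen U)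
    (hsmooth : ∀ a b, ContDiffOn ℝ ∞ (fun t => f t a b) U)
    (hhol : ∀ a b, DifferentiableOn ℂ (fun t => f t a b) U) {t : Fin r → ℂ} (ht : t ∈ U)
    (i j : Fin r) : tPartial i (tPartial j f) t = tPartial j (tPartial i f) t := by
  ext1 a b
  have hCt : ContDiffAt ℝ ∞ (fun t => f t a b) t := (hsmooth a b).contDiffAt (hU.mem_nhds ht)
  have hsymm : IsSymmSndFDerivAt ℝ (fun t => f t a b) t := hCt.isSymmSndFDerivAt (by simpa using two_le_infty)
  simp only [tPartial, Matrix.of_apply]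
  rw [(differentiableAt_fderiv_apply hU (hsmooth a b) (hhol a b) ht _).2,
    (differentiableAt_fderiv_apply hU (hsmooth a b) (hhol a b) ht _).2, hsymm.eq]

end TPartial

/-! ### The gauge transform by a Birkhoff factor -/

section Birkhoff

/-- Functions that are holomorphic on a set. -/
def differentiableOnAlgebra {E : Type*} [NormedAddCommGroup E] [NormedSpace ℂ E] (U : Set E) :
    Subalgebra ℂ (E → ℂ) where
  carrier := {f | DifferentiableOn ℂ f U}
  mul_mem' hf hg := hf.mul hg
  add_mem' hf hg := hf.add hg
  algebraMap_mem' _ := differentiableOn_const _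

variable {r n : ℕ} {U : Set (Fin r → ℂ)}

/-- `B₀ ωᵢ B₀⁻¹` for `ωᵢ = (h Ωᵢ^h)|_{h=0}`. -/
def gaugedLimit (A : Fin r → Matrix (Fin n) (Fin n) (QHRing r))
    (B₀ : (Fin r → ℂ) → Matrix (Fin n) (Fin n) ℂ) (i : Fin r) (t : Fin r → ℂ) :
    Matrix (Fin n) (Fin n) ℂ :=
  B₀ t * ((A i).map (hZero r)).map (evalT t) * (B₀ t)⁻¹

namespace IsBirkhoff

variable {A : Fin r → Matrix (Fin n) (Fin n) (QHRing r)}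
  {L Lm Lp : (Fin r → ℂ) → Circle → Matrix (Fin n) (Fin n) ℂ}
  {B₀ : (Fin r → ℂ) → Matrix (Fin n) (Fin n) ℂ}

theorem _root_.QuantumDModule.IsLoopFamily.differentiableAt
    {γ : (Fin r → ℂ) → Circle → Matrix (Fin n) (Fin n) ℂ} (h : IsLoopFamily U γ) (hU : IsOpen U)
    {t : Fin r → ℂ} (ht : t ∈ U) (z : Circle) (a b : Fin n) :
    DifferentiableAt ℂ (fun t => γ t z a b) t :=
  (h.holomorphic a b z t ht).differentiableAt (hU.mem_nhds ht)

/-- The logarithmic derivatives of the two factors. -/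
theorem gauge_factors (h : IsBirkhoff A U L Lm Lp B₀) (hU : IsOpen U) {t : Fin r → ℂ} (ht : t ∈ U)
    (i : Fin r) (z : Circle) :
    (Lm t z)⁻¹ * tPartial i (fun t => Lm t z) t + tPartial i (fun t => Lp t z) t * (Lp t z)⁻¹ =
      Lp t z * connection A i t z * (Lp t z)⁻¹ := by
  have hm := (Matrix.isUnit_iff_isUnit_det _).1 (h.loop_minus.isUnit t ht z)
  have hp := (Matrix.isUnit_iff_isUnit_det _).1 (h.loop_plus.isUnit t ht z)
  rw [← h.gauge i t ht z, tPartial_congr hU ht (fun t ht => h.factor t ht z) i,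
    tPartial_mul (h.loop_minus.differentiableAt hU ht z) (h.loop_plus.differentiableAt hU ht z),
    h.factor t ht z, Matrix.mul_inv_rev]
  simp only [mul_add, add_mul, mul_assoc]
  rw [Matrix.mul_nonsing_inv _ hp, mul_one, Matrix.nonsing_inv_mul_cancel_left _ _ hm,
    Matrix.mul_nonsing_inv_cancel_left _ _ hp, Matrix.mul_nonsing_inv_cancel_left _ _ hp]

theorem continuous_fderiv {γ : (Fin r → ℂ) → Circle → Matrix (Fin n) (Fin n) ℂ}
    (h : IsLoopFamily U γ) (hU : IsOpen U) {t : Fin r → ℂ} (ht : t ∈ U) (i : Fin r) (a b : Fin n) :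
    Continuous fun θ : ℝ => tPartial i (fun t => γ t (Circle.exp θ)) t a b :=
  (continuousOn_fderiv_family (h.smooth a b) hU (h.holomorphic a b) (Pi.single i 1)).comp_continuous
    (f := fun θ : ℝ => (t, θ)) (by fun_prop) fun θ => ⟨ht, trivial⟩

/-- Liouville's argument in Fourier coefficients. Here Y = L₋⁻¹∂ᵢL₋ has only negative powers of h, V
= ∂ᵢL₊L₊⁻¹ only nonnegative ones, and Y = h⁻¹Z − V with Z holomorphic in the disc. Only h⁻¹Z(0) can
survive. -/
theorem minus_gauge (h : IsBirkhoff A U L Lm Lp B₀) (hU : IsOpen U) {t : Fin r → ℂ} (ht : t ∈ U)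
    (i : Fin r) (z : Circle) :
    (Lm t z)⁻¹ * tPartial i (fun t => Lm t z) t = (z : ℂ)⁻¹ • gaugedLimit A B₀ i t := by
  obtain ⟨Fm, hFm, hFm0, hLm⟩ := h.minus t ht
  obtain ⟨Fp, hFp, hFp0, hLp⟩ := h.plus t ht
  have hFmi := IsDiscFun.inv hFm.1 hFm.2
  have hFpi := IsDiscFun.inv hFp.1 hFp.2
  have hz : ∀ z : Circle, ((z : ℂ))⁻¹ = ((z⁻¹ : Circle) : ℂ) := fun z => (Circle.coe_inv z).symm
  set Z : ℂ → Matrix (Fin n) (Fin n) ℂ := fun x => Fp x * (A i).map (evalTH t x) * (Fp x)⁻¹ with hZ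
  have hZd : IsDiscFun Z := IsDiscFun.mul (IsDiscFun.mul hFp.1 (isDiscFun_evalTH t (A i))) hFpi
  have hZ0 : Z 0 = gaugedLimit A B₀ i t := by
    rw [hZ, gaugedLimit, ← hFp0]
    dsimp only
    congr 2
    ext a b
    exact evalTH_zero t (A i a b)
  ext1 a b
  set Y : Circle → ℂ := fun z => ((Lm t z)⁻¹ * tPartial i (fun t => Lm t z) t) a b with hY
  set V : Circle → ℂ := fun z => (tPartial i (fun t => Lp t z) t * (Lp t z)⁻¹) a b with hV
  have hwm : ∀ l, Continuous fun θ : ℝ => (Lm t (Circle.exp θ))⁻¹ a l := fun l => by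
    have := (IsDiscFun.continuous hFmi a l).comp continuous_neg
    refine this.congr fun θ => ?_
    rw [hLm, hz, ← Circle.exp_neg]
    rfl
  have hwp : ∀ l, Continuous fun θ : ℝ => (Lp t (Circle.exp θ))⁻¹ l b := fun l => by
    refine (IsDiscFun.continuous hFpi l b).congr fun θ => ?_
    rw [hLp]
  have hYcont : Continuous fun θ : ℝ => Y (Circle.exp θ) := by
    simp only [hY, Matrix.mul_apply]
    exact continuous_finsetSum _ fun l _ =>
      (hwm l).mul (continuous_fderiv h.loop_minus hU ht i l b)
  have hVcont : Continuous fun θ : ℝ => V (Circle.exp θ) := by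
    simp only [hV, Matrix.mul_apply]
    exact continuous_finsetSum _ fun l _ =>
      (continuous_fderiv h.loop_plus hU ht i a l).mul (hwp l)
  have hYcoeff : ∀ k : ℤ, 0 ≤ k → circleCoeff k Y = 0 := by
    intro k hk
    -- The product L₋(t)⁻¹L₋(t') is I + O(h⁻¹) for every t', which supplies the constant value of
    -- its zeroth coefficient.
    have := circleCoeff_fderiv_eq_zero (w := fun l z => (Lm t z)⁻¹ a l)
      (g := fun l t z => Lm t z l b) hwm (fun l => h.loop_minus.smooth l b) hU
      (fun l z => h.loop_minus.holomorphic l b z) ht (Pi.single i 1) (k := k)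
      (c := if k = 0 then 2 * Real.pi * (1 : Matrix (Fin n) (Fin n) ℂ) a b else 0) ?_
    · exact this
    · intro t' ht'
      obtain ⟨G, hG, hG0, hLm'⟩ := h.minus t' ht'
      have hprod := IsDiscFun.mul hFmi hG.1 a b
      have heq : circleCoeff k (fun z : Circle => ∑ l, (Lm t z)⁻¹ a l * Lm t' z l b) =
          circleCoeff (-k) (fun z : Circle => ((Fm z)⁻¹ * G z) a b) := by
        rw [← circleCoeff_comp_inv]
        congr 1
        ext z
        rw [← Matrix.mul_apply, hLm, hLm', hz]
      rw [heq]
      split_ifs with h0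
      · rw [h0, neg_zero]
        refine (circleCoeff_disc_zero hprod).trans ?_
        dsimp only
        rw [hFm0, hG0, inv_one, one_mul]
      · exact circleCoeff_disc_of_neg hprod (by lia)
  have hVcoeff : ∀ k : ℤ, k < 0 → circleCoeff k V = 0 := by
    intro k hk
    have := circleCoeff_fderiv_eq_zero (w := fun l z => (Lp t z)⁻¹ l b)
      (g := fun l t z => Lp t z a l) hwp (fun l => h.loop_plus.smooth a l) hU
      (fun l z => h.loop_plus.holomorphic a l z) ht (Pi.single i 1) (k := k) (c := 0) ?_
    · rw [← this, hV]
      congr 1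
      ext z
      rw [Matrix.mul_apply]
      exact Finset.sum_congr rfl fun l _ => mul_comm _ _
    · intro t' ht'
      obtain ⟨G, hG, hG0, hLp'⟩ := h.plus t' ht'
      have hprod := IsDiscFun.mul hG.1 hFpi a b
      rw [← circleCoeff_disc_of_neg hprod hk]
      congr 1
      ext z
      change _ = (G z * (Fp z)⁻¹) a b
      rw [← hLp, ← hLp', Matrix.mul_apply]
      exact Finset.sum_congr rfl fun l _ => mul_comm _ _
  have hYV : ∀ z : Circle, Y z = (z : ℂ) ^ (-1 : ℤ) * Z z a b - V z := by
    intro z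
    have := congrFun (congrFun (h.gauge_factors hU ht i z) a) b
    rw [Matrix.add_apply] at this
    rw [eq_sub_iff_add_eq, this, connection, hZ, hLp, Matrix.mul_smul, Matrix.smul_mul,
      Matrix.smul_apply, smul_eq_mul, zpow_neg_one]
  -- All coefficients of D vanish: for k ≥ 0 by `hYcoeff`, for k < −1 by Cauchy's theorem, and for k
  -- = −1 because Z(0) has been subtracted.
  set D : Circle → ℂ := fun z => Y z - (z : ℂ) ^ (-1 : ℤ) * gaugedLimit A B₀ i t a b with hD
  have hinvcont : Continuous fun θ : ℝ =>
      (Circle.exp θ : ℂ) ^ (-1 : ℤ) * gaugedLimit A B₀ i t a b :=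
    (continuous_zpow_circleExp _).mul continuous_const
  have hDcont : Continuous fun θ : ℝ => D (Circle.exp θ) := hYcont.sub hinvcont
  have hDzero := eq_zero_of_circleCoeff_eq_zero hDcont (fun k => ?_) z
  · rw [hD] at hDzero
    dsimp only at hDzero
    rw [zpow_neg_one] at hDzero
    exact sub_eq_zero.1 hDzero
  · rcases lt_or_ge k 0 with hk | hk
    · have hW : DiffContOnCl ℂ (fun x => Z x a b - gaugedLimit A B₀ i t a b) (Metric.ball 0 1) :=
        (hZd a b).sub_const _
      have hDeq : D = fun z : Circle => (z : ℂ) ^ (-1 : ℤ) *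
          (fun z : Circle => Z z a b - gaugedLimit A B₀ i t a b) z - V z := by
        ext z
        rw [hD]
        dsimp only
        rw [hYV]
        ring
      rw [hDeq, circleCoeff_sub _ _ hVcont, hVcoeff k hk, sub_zero, circleCoeff_zpow_mul]
      · rcases lt_or_ge (k - -1) 0 with hk' | hk'
        · exact circleCoeff_disc_of_neg hW hk'
        · obtain h0 : k - -1 = 0 := by lia
          rw [h0]
          refine (circleCoeff_disc_zero hW).trans ?_
          rw [hZ0, sub_self, mul_zero]
      · exact (continuous_zpow_circleExp _).mul ((IsDiscFun.continuous hZd a b).sub continuous_const)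
    · rw [hD, circleCoeff_sub _ hYcont hinvcont, hYcoeff k hk, circleCoeff_zpow_mul _ _
        (fun _ => gaugedLimit A B₀ i t a b), zero_sub, neg_eq_zero]
      exact (circleCoeff_comp_inv (k - -1) fun _ => gaugedLimit A B₀ i t a b).trans
        (circleCoeff_disc_of_neg (F := fun _ => gaugedLimit A B₀ i t a b) diffContOnCl_const
          (by lia))

theorem isUnit_plus_zero (h : IsBirkhoff A U L Lm Lp B₀) {t : Fin r → ℂ} (ht : t ∈ U) :
    IsUnit (B₀ t) := by
  obtain ⟨F, hF, hF0, -⟩ := h.plus t ht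
  exact hF0 ▸ hF.2 0 (Metric.mem_closedBall_self zero_le_one)

/-- One value of h already carries all information on ω̂: the factor L₋ at h = 1 is a fundamental
solution of dF = Fω̂. -/
theorem tPartial_minus_one (h : IsBirkhoff A U L Lm Lp B₀) (hU : IsOpen U) {t : Fin r → ℂ}
    (ht : t ∈ U) (i : Fin r) :
    tPartial i (fun t => Lm t 1) t = Lm t 1 * gaugedLimit A B₀ i t := by
  have hm := (Matrix.isUnit_iff_isUnit_det _).1 (h.loop_minus.isUnit t ht 1)
  have := h.minus_gauge hU ht i 1
  rw [Circle.coe_one, inv_one, one_smul] at this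
  rw [← this, Matrix.mul_nonsing_inv_cancel_left _ _ hm]

theorem contDiffOn_minus_one (h : IsBirkhoff A U L Lm Lp B₀) (a b : Fin n) :
    ContDiffOn ℝ ∞ (fun t => Lm t 1 a b) U := by
  have := (h.loop_minus.smooth a b).comp (f := fun t : Fin r → ℂ => (t, (0 : ℝ)))
    (s := U) (by fun_prop) fun t ht => ⟨ht, trivial⟩
  simpa only [Function.comp_def, Circle.exp_zero] using this

/-- Holomorphy is read off from L₋ at h = 1, so nothing about the dependence of B₀ on t has to be
established. -/
theorem differentiableOn_gaugedLimit (h : IsBirkhoff A U L Lm Lp B₀) (hU : IsOpen U) (i : Fin r)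
    (a b : Fin n) : DifferentiableOn ℂ (fun t => gaugedLimit A B₀ i t a b) U := by
  have hinv : ∀ l, DifferentiableOn ℂ (fun t => (Lm t 1)⁻¹ a l) U := fun l =>
    inv_apply_mem_subalgebra (differentiableOnAlgebra U) (S := U)
      (fun f hf h0 => DifferentiableOn.inv hf h0) (fun a b => h.loop_minus.holomorphic a b 1)
      (fun t ht => h.loop_minus.isUnit t ht 1) a l
  have hder : ∀ l, DifferentiableOn ℂ (fun t => tPartial i (fun t => Lm t 1) t l b) U :=
    fun l t ht => (differentiableAt_fderiv_apply hU (h.contDiffOn_minus_one l b)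
      (h.loop_minus.holomorphic l b 1) ht (Pi.single i 1)).1.differentiableWithinAt
  refine (DifferentiableOn.fun_sum (u := Finset.univ) fun l _ =>
    (hinv l).fun_mul (hder l)).congr fun t ht => ?_
  rw [← Matrix.mul_apply, h.minus_gauge hU ht, Circle.coe_one, inv_one, one_smul]

theorem gaugedLimit_comm (h : IsBirkhoff A U L Lm Lp B₀) {i j : Fin r}
    (hcomm : (A i).map (hZero r) * (A j).map (hZero r) =
      (A j).map (hZero r) * (A i).map (hZero r)) {t : Fin r → ℂ} (ht : t ∈ U) :
    gaugedLimit A B₀ i t * gaugedLimit A B₀ j t = gaugedLimit A B₀ j t * gaugedLimit A B₀ i t := by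
  have hB := (Matrix.isUnit_iff_isUnit_det _).1 (h.isUnit_plus_zero ht)
  simp only [gaugedLimit, mul_assoc]
  rw [Matrix.nonsing_inv_mul_cancel_left _ _ hB, Matrix.nonsing_inv_mul_cancel_left _ _ hB,
    ← mul_assoc (((A i).map _).map _), ← mul_assoc (((A j).map _).map _), ← Matrix.map_mul,
    hcomm, Matrix.map_mul]

/-- Mixed second derivatives of F = L₋ at h = 1 are F(ω̂ᵢω̂ⱼ + ∂ᵢω̂ⱼ). They are symmetric, the
products commute, and F is invertible. -/
theorem tPartial_gaugedLimit (h : IsBirkhoff A U L Lm Lp B₀) (hU : IsOpen U) {i j : Fin r}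
    (hcomm : (A i).map (hZero r) * (A j).map (hZero r) =
      (A j).map (hZero r) * (A i).map (hZero r)) {t : Fin r → ℂ} (ht : t ∈ U) :
    tPartial i (gaugedLimit A B₀ j) t = tPartial j (gaugedLimit A B₀ i) t := by
  have hm := (Matrix.isUnit_iff_isUnit_det _).1 (h.loop_minus.isUnit t ht 1)
  have hsecond : ∀ i j, tPartial i (tPartial j fun t => Lm t 1) t =
      Lm t 1 * (gaugedLimit A B₀ i t * gaugedLimit A B₀ j t + tPartial i (gaugedLimit A B₀ j) t) := by
    intro i j
    rw [tPartial_congr hU ht (fun t ht => h.tPartial_minus_one hU ht j) i,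
      tPartial_mul (h.loop_minus.differentiableAt hU ht 1) (fun a b =>
        (h.differentiableOn_gaugedLimit hU j a b t ht).differentiableAt (hU.mem_nhds ht)),
      h.tPartial_minus_one hU ht i, mul_add, mul_assoc]
  have hsymm := tPartial_comm hU h.contDiffOn_minus_one
    (fun a b => h.loop_minus.holomorphic a b 1) ht i j
  rw [hsecond, hsecond, h.gaugedLimit_comm hcomm ht] at hsymm
  have := congrArg (fun M => (Lm t 1)⁻¹ * M) hsymm
  simpa only [Matrix.nonsing_inv_mul_cancel_left _ _ hm, add_right_inj] using this

theorem isFlatOn_gaugedLimit (h : IsBirkhoff A U L Lm Lp B₀) (hU : IsOpen U)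
    (hcomm : ∀ i j, (A i).map (hZero r) * (A j).map (hZero r) =
      (A j).map (hZero r) * (A i).map (hZero r)) (c : ℂ) :
    IsFlatOn U fun i t => c • gaugedLimit A B₀ i t := by
  refine ⟨fun i a b => (h.differentiableOn_gaugedLimit hU i a b).const_smul c,
    fun i j t ht => ?_⟩
  have hsmul : ∀ i j, tPartial i (fun t => c • gaugedLimit A B₀ j t) t =
      c • tPartial i (gaugedLimit A B₀ j) t := by
    intro i j
    ext1 a b
    have := fderiv_fun_const_smul
      ((h.differentiableOn_gaugedLimit hU j a b t ht).differentiableAt (hU.mem_nhds ht)) c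
    exact congrArg (fun L => L (Pi.single i 1)) this
  rw [hsmul, hsmul, h.tPartial_gaugedLimit hU (hcomm i j) ht, sub_self, zero_add]
  simp only [Matrix.smul_mul, Matrix.mul_smul]
  rw [h.gaugedLimit_comm (hcomm i j) ht, sub_self]

end IsBirkhoff

end Birkhoff

/-! ### Flat sections of a pencil of connections -/

section FundamentalSolution

variable {E 𝔸 : Type*} [NormedAddCommGroup E] [NormedSpace ℂ E] [NormedRing 𝔸] [NormedAlgebra ℂ 𝔸]

/-- The one-form `v ↦ a * θ v`. -/
def mulForm (a : 𝔸) (θ : E →L[ℂ] 𝔸) : E →L[ℂ] 𝔸 := (ContinuousLinearMap.mul ℂ 𝔸 a).comp θ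

theorem mulForm_apply (a : 𝔸) (θ : E →L[ℂ] 𝔸) (v : E) : mulForm a θ v = a * θ v := rfl

theorem zero_mulForm (θ : E →L[ℂ] 𝔸) : mulForm 0 θ = 0 := by
  ext v
  simp [mulForm_apply]

theorem norm_mulForm_le (a : 𝔸) (θ : E →L[ℂ] 𝔸) : ‖mulForm a θ‖ ≤ ‖a‖ * ‖θ‖ :=
  (ContinuousLinearMap.opNorm_comp_le _ _).trans
    (mul_le_mul_of_nonneg_right (ContinuousLinearMap.opNorm_mul_apply_le ℂ 𝔸 a) (norm_nonneg _))

/-- A smooth closed one-form whose values commute, so that `d + z Θ` is flat for all `z`. -/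
structure IsClosedCommuting (Θ : E → E →L[ℂ] 𝔸) : Prop where
  smooth : ContDiff ℂ ∞ Θ
  closed : ∀ t u v, fderiv ℂ Θ t u v = fderiv ℂ Θ t v u
  comm : ∀ t u v, Θ t u * Θ t v = Θ t v * Θ t u

variable {Θ : E → E →L[ℂ] 𝔸}

/-- If dB = AΘ, then d(BΘ) = AΘ∧Θ + B dΘ. The first term vanishes by commutativity and the second by
closedness, so the Poincaré lemma applies. -/
theorem IsClosedCommuting.exists_primitive [CompleteSpace 𝔸] (hΘ : IsClosedCommuting Θ) {A B : E → 𝔸}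
    (hB : ∀ t, HasFDerivAt B (mulForm (A t) (Θ t)) t) :
    ∃ C : E → 𝔸, C 0 = 0 ∧ ∀ t, HasFDerivAt C (mulForm (B t) (Θ t)) t := by
  have hform : ∀ t, HasFDerivAt (fun t => mulForm (B t) (Θ t))
      ((ContinuousLinearMap.compL ℂ E 𝔸 𝔸 (ContinuousLinearMap.mul ℂ 𝔸 (B t))).comp
        (fderiv ℂ Θ t) + ((ContinuousLinearMap.compL ℂ E 𝔸 𝔸).flip (Θ t)).comp
        ((ContinuousLinearMap.mul ℂ 𝔸).comp (mulForm (A t) (Θ t)))) t := fun t =>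
    HasFDerivAt.clm_comp ((ContinuousLinearMap.mul ℂ 𝔸).hasFDerivAt.comp t (hB t))
      ((hΘ.smooth.differentiable (by simp)) t).hasFDerivAt
  have hdiff : DifferentiableOn ℝ (fun t => mulForm (B t) (Θ t)) Set.univ := fun t _ =>
    ((hform t).restrictScalars ℝ).differentiableAt.differentiableWithinAt
  obtain ⟨C, hC⟩ := convex_univ.exists_forall_hasFDerivAt_of_fderiv_symmetric isOpen_univ hdiff
    (fun t _ u v => by
      rw [((hform t).restrictScalars ℝ).fderiv]
      change B t * fderiv ℂ Θ t u v + A t * Θ t u * Θ t v =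
        B t * fderiv ℂ Θ t v u + A t * Θ t v * Θ t u
      rw [hΘ.closed, mul_assoc, hΘ.comm, mul_assoc])
  exact ⟨fun t => C t - C 0, sub_self _, fun t => (hC t trivial).sub_const _⟩

/-- The coefficients of the fundamental solution of `dF = z F Θ`, shifted by one. -/
structure IsSolutionSeries (Θ : E → E →L[ℂ] 𝔸) (B : ℕ → E → 𝔸) : Prop where
  zero : ∀ t, B 0 t = 0
  one : ∀ t, B 1 t = 1
  initial : ∀ n, B (n + 2) 0 = 0
  hasFDerivAt : ∀ n t, HasFDerivAt (B (n + 1)) (mulForm (B n t) (Θ t)) t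

theorem IsClosedCommuting.exists_series [CompleteSpace 𝔸] (hΘ : IsClosedCommuting Θ) :
    ∃ B, IsSolutionSeries Θ B := by
  -- Picard iteration on consecutive pairs: closedness of the next form needs the derivative of the
  -- current term. Starting from (0, 1) gives the shift by one, so the recursion also covers the
  -- constant term.
  let S := {p : (E → 𝔸) × (E → 𝔸) // ∀ t, HasFDerivAt p.2 (mulForm (p.1 t) (Θ t)) t}
  choose C hC0 hC using fun s : S => hΘ.exists_primitive s.2
  let start : S := ⟨(fun _ => 0, fun _ => 1), fun t =>
    (hasFDerivAt_const (1 : 𝔸) t).congr_fderiv (zero_mulForm _).symm⟩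
  let seq : ℕ → S := fun n => Nat.rec start (fun _ s => ⟨(s.1.2, C s), hC s⟩) n
  exact ⟨fun n => (seq n).1.1, fun _ => rfl, fun _ => rfl, fun n => hC0 (seq n),
    fun n => (seq n).2⟩

/-- Locally uniform bounds of the form `c Yⁿ / n!`. -/
def IsFactBounded {F : Type*} [NormedAddCommGroup F] (B : ℕ → E → F) : Prop :=
  ∀ ρ : ℝ, ∃ c Y : ℝ, 0 ≤ c ∧ 0 ≤ Y ∧
    ∀ n, ∀ t ∈ Metric.ball (0 : E) ρ, ‖B n t‖ ≤ c * (Y ^ n / n.factorial)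

theorem exists_norm_bound [FiniteDimensional ℂ E] (hΘ : Continuous Θ) (ρ : ℝ) :
    ∃ C, 0 ≤ C ∧ ∀ t ∈ Metric.ball (0 : E) ρ, ‖Θ t‖ ≤ C := by
  have : ProperSpace E := FiniteDimensional.proper ℂ E
  obtain ⟨C, hC⟩ := (isCompact_closedBall (0 : E) ρ).exists_bound_of_continuousOn hΘ.continuousOn
  exact ⟨max C 0, le_max_right _ _, fun t ht =>
    (hC t (Metric.ball_subset_closedBall ht)).trans (le_max_left _ _)⟩

variable {B : ℕ → E → 𝔸}

/-- Iterated integration along the ray s ↦ s t: the integrand is bounded by a multiple of s^n, and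
each integration contributes the next factor of the factorial. -/
theorem IsSolutionSeries.norm_le (hB : IsSolutionSeries Θ B) {ρ C : ℝ} (hC0 : 0 ≤ C)
    (hC : ∀ t ∈ Metric.ball (0 : E) ρ, ‖Θ t‖ ≤ C) (n : ℕ) :
    ∀ t ∈ Metric.ball (0 : E) ρ,
      ‖B (n + 1) t‖ ≤ ‖(1 : 𝔸)‖ * ((C * ‖t‖) ^ n / n.factorial) := by
  induction n with
  | zero => intro t _; simp [hB.one]
  | succ n ih =>
    intro t ht
    have hmem : ∀ s ∈ Set.Icc (0 : ℝ) 1, s • t ∈ Metric.ball (0 : E) ρ := fun s hs => by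
      rw [mem_ball_zero_iff] at ht ⊢
      rw [norm_smul, Real.norm_of_nonneg hs.1]
      exact (mul_le_of_le_one_left (norm_nonneg _) hs.2).trans_lt ht
    have hder : ∀ s : ℝ, HasDerivAt (fun s : ℝ => B (n + 2) (s • t))
        (B (n + 1) (s • t) * Θ (s • t) t) s := fun s => by
      have h1 : HasDerivAt (fun s : ℝ => s • t) t s := by
        simpa using (hasDerivAt_id s).smul_const t
      exact ((hB.hasFDerivAt (n + 1) (s • t)).restrictScalars ℝ).comp_hasDerivAt s h1
    have hbound : ∀ s : ℝ, HasDerivAt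
        (fun s : ℝ => ‖(1 : 𝔸)‖ * ((C * ‖t‖) ^ (n + 1) / (n + 1).factorial) * s ^ (n + 1))
        (‖(1 : 𝔸)‖ * ((C * ‖t‖) ^ (n + 1) / (n + 1).factorial) * ((n + 1 : ℕ) * s ^ n)) s :=
      fun s => (hasDerivAt_pow (n + 1) s).const_mul _
    have key := image_norm_le_of_norm_deriv_right_le_deriv_boundary (a := 0) (b := 1)
      (fun s _ => (hder s).continuousAt.continuousWithinAt)
      (fun s _ => (hder s).hasDerivWithinAt) (by simp [hB.initial]) hbound
      (fun s hs => by
        have hs' : s ∈ Set.Icc (0 : ℝ) 1 := ⟨hs.1, hs.2.le⟩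
        calc ‖B (n + 1) (s • t) * Θ (s • t) t‖
            ≤ ‖B (n + 1) (s • t)‖ * (‖Θ (s • t)‖ * ‖t‖) :=
              (norm_mul_le _ _).trans
                (mul_le_mul_of_nonneg_left (ContinuousLinearMap.le_opNorm _ _) (norm_nonneg _))
          _ ≤ ‖(1 : 𝔸)‖ * ((C * ‖s • t‖) ^ n / n.factorial) * (C * ‖t‖) := by
              gcongr
              · exact ih _ (hmem s hs')
              · exact hC _ (hmem s hs')
          _ = _ := by
              rw [norm_smul, Real.norm_of_nonneg hs.1, Nat.factorial_succ]
              push_cast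
              field_simp
              ring) (x := 1) (by simp)
    simpa using key

theorem IsSolutionSeries.isFactBounded_succ [FiniteDimensional ℂ E] (hΘ : Continuous Θ)
    (hB : IsSolutionSeries Θ B) : IsFactBounded fun n => B (n + 1) := by
  intro ρ
  obtain ⟨C, hC0, hC⟩ := exists_norm_bound hΘ ρ
  refine ⟨‖(1 : 𝔸)‖, C * |ρ|, norm_nonneg _, by positivity, fun n t ht =>
    (hB.norm_le hC0 hC n t ht).trans ?_⟩
  rw [mem_ball_zero_iff] at ht
  gcongr
  exact ht.le.trans (le_abs_self ρ)

theorem IsSolutionSeries.isFactBounded [FiniteDimensional ℂ E] (hΘ : Continuous Θ)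
    (hB : IsSolutionSeries Θ B) : IsFactBounded B := by
  intro ρ
  obtain ⟨c, Y, hc, hY, h⟩ := hB.isFactBounded_succ hΘ ρ
  -- The enlarged constant absorbs the factor n + 1 ≤ 2^(n+1) lost in shifting the index.
  refine ⟨c, 2 * (Y + 1), hc, by positivity, fun n t ht => ?_⟩
  cases n with
  | zero => simpa [hB.zero] using hc
  | succ n =>
    refine (h n t ht).trans (mul_le_mul_of_nonneg_left ?_ hc)
    rw [Nat.factorial_succ, Nat.cast_mul, div_le_div_iff₀ (by positivity) (by positivity)]
    have h1 : ((n + 1 : ℕ) : ℝ) ≤ 2 ^ (n + 1) := by exact_mod_cast Nat.lt_two_pow_self.le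
    have h2 : Y ^ n ≤ (Y + 1) ^ (n + 1) := by
      rw [pow_succ]
      refine (pow_le_pow_left₀ hY (by linarith) n).trans
        (le_mul_of_one_le_right (by positivity) (by linarith))
    rw [mul_pow, ← mul_assoc]
    refine mul_le_mul_of_nonneg_right ?_ (by positivity)
    rw [mul_comm]
    exact mul_le_mul h1 h2 (by positivity) (by positivity)

/-- Sequences of at most exponential growth. -/
def IsExpBounded (φ : ℕ → ℂ) : Prop :=
  ∃ M K : ℝ, 0 ≤ M ∧ 0 ≤ K ∧ ∀ n, ‖φ n‖ ≤ M * K ^ n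

theorem IsExpBounded.succ {φ : ℕ → ℂ} (hφ : IsExpBounded φ) :
    IsExpBounded fun n => φ (n + 1) := by
  obtain ⟨M, K, hM, hK, h⟩ := hφ
  exact ⟨M * K, K, by positivity, hK, fun n => (h _).trans_eq (by ring)⟩

theorem IsExpBounded.mul_natCast {φ : ℕ → ℂ} (hφ : IsExpBounded φ) :
    IsExpBounded fun n => φ n * n := by
  obtain ⟨M, K, hM, hK, h⟩ := hφ
  refine ⟨M, K * 2, hM, by positivity, fun n => ?_⟩
  have h1 : (n : ℝ) ≤ 2 ^ n := by exact_mod_cast Nat.lt_two_pow_self.le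
  rw [norm_mul, Complex.norm_natCast, mul_pow, ← mul_assoc]
  exact mul_le_mul (h n) h1 (by positivity) (by positivity)

theorem exists_summable_bound {E F : Type*} [NormedAddCommGroup E] [NormedAddCommGroup F] [NormedSpace ℂ F] {B : ℕ → E → F}
    (hB : IsFactBounded B) {φ : ℕ → ℂ} (hφ : IsExpBounded φ) (ρ : ℝ) :
    ∃ u : ℕ → ℝ, Summable u ∧ ∀ n, ∀ p ∈ Metric.ball (0 : E × ℂ) ρ,
      ‖(φ n * Complex.exp (n * p.2)) • B n p.1‖ ≤ u n := by
  obtain ⟨c, Y, hc, hY, h⟩ := hB ρ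
  obtain ⟨M, K, hM, hK, hφ⟩ := hφ
  refine ⟨fun n => M * c * ((K * Real.exp ρ * Y) ^ n / n.factorial),
    (Real.summable_pow_div_factorial _).mul_left _, fun n p hp => ?_⟩
  rw [mem_ball_zero_iff, Prod.norm_def, max_lt_iff] at hp
  have hexp : ‖Complex.exp (n * p.2)‖ ≤ Real.exp ρ ^ n := by
    rw [← Real.exp_nat_mul]
    refine (Complex.norm_exp_le_exp_norm _).trans (Real.exp_le_exp.2 ?_)
    rw [norm_mul, Complex.norm_natCast]
    gcongr
    exact hp.2.le
  rw [norm_smul, norm_mul]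
  calc ‖φ n‖ * ‖Complex.exp (n * p.2)‖ * ‖B n p.1‖
      ≤ M * K ^ n * Real.exp ρ ^ n * (c * (Y ^ n / n.factorial)) := by
        gcongr
        · exact hφ n
        · exact h n _ (mem_ball_zero_iff.2 hp.1)
    _ = _ := by ring

theorem mem_ball_norm_add_one {G : Type*} [NormedAddCommGroup G] (p : G) :
    p ∈ Metric.ball (0 : G) (‖p‖ + 1) := by
  rw [mem_ball_zero_iff]
  exact lt_add_one _

theorem summable_smul_exp {E F : Type*} [NormedAddCommGroup E] [NormedAddCommGroup F]
    [NormedSpace ℂ F] [CompleteSpace F] {B : ℕ → E → F} (hB : IsFactBounded B) {φ : ℕ → ℂ}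
    (hφ : IsExpBounded φ) (p : E × ℂ) :
    Summable fun n => (φ n * Complex.exp (n * p.2)) • B n p.1 := by
  obtain ⟨u, hu, hle⟩ := exists_summable_bound hB hφ (‖p‖ + 1)
  exact Summable.of_norm_bounded hu fun n => hle n p (mem_ball_norm_add_one p)

/-- The sum `∑ φ(n) e^{n w} B_{n+1}(t)`. -/
def expSum (B : ℕ → E → 𝔸) (φ : ℕ → ℂ) (p : E × ℂ) : 𝔸 :=
  ∑' n, (φ n * Complex.exp (n * p.2)) • B (n + 1) p.1

variable [FiniteDimensional ℂ E] [CompleteSpace 𝔸]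

/-- With z = e^w, differentiation in w multiplies φ(n) by n, and in t it shifts φ and produces a
factor e^w, since the term B₀ = 0 drops out. Both operations preserve exponential growth, so sums of
this type are closed under differentiation. -/
theorem IsSolutionSeries.hasFDerivAt_expSum (hΘ : Continuous Θ) (hB : IsSolutionSeries Θ B)
    {φ : ℕ → ℂ} (hφ : IsExpBounded φ) (p : E × ℂ) :
    ∃ D : E × ℂ →L[ℂ] 𝔸, HasFDerivAt (expSum B φ) D p ∧ ∀ y, D y =
      Complex.exp p.2 • (expSum B (fun n => φ (n + 1)) p * Θ p.1 y.1) +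
        y.2 • expSum B (fun n => φ n * n) p := by
  have hb := hB.isFactBounded hΘ
  have hb1 := hB.isFactBounded_succ hΘ
  have hform : IsFactBounded fun n t =>
      (mulForm (B n t) (Θ t)).comp (ContinuousLinearMap.fst ℂ E ℂ) := by
    intro ρ
    obtain ⟨C, hC0, hC⟩ := exists_norm_bound hΘ ρ
    obtain ⟨c, Y, hc, hY, h⟩ := hb ρ
    refine ⟨c * C, Y, by positivity, hY, fun n t ht => ?_⟩
    calc _ ≤ ‖mulForm (B n t) (Θ t)‖ * ‖ContinuousLinearMap.fst ℂ E ℂ‖ :=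
          ContinuousLinearMap.opNorm_comp_le _ _
      _ ≤ ‖mulForm (B n t) (Θ t)‖ * 1 :=
          mul_le_mul_of_nonneg_left (ContinuousLinearMap.norm_fst_le ℂ E ℂ) (norm_nonneg _)
      _ ≤ ‖B n t‖ * ‖Θ t‖ := by rw [mul_one]; exact norm_mulForm_le _ _
      _ ≤ c * (Y ^ n / n.factorial) * C := by
          gcongr
          · exact h n t ht
          · exact hC t ht
      _ = _ := by ring
  have hval : IsFactBounded fun n t =>
      (ContinuousLinearMap.snd ℂ E ℂ).smulRight (B (n + 1) t) := by
    intro ρ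
    obtain ⟨c, Y, hc, hY, h⟩ := hb1 ρ
    refine ⟨c, Y, hc, hY, fun n t ht => ?_⟩
    rw [ContinuousLinearMap.norm_smulRight_apply]
    exact (mul_le_of_le_one_left (norm_nonneg _)
      (ContinuousLinearMap.norm_snd_le ℂ E ℂ)).trans (h n t ht)
  obtain ⟨u, hu, hule⟩ := exists_summable_bound hform hφ (‖p‖ + 1)
  obtain ⟨v, hv, hvle⟩ := exists_summable_bound hval hφ.mul_natCast (‖p‖ + 1)
  have hp := mem_ball_norm_add_one p
  set f' : ℕ → E × ℂ → E × ℂ →L[ℂ] 𝔸 := fun n p =>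
    (φ n * Complex.exp (n * p.2)) •
      (mulForm (B n p.1) (Θ p.1)).comp (ContinuousLinearMap.fst ℂ E ℂ) +
    (φ n * n * Complex.exp (n * p.2)) •
      (ContinuousLinearMap.snd ℂ E ℂ).smulRight (B (n + 1) p.1) with hf'
  have hf'le : ∀ n, ∀ x ∈ Metric.ball (0 : E × ℂ) (‖p‖ + 1), ‖f' n x‖ ≤ u n + v n :=
    fun n x hx => norm_add_le_of_le (hule n x hx) (hvle n x hx)
  have hterm : ∀ n, ∀ x ∈ Metric.ball (0 : E × ℂ) (‖p‖ + 1),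
      HasFDerivAt (fun p : E × ℂ => (φ n * Complex.exp (n * p.2)) • B (n + 1) p.1) (f' n x) x := by
    intro n x _
    have h1 : HasFDerivAt (fun p : E × ℂ => B (n + 1) p.1)
        ((mulForm (B n x.1) (Θ x.1)).comp (ContinuousLinearMap.fst ℂ E ℂ)) x :=
      (hB.hasFDerivAt n x.1).comp x hasFDerivAt_fst
    have h2 : HasFDerivAt (fun p : E × ℂ => φ n * Complex.exp (n * p.2))
        (φ n • Complex.exp (n * x.2) • (n : ℂ) • ContinuousLinearMap.snd ℂ E ℂ) x :=
      ((hasFDerivAt_snd.const_mul (n : ℂ)).cexp).const_mul (φ n)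
    convert! h2.smul h1 using 1
    rw [hf']
    dsimp only
    congr 1
    ext y
    · simp [smul_smul]
    · simp [smul_smul]
      ring_nf
  have hder := hasFDerivAt_tsum_of_isPreconnected (hu.add hv) Metric.isOpen_ball
    (convex_ball (0 : E × ℂ) (‖p‖ + 1)).isPreconnected hterm hf'le hp
    (summable_smul_exp hb1 hφ p) hp
  refine ⟨_, hder, fun y => ?_⟩
  have hsum : Summable fun n => f' n p :=
    Summable.of_norm_bounded (hu.add hv) fun n => hf'le n p hp
  have hs0 := summable_smul_exp hb hφ p
  have hs1 := summable_smul_exp hb1 hφ.mul_natCast p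
  have happ := (ContinuousLinearMap.apply ℂ 𝔸 y).map_tsum hsum
  simp only [ContinuousLinearMap.apply_apply] at happ
  rw [happ]
  have hexpand : ∀ n, f' n p y = (φ n * Complex.exp (n * p.2)) • B n p.1 * Θ p.1 y.1 +
      y.2 • (φ n * n * Complex.exp (n * p.2)) • B (n + 1) p.1 := fun n => by
    rw [hf', smul_mul_assoc, smul_comm y.2]
    rfl
  simp only [hexpand]
  rw [(hs0.mul_right _).tsum_add (hs1.const_smul y.2), hs0.tsum_mul_right, hs1.tsum_const_smul,
    hs0.tsum_eq_zero_add, hB.zero, smul_zero, zero_add, ← smul_mul_assoc]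
  congr 2
  rw [expSum, ← (summable_smul_exp hb1 hφ.succ p).tsum_const_smul]
  refine tsum_congr fun n => ?_
  rw [smul_smul, Nat.cast_add, Nat.cast_one, add_mul, one_mul, Complex.exp_add]
  congr 1
  ring

theorem IsSolutionSeries.contDiff_expSum (hΘ : ContDiff ℂ ∞ Θ) (hB : IsSolutionSeries Θ B)
    {φ : ℕ → ℂ} (hφ : IsExpBounded φ) : ContDiff ℂ ∞ (expSum B φ) := by
  refine contDiff_infty.2 fun N => ?_
  -- The weights must vary, because a derivative is a sum of the same type with other weights.
  induction N generalizing φ with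
  | zero =>
    refine contDiff_zero.2 (continuous_iff_continuousAt.2 fun p => ?_)
    obtain ⟨D, hD, -⟩ := hB.hasFDerivAt_expSum hΘ.continuous hφ p
    exact hD.continuousAt
  | succ N ih =>
    have hd : Differentiable ℂ (expSum B φ) := fun p => by
      obtain ⟨D, hD, -⟩ := hB.hasFDerivAt_expSum hΘ.continuous hφ p
      exact hD.differentiableAt
    rw [Nat.cast_add, Nat.cast_one]
    refine contDiff_succ_iff_fderiv_apply.2 ⟨hd, fun h => by simp at h, fun y => ?_⟩
    have heq : (fun p => fderiv ℂ (expSum B φ) p y) = fun p =>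
        Complex.exp p.2 • (expSum B (fun n => φ (n + 1)) p * Θ p.1 y.1) +
          y.2 • expSum B (fun n => φ n * n) p := by
      ext1 p
      obtain ⟨D, hD, hDy⟩ := hB.hasFDerivAt_expSum hΘ.continuous hφ p
      rw [hD.fderiv, hDy]
    rw [heq]
    have hΘN : ContDiff ℂ N Θ := hΘ.of_le (WithTop.coe_le_coe.2 le_top)
    exact ((Complex.contDiff_exp.comp contDiff_snd).smul ((ih hφ.succ).mul
      ((hΘN.comp contDiff_fst).clm_apply contDiff_const))).add
        ((ih hφ.mul_natCast).const_smul y.2)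

/-- A flat pencil `d + z Θ` has a fundamental solution that is entire in `z`. -/
theorem IsClosedCommuting.exists_fundamental_solution (hΘ : IsClosedCommuting Θ) :
    ∃ F : E → ℂ → 𝔸, (∀ t, F t 0 = 1) ∧ (∀ z, F 0 z = 1) ∧ (∀ t, Differentiable ℂ (F t)) ∧
      (ContDiff ℂ ∞ fun p : E × ℂ => F p.1 (Complex.exp p.2)) ∧
      ∀ t z, HasFDerivAt (fun t => F t z) (z • mulForm (F t z) (Θ t)) t := by
  obtain ⟨B, hB⟩ := hΘ.exists_series
  have hcont := hΘ.smooth.continuous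
  have h1 : IsExpBounded fun _ => 1 := ⟨1, 1, zero_le_one, zero_le_one, fun n => by simp⟩
  let F : E → ℂ → 𝔸 := fun t z => ∑' n, z ^ n • B (n + 1) t
  have hF0 : ∀ t, F t 0 = 1 := fun t => by
    change ∑' n, _ = _
    rw [tsum_eq_single 0 fun n hn => by rw [zero_pow hn, zero_smul], pow_zero, one_smul, hB.one]
  have hFexp : (fun p : E × ℂ => F p.1 (Complex.exp p.2)) = expSum B fun _ => 1 := by
    ext1 p
    refine tsum_congr fun n => ?_
    rw [one_mul, Complex.exp_nat_mul]
  refine ⟨F, hF0, fun z => ?_, fun t => ?_, ?_, fun t z => ?_⟩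
  · change ∑' n, _ = _
    rw [tsum_eq_single 0, pow_zero, one_smul, hB.one]
    intro n hn
    obtain ⟨k, rfl⟩ := Nat.exists_eq_succ_of_ne_zero hn
    rw [hB.initial, smul_zero]
  · intro z
    obtain ⟨c, Y, hc, hY, h⟩ := hB.isFactBounded_succ hcont (‖t‖ + 1)
    have hd := Complex.differentiableOn_tsum_of_summable_norm (F := fun n z => z ^ n • B (n + 1) t)
      ((Real.summable_pow_div_factorial ((‖z‖ + 1) * Y)).mul_left c)
      (fun n => ((differentiable_pow n).smul_const _).differentiableOn)
      (Metric.isOpen_ball (x := (0 : ℂ)) (ε := ‖z‖ + 1)) fun n w hw => by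
        rw [mem_ball_zero_iff] at hw
        rw [norm_smul, norm_pow]
        calc ‖w‖ ^ n * ‖B (n + 1) t‖ ≤ (‖z‖ + 1) ^ n * (c * (Y ^ n / n.factorial)) := by
              gcongr
              exact h n t (mem_ball_norm_add_one t)
          _ = _ := by rw [mul_pow]; ring
    exact (hd z (mem_ball_norm_add_one z)).differentiableAt
      (Metric.isOpen_ball.mem_nhds (mem_ball_norm_add_one z))
  · rw [hFexp]
    exact hB.contDiff_expSum hΘ.smooth h1
  -- The exponential misses z = 0, where F is constant; elsewhere the derivative comes from `expSum`
  -- at w = log z.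
  · rcases eq_or_ne z 0 with rfl | hz
    · simp only [hF0]
      exact (hasFDerivAt_const (1 : 𝔸) t).congr_fderiv (by ext v; simp)
    · obtain ⟨D, hD, hDy⟩ := hB.hasFDerivAt_expSum hcont h1 (t, Complex.log z)
      have hcomp := HasFDerivAt.comp (g := expSum B fun _ => 1)
        (f := fun t => (t, Complex.log z)) t hD (hasFDerivAt_prodMk_left (𝕜 := ℂ) t (Complex.log z))
      rw [← hFexp] at hcomp
      convert! hcomp using 1
      · ext1 t
        simp only [Function.comp_apply, Complex.exp_log hz]
      · ext v
        have := congrFun hFexp (t, Complex.log z)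
        simp only [Complex.exp_log hz] at this
        simp [hDy, mulForm_apply, Complex.exp_log hz, this]

end FundamentalSolution

/-! ### Flat sections for polynomial connection matrices -/

section FlatSections

variable {r n : ℕ}

theorem qDeriv_constH (i : Fin r) (f : QRing r) :
    qDeriv i (constH r f) = constH r (qPartial i f) := by
  rw [qDeriv_apply, qPartial, constH, map_mul, MvPolynomial.map_X, MvPolynomial.pderiv_map]

theorem contDiff_evalT (f : QRing r) : ContDiff ℂ ∞ fun t : Fin r → ℂ => evalT t f := by
  have := (contDiff_evalTH (constH r f)).comp (contDiff_prodMk_left (0 : ℂ))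
  simpa only [Function.comp_def, evalTH_constH] using this

theorem fderiv_evalT (f : QRing r) (t u : Fin r → ℂ) :
    fderiv ℂ (fun t => evalT t f) t u = ∑ j, u j * evalT t (qPartial j f) := by
  have hsingle : ∀ j, fderiv ℂ (fun t => evalT t f) t (Pi.single j 1) =
      evalT t (qPartial j f) := fun j => by
    have := fderiv_evalTH 0 (constH r f) t j
    simpa only [qDeriv_constH, evalTH_constH] using this
  conv_lhs => rw [← Finset.univ_sum_single u]
  rw [map_sum]
  refine Finset.sum_congr rfl fun j _ => ?_
  rw [← hsingle j, ← smul_eq_mul, ← map_smul, ← Pi.single_smul, smul_eq_mul, mul_one]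

/-- Matrices as continuous endomorphisms. -/
def toEnd (n : ℕ) : Matrix (Fin n) (Fin n) ℂ →ₐ[ℂ] (Fin n → ℂ) →L[ℂ] (Fin n → ℂ) :=
  ((Matrix.toLinAlgEquiv' (R := ℂ) (n := Fin n)).trans
    (Module.End.toContinuousLinearMap (Fin n → ℂ))).toAlgHom

theorem toEnd_apply (M : Matrix (Fin n) (Fin n) ℂ) (v : Fin n → ℂ) :
    toEnd n M v = M.mulVec v := rfl

/-- A matrix entry of a continuous endomorphism. -/
def endEntry (a b : Fin n) : ((Fin n → ℂ) →L[ℂ] (Fin n → ℂ)) →L[ℂ] ℂ :=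
  (ContinuousLinearMap.proj (R := ℂ) (φ := fun _ : Fin n => ℂ) a).comp
    (ContinuousLinearMap.apply ℂ (Fin n → ℂ) (Pi.single b 1))

theorem endEntry_apply (a b : Fin n) (T : (Fin n → ℂ) →L[ℂ] (Fin n → ℂ)) :
    endEntry a b T = T (Pi.single b 1) a := rfl

theorem endEntry_mul_toEnd (a b : Fin n) (T : (Fin n → ℂ) →L[ℂ] (Fin n → ℂ))
    (M : Matrix (Fin n) (Fin n) ℂ) :
    endEntry a b (T * toEnd n M) = ∑ c, endEntry a c T * M c b := by
  change T (toEnd n M (Pi.single b 1)) a = _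
  rw [toEnd_apply, Matrix.mulVec_single_one, ← Finset.univ_sum_single (M.col b), map_sum,
    Finset.sum_apply]
  refine Finset.sum_congr rfl fun c _ => ?_
  have : (Pi.single c (M.col b c) : Fin n → ℂ) = M c b • Pi.single c 1 := by
    rw [← Pi.single_smul, smul_eq_mul, mul_one]
    rfl
  rw [this, map_smul, Pi.smul_apply, smul_eq_mul, mul_comm, endEntry_apply]

theorem endEntry_one (a b : Fin n) :
    endEntry a b (1 : (Fin n → ℂ) →L[ℂ] (Fin n → ℂ)) = (1 : Matrix (Fin n) (Fin n) ℂ) a b := by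
  rw [endEntry_apply, one_apply_eq_self, Matrix.one_apply, Pi.single_apply]

variable {𝔸 : Type*} [NormedRing 𝔸] [NormedAlgebra ℂ 𝔸] (ψ : Matrix (Fin n) (Fin n) ℂ →ₐ[ℂ] 𝔸)

/-- The one-form `∑ Wᵢ(e^t) dtᵢ`. -/
def pencilForm (W : Fin r → Matrix (Fin n) (Fin n) (QRing r)) (t : Fin r → ℂ) :
    (Fin r → ℂ) →L[ℂ] 𝔸 :=
  ∑ i, ∑ a, ∑ b, evalT t (W i a b) •
    (ContinuousLinearMap.proj (R := ℂ) (φ := fun _ : Fin r => ℂ) i).smulRight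
      (ψ (Matrix.single a b (1 : ℂ)))

theorem sum_smul_map_single (M : Matrix (Fin n) (Fin n) ℂ) :
    ∑ a, ∑ b, M a b • ψ (Matrix.single a b (1 : ℂ)) = ψ M := by
  conv_rhs => rw [Matrix.matrix_eq_sum_single M]
  simp only [map_sum, ← map_smul, Matrix.smul_single, smul_eq_mul, mul_one]

theorem pencilForm_apply (W : Fin r → Matrix (Fin n) (Fin n) (QRing r)) (t v : Fin r → ℂ) :
    pencilForm ψ W t v = ∑ i, v i • ψ ((W i).map (evalT t)) := by
  simp only [pencilForm, sum_apply, smul_apply, ContinuousLinearMap.smulRight_apply,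
    ContinuousLinearMap.proj_apply]
  refine Finset.sum_congr rfl fun i _ => ?_
  simp only [smul_comm (evalT t _) (v i), ← Finset.smul_sum]
  rw [← sum_smul_map_single ψ ((W i).map (evalT t))]
  rfl

theorem contDiff_pencilForm (W : Fin r → Matrix (Fin n) (Fin n) (QRing r)) :
    ContDiff ℂ ∞ (pencilForm ψ W) :=
  ContDiff.sum fun _ _ => ContDiff.sum fun _ _ => ContDiff.sum fun _ _ =>
    (contDiff_evalT _).smul contDiff_const

theorem fderiv_pencilForm (W : Fin r → Matrix (Fin n) (Fin n) (QRing r)) (t u v : Fin r → ℂ) :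
    fderiv ℂ (pencilForm ψ W) t u v =
      ∑ i, ∑ j, (v i * u j) • ψ (((W i).map (qPartial j)).map (evalT t)) := by
  have hterm : ∀ (f : QRing r) (C : (Fin r → ℂ) →L[ℂ] 𝔸), HasFDerivAt (fun t => evalT t f • C)
      ((fderiv ℂ (fun t => evalT t f) t).smulRight C) t := fun f C =>
    ((contDiff_evalT f).contDiffAt.differentiableAt (by simp)).hasFDerivAt.smul_const C
  have hd : HasFDerivAt (pencilForm ψ W) (∑ i, ∑ a, ∑ b,
      (fderiv ℂ (fun t => evalT t (W i a b)) t).smulRight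
        ((ContinuousLinearMap.proj (R := ℂ) (φ := fun _ : Fin r => ℂ) i).smulRight
          (ψ (Matrix.single a b (1 : ℂ))))) t :=
    HasFDerivAt.fun_sum fun i _ => HasFDerivAt.fun_sum fun a _ => HasFDerivAt.fun_sum fun b _ =>
      hterm _ _
  rw [hd.fderiv]
  simp only [sum_apply, smul_apply, ContinuousLinearMap.smulRight_apply,
    ContinuousLinearMap.proj_apply, fderiv_evalT]
  refine Finset.sum_congr rfl fun i _ => ?_
  simp only [← map_smul]
  rw [← map_sum, ← sum_smul_map_single ψ]
  refine Finset.sum_congr rfl fun a _ => Finset.sum_congr rfl fun b _ => ?_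
  rw [smul_smul, map_smul ψ _ (Matrix.single a b 1), Matrix.sum_apply, Finset.sum_mul]
  congr 1
  refine Finset.sum_congr rfl fun j _ => ?_
  simp only [Matrix.smul_apply, Matrix.map_apply, smul_eq_mul]
  ring

theorem isClosedCommuting_pencilForm {W : Fin r → Matrix (Fin n) (Fin n) (QRing r)}
    (hcomm : ∀ i j, W i * W j = W j * W i)
    (hclosed : ∀ i j, (W j).map (qPartial i) = (W i).map (qPartial j)) :
    IsClosedCommuting (pencilForm ψ W) where
  smooth := contDiff_pencilForm ψ W
  closed t u v := by
    rw [fderiv_pencilForm, fderiv_pencilForm, Finset.sum_comm]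
    refine Finset.sum_congr rfl fun i _ => Finset.sum_congr rfl fun j _ => ?_
    rw [hclosed, mul_comm]
  comm t u v := by
    rw [pencilForm_apply, pencilForm_apply]
    refine Commute.sum_left _ _ _ fun i _ => Commute.sum_right _ _ _ fun j _ => ?_
    refine (Commute.smul_left ?_ _).smul_right _
    change ψ _ * ψ _ = ψ _ * ψ _
    rw [← map_mul, ← map_mul, ← Matrix.map_mul, hcomm, Matrix.map_mul]

/-- A fundamental system of flat sections of the pencil `d + z W`. -/
structure IsFlatFamily (W : Fin r → Matrix (Fin n) (Fin n) (QRing r))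
    (F : (Fin r → ℂ) → ℂ → Matrix (Fin n) (Fin n) ℂ) : Prop where
  zero_right : ∀ t, F t 0 = 1
  zero_left : ∀ z, F 0 z = 1
  entire : ∀ t a b, Differentiable ℂ fun z => F t z a b
  smooth : ∀ a b, ContDiff ℂ ∞ fun p : (Fin r → ℂ) × ℂ => F p.1 (Complex.exp p.2) a b
  holomorphic : ∀ z a b, Differentiable ℂ fun t => F t z a b
  tPartial_eq : ∀ i t z, tPartial i (fun t => F t z) t = z • (F t z * (W i).map (evalT t))

theorem exists_isFlatFamily {W : Fin r → Matrix (Fin n) (Fin n) (QRing r)}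
    (hcomm : ∀ i j, W i * W j = W j * W i)
    (hclosed : ∀ i j, (W j).map (qPartial i) = (W i).map (qPartial j)) :
    ∃ F, IsFlatFamily W F := by
  -- The series is summed in the Banach algebra of continuous endomorphisms with the operator norm,
  -- and matrix entries are extracted afterwards.
  obtain ⟨F, h0, h0', hent, hsm, hder⟩ :=
    (isClosedCommuting_pencilForm (toEnd n) hcomm hclosed).exists_fundamental_solution
  have hder' : ∀ a b z t, HasFDerivAt (fun t => endEntry a b (F t z))
      ((endEntry a b).comp (z • mulForm (F t z) (pencilForm (toEnd n) W t))) t := fun a b z t =>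
    (endEntry a b).hasFDerivAt.comp t (hder t z)
  refine ⟨fun t z => Matrix.of fun a b => endEntry a b (F t z), fun t => ?_, fun z => ?_,
    fun t a b => (endEntry a b).differentiable.comp (hent t),
    fun a b => (endEntry a b).contDiff.comp hsm, fun z a b t => (hder' a b z t).differentiableAt,
    fun i t z => ?_⟩
  · ext1 a b
    rw [Matrix.of_apply, h0, endEntry_one]
  · ext1 a b
    rw [Matrix.of_apply, h0', endEntry_one]
  · ext1 a b
    rw [tPartial, Matrix.of_apply]
    simp only [Matrix.of_apply]
    rw [(hder' a b z t).fderiv]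
    change endEntry a b (z • (F t z * pencilForm (toEnd n) W t (Pi.single i 1))) = _
    rw [pencilForm_apply, Finset.sum_eq_single i, Pi.single_eq_same, one_smul, map_smul,
      endEntry_mul_toEnd, Matrix.smul_apply, Matrix.mul_apply]
    · rfl
    · intro j _ hj
      rw [Pi.single_eq_of_ne hj]
      exact zero_smul ℂ (toEnd n ((W j).map (evalT t)))
    · simp

/-- If G solves the dual equation with −Wᵀ, then FGᵀ has zero derivative and equals 1 at t = 0, so
Gᵀ is the inverse of F. -/
theorem IsFlatFamily.isUnit {W : Fin r → Matrix (Fin n) (Fin n) (QRing r)}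
    (hcomm : ∀ i j, W i * W j = W j * W i)
    (hclosed : ∀ i j, (W j).map (qPartial i) = (W i).map (qPartial j))
    {F : (Fin r → ℂ) → ℂ → Matrix (Fin n) (Fin n) ℂ} (hF : IsFlatFamily W F) (t : Fin r → ℂ)
    (z : ℂ) : IsUnit (F t z) := by
  obtain ⟨G, hG⟩ := exists_isFlatFamily (W := fun i => -(W i).transpose)
    (fun i j => by simp only [neg_mul_neg, ← Matrix.transpose_mul, hcomm]) fun i j => by
      ext1 a b
      have := congrFun (congrFun (hclosed i j) b) a
      simp only [Matrix.map_apply, qPartial, Matrix.neg_apply, Matrix.transpose_apply, map_neg,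
        mul_neg] at this ⊢
      rw [this]
  have hFd : ∀ t a b, DifferentiableAt ℂ (fun t => F t z a b) t := fun t a b =>
    hF.holomorphic z a b t
  have hGd : ∀ t a b, DifferentiableAt ℂ (fun t => (G t z).transpose a b) t := fun t a b =>
    hG.holomorphic z b a t
  have hGt : ∀ i t, tPartial i (fun t => (G t z).transpose) t =
      (tPartial i (fun t => G t z) t).transpose := fun i t => rfl
  have hzero : ∀ i t, tPartial i (fun t => F t z * (G t z).transpose) t = 0 := by
    intro i t
    rw [tPartial_mul (hFd t) (hGd t), hGt, hF.tPartial_eq, hG.tPartial_eq]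
    have hneg : (-(W i).transpose).map (evalT t) = -((W i).map (evalT t)).transpose := by
      ext1 a b
      simp
    rw [hneg, mul_neg, smul_neg, Matrix.transpose_neg, Matrix.transpose_smul,
      Matrix.transpose_mul, Matrix.transpose_transpose, Matrix.smul_mul, mul_neg, Matrix.mul_smul,
      mul_assoc, add_neg_cancel]
  have hconst : F t z * (G t z).transpose = 1 := by
    ext1 a b
    have hd : Differentiable ℂ fun t => (F t z * (G t z).transpose) a b := by
      simp only [Matrix.mul_apply]
      exact Differentiable.fun_sum fun c _ t => (hFd t a c).fun_mul (hGd t c b)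
    have hf0 : ∀ t, fderiv ℂ (fun t => (F t z * (G t z).transpose) a b) t = 0 := fun t =>
      ContinuousLinearMap.coe_injective (LinearMap.pi_ext' fun i => LinearMap.ext_ring
        (congrFun (congrFun (hzero i t) a) b))
    have := is_const_of_fderiv_eq_zero hd hf0 t 0
    rw [this, hF.zero_left, hG.zero_left, Matrix.transpose_one, one_mul]
  exact (Matrix.isUnit_iff_isUnit_det _).2 (Matrix.isUnit_det_of_right_inverse hconst)

end FlatSections

/-! ### Polynomial factors -/

section PolynomialFactor

variable {r n : ℕ} {U : Set (Fin r → ℂ)}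

theorem IsLoopFamily.mul {γ δ : (Fin r → ℂ) → Circle → Matrix (Fin n) (Fin n) ℂ}
    (hγ : IsLoopFamily U γ) (hδ : IsLoopFamily U δ) :
    IsLoopFamily U fun t h => γ t h * δ t h where
  isUnit t ht h := (hγ.isUnit t ht h).mul (hδ.isUnit t ht h)
  smooth a b := by
    simp only [Matrix.mul_apply]
    exact ContDiffOn.sum fun c _ => (hγ.smooth a c).mul (hδ.smooth c b)
  holomorphic a b h := by
    simp only [Matrix.mul_apply]
    exact DifferentiableOn.fun_sum fun c _ => (hγ.holomorphic a c h).mul (hδ.holomorphic c b h)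

theorem contDiff_real_prod_ofReal (c : ℂ) :
    ContDiff ℝ ∞ fun p : (Fin r → ℂ) × ℝ => (p.1, (p.2 : ℂ) * c) :=
  contDiff_fst.prodMk ((Complex.ofRealCLM.contDiff.comp contDiff_snd).mul contDiff_const)

theorem isLoopFamily_evalTH {L : Matrix (Fin n) (Fin n) (QHRing r)} (hL : IsUnit L) :
    IsLoopFamily U fun t (h : Circle) => L.map (evalTH t (h : ℂ)) where
  isUnit t _ h := hL.map (evalTH t (h : ℂ)).mapMatrix
  smooth a b := by
    have h1 : ContDiff ℂ ∞ fun p : (Fin r → ℂ) × ℂ => (p.1, Complex.exp p.2) :=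
      contDiff_fst.prodMk (Complex.contDiff_exp.comp contDiff_snd)
    have h2 := (((contDiff_evalTH (L a b)).comp h1).restrict_scalars ℝ).comp
      (contDiff_real_prod_ofReal Complex.I)
    exact h2.contDiffOn
  holomorphic a b h t _ := (differentiableAt_evalTH _ _ t).differentiableWithinAt

theorem isLoopFamily_flatFamily {W : Fin r → Matrix (Fin n) (Fin n) (QRing r)}
    {F : (Fin r → ℂ) → ℂ → Matrix (Fin n) (Fin n) ℂ} (hF : IsFlatFamily W F)
    (hu : ∀ t z, IsUnit (F t z)) : IsLoopFamily U fun t (h : Circle) => F t (h : ℂ)⁻¹ where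
  isUnit t _ h := hu t _
  smooth a b := by
    have h2 := ((hF.smooth a b).restrict_scalars ℝ).comp (contDiff_real_prod_ofReal (-Complex.I))
    refine h2.contDiffOn.congr fun p _ => ?_
    simp only [Function.comp_apply, Circle.coe_exp, mul_neg, Complex.exp_neg]
  holomorphic a b h := (hF.holomorphic _ a b).differentiableOn

/-- A polynomial gauge transformation to an `h`-independent connection is the plus factor of a
Birkhoff factorization. -/
theorem isPolynomialPlusFactor_of_gauge {A : Fin r → Matrix (Fin n) (Fin n) (QHRing r)}
    {L : Matrix (Fin n) (Fin n) (QHRing r)} (hL : IsUnit L)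
    {W : Fin r → Matrix (Fin n) (Fin n) (QRing r)} (hcomm : ∀ i j, W i * W j = W j * W i)
    (hclosed : ∀ i j, (W j).map (qPartial i) = (W i).map (qPartial j))
    (hgauge : ∀ i, L * A i - hDer i L = (W i).map (constH r) * L) :
    IsPolynomialPlusFactor A U L := by
  obtain ⟨F, hF⟩ := exists_isFlatFamily hcomm hclosed
  have hu := hF.isUnit hcomm hclosed
  have hloopm : IsLoopFamily U fun t (h : Circle) => F t (h : ℂ)⁻¹ := isLoopFamily_flatFamily hF hu
  have hloopp : IsLoopFamily U fun t (h : Circle) => L.map (evalTH t (h : ℂ)) :=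
    isLoopFamily_evalTH hL
  -- F is entire in z with F = 1 at z = 0, so z = h⁻¹ gives a minus loop with logarithmic derivative
  -- h⁻¹W. Multiplying by the gauge transformation on the right yields a solution for the original
  -- connection.
  refine ⟨fun t h => F t (h : ℂ)⁻¹ * L.map (evalTH t (h : ℂ)), fun t h => F t (h : ℂ)⁻¹,
    hloopm.mul hloopp, hloopm, hloopp, fun i t _ h => ?_, fun t _ => ?_, fun t _ => ?_,
    fun _ _ _ => rfl⟩
  · have hm := (Matrix.isUnit_iff_isUnit_det _).1 (hu t (h : ℂ)⁻¹)
    have hp := (Matrix.isUnit_iff_isUnit_det _).1 (hL.map (evalTH t (h : ℂ)).mapMatrix)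
    rw [RingHom.mapMatrix_apply] at hp
    have hh : (h : ℂ) ≠ 0 := Circle.coe_ne_zero h
    have hev := congrArg (fun M : Matrix (Fin n) (Fin n) (QHRing r) => M.map (evalTH t (h : ℂ)))
      (sub_eq_iff_eq_add.1 (hgauge i))
    have hW : ((W i).map (constH r)).map (evalTH t (h : ℂ)) = (W i).map (evalT t) := by
      ext1 a b
      exact evalTH_constH t _ _
    have hD : (hDer i L).map (evalTH t (h : ℂ)) =
        (h : ℂ) • (L.map (qDeriv i)).map (evalTH t (h : ℂ)) := by
      ext1 a b
      simp only [hDer, Matrix.map_apply, Matrix.smul_apply, map_mul, evalTH_hVar, smul_eq_mul]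
    rw [Matrix.map_mul, Matrix.map_add _ (map_add _), Matrix.map_mul, hW, hD] at hev
    rw [tPartial_mul (f := fun t => F t (h : ℂ)⁻¹) (g := fun t => L.map (evalTH t (h : ℂ)))
      (fun a b => hF.holomorphic _ a b t) (fun a b => differentiableAt_evalTH _ _ t), hF.tPartial_eq, tPartial_evalTH, connection,
      Matrix.mul_inv_rev]
    have hsum : (h : ℂ)⁻¹ • (F t (h : ℂ)⁻¹ * (W i).map (evalT t)) * L.map (evalTH t (h : ℂ)) +
        F t (h : ℂ)⁻¹ * (L.map (qDeriv i)).map (evalTH t (h : ℂ)) =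
        F t (h : ℂ)⁻¹ * (L.map (evalTH t (h : ℂ)) * ((h : ℂ)⁻¹ • (A i).map (evalTH t (h : ℂ)))) := by
      rw [Matrix.mul_smul, hev, smul_add, smul_smul, inv_mul_cancel₀ hh, one_smul, mul_add,
        Matrix.smul_mul, Matrix.mul_smul, mul_assoc]
    rw [hsum, mul_assoc, Matrix.nonsing_inv_mul_cancel_left _ _ hm,
      Matrix.nonsing_inv_mul_cancel_left _ _ hp]
  · exact ⟨F t, ⟨fun a b => (hF.entire t a b).diffContOnCl, fun z _ => hu t z⟩, hF.zero_right t,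
      fun h => rfl⟩
  · refine ⟨fun z => L.map (evalTH t z), ⟨isDiscFun_evalTH t L, fun z _ =>
      hL.map (evalTH t z).mapMatrix⟩, ?_, fun h => rfl⟩
    ext1 a b
    exact evalTH_zero t _

theorem infinite_exp_image_ball (x : ℂ) {ε : ℝ} (hε : 0 < ε) :
    (Complex.exp '' Metric.ball x ε).Infinite := by
  have hinj : Set.InjOn (fun s : ℝ => Complex.exp (x + s)) (Set.Ioo 0 ε) := by
    intro s _ s' _ h
    have h' := congrArg norm h
    simp only [Complex.exp_add, norm_mul] at h'
    have h'' := mul_left_cancel₀ (norm_ne_zero_iff.2 (Complex.exp_ne_zero x)) h'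
    rw [Complex.norm_exp_ofReal, Complex.norm_exp_ofReal] at h''
    exact Real.exp_injective h''
  refine ((Set.Ioo_infinite hε).image hinj).mono ?_
  rintro _ ⟨s, hs, rfl⟩
  refine ⟨x + s, ?_, rfl⟩
  rw [mem_ball_iff_norm, add_sub_cancel_left, Complex.norm_real, Real.norm_of_nonneg hs.1.le]
  exact hs.2

theorem infinite_range_circle : (Set.range fun h : Circle => (h : ℂ)).Infinite := by
  have hinj : Set.InjOn (fun θ : ℝ => (Circle.exp θ : ℂ)) (Set.Ioo 0 1) := by
    intro θ hθ θ' hθ' h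
    have hmem : ∀ x ∈ Set.Ioo (0 : ℝ) 1, -Real.pi < x ∧ x ≤ Real.pi := fun x hx =>
      ⟨by linarith [Real.pi_pos, hx.1], by linarith [Real.pi_gt_three, hx.2]⟩
    have h2 := congrArg Complex.arg h
    dsimp only at h2
    rwa [Circle.arg_exp (hmem θ hθ).1 (hmem θ hθ).2,
      Circle.arg_exp (hmem θ' hθ').1 (hmem θ' hθ').2] at h2
  refine ((Set.Ioo_infinite one_pos).image hinj).mono ?_
  rintro _ ⟨θ, -, rfl⟩
  exact ⟨Circle.exp θ, rfl⟩

/-- An open set contains a polydisc whose exponential is a product of infinite sets, and the circle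
is infinite: enough points to determine a polynomial in q and h. -/
theorem eq_zero_of_evalTH_eq_zero (hU : IsOpen U) (hne : U.Nonempty) {f : QHRing r}
    (hf : ∀ t ∈ U, ∀ h : Circle, evalTH t (h : ℂ) f = 0) : f = 0 := by
  obtain ⟨t₀, ht₀⟩ := hne
  obtain ⟨ε, hε, hball⟩ := Metric.isOpen_iff.1 hU t₀ ht₀
  have hz : ∀ h : Circle, MvPolynomial.map (Polynomial.evalRingHom (h : ℂ)) f = 0 := by
    intro h
    refine MvPolynomial.funext_set (fun j => Complex.exp '' Metric.ball (t₀ j) ε)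
      (fun j => infinite_exp_image_ball _ hε) fun x hx => ?_
    choose s hs hsx using fun j => hx j trivial
    have hsU : s ∈ U := hball ((mem_ball_iff_norm.2 ((pi_norm_lt_iff hε).2 fun j =>
      mem_ball_iff_norm.1 (hs j))))
    have := hf s hsU h
    rw [map_zero, MvPolynomial.eval_map]
    rwa [evalTH, MvPolynomial.coe_eval₂Hom, funext hsx] at this
  ext1 d
  rw [MvPolynomial.coeff_zero]
  refine Polynomial.eq_zero_of_infinite_isRoot _ (infinite_range_circle.mono ?_)
  rintro _ ⟨h, rfl⟩
  have := congrArg (MvPolynomial.coeff d) (hz h)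
  rwa [MvPolynomial.coeff_map, MvPolynomial.coeff_zero] at this

/-- A polynomial plus factor gauges the connection to a multiple of an `h`-independent one. -/
theorem IsPolynomialPlusFactor.gauge_eq {A : Fin r → Matrix (Fin n) (Fin n) (QHRing r)}
    {L : Matrix (Fin n) (Fin n) (QHRing r)} (h : IsPolynomialPlusFactor A U L) (hU : IsOpen U)
    (hne : U.Nonempty) (i : Fin r) :
    constH r (constTerm L).det • (L * A i - hDer i L) =
      (constTerm L * (A i).map (hZero r) * (constTerm L).adjugate).map (constH r) * L := by
  obtain ⟨L', Lm, hB⟩ := h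
  rw [← sub_eq_zero]
  ext1 a b
  refine eq_zero_of_evalTH_eq_zero hU hne fun t ht z => ?_
  have hz : (z : ℂ) ≠ 0 := Circle.coe_ne_zero z
  have hp := (Matrix.isUnit_iff_isUnit_det _).1 (hB.loop_plus.isUnit t ht z)
  have hg := hB.gauge_factors hU ht i z
  rw [hB.minus_gauge hU ht, tPartial_evalTH, connection] at hg
  have hg2 := congrArg (fun M => (z : ℂ) • (M * L.map (evalTH t (z : ℂ)))) hg
  simp only [add_mul, smul_add, Matrix.smul_mul, Matrix.mul_smul, smul_smul, mul_inv_cancel₀ hz,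
    one_smul, Matrix.nonsing_inv_mul_cancel_right _ _ hp] at hg2
  set B := (constTerm L).map (evalT t) with hBdef
  have hdet : evalT t (constTerm L).det = B.det := RingHom.map_det _ _
  have hBu : IsUnit B.det := (Matrix.isUnit_iff_isUnit_det _).1 (hB.isUnit_plus_zero ht)
  -- B₀ is known to be invertible only at the points e^t with t in U, not over ℂ[q]; hence adjugate
  -- and determinant replace its inverse.
  have hadj : ((constTerm L).adjugate).map (evalT t) = B.det • B⁻¹ := by
    have h1 : ((constTerm L).adjugate).map (evalT t) = B.adjugate :=
      RingHom.map_adjugate (evalT t) _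
    rw [h1, Matrix.inv_def, smul_smul, Ring.mul_inverse_cancel _ hBu, one_smul]
  have hD : (hDer i L).map (evalTH t (z : ℂ)) =
      (z : ℂ) • (L.map (qDeriv i)).map (evalTH t (z : ℂ)) := by
    ext1 a b
    simp only [hDer, Matrix.map_apply, Matrix.smul_apply, map_mul, evalTH_hVar, smul_eq_mul]
  have hcH : ∀ M : Matrix (Fin n) (Fin n) (QRing r),
      (M.map (constH r)).map (evalTH t (z : ℂ)) = M.map (evalT t) := fun M => by
    ext1 a b
    exact evalTH_constH t _ _
  have hsm : ∀ (f : QHRing r) (M : Matrix (Fin n) (Fin n) (QHRing r)),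
      (f • M).map (evalTH t (z : ℂ)) = evalTH t (z : ℂ) f • M.map (evalTH t (z : ℂ)) := fun f M => by
    ext1 a b
    exact map_mul (evalTH t (z : ℂ)) _ _
  have hmat : (constH r (constTerm L).det • (L * A i - hDer i L) -
      (constTerm L * (A i).map (hZero r) * (constTerm L).adjugate).map (constH r) * L).map
        (evalTH t (z : ℂ)) = 0 := by
    rw [Matrix.map_sub _ (map_sub _), Matrix.map_mul, hcH, Matrix.map_mul, Matrix.map_mul, hadj,
      hsm, Matrix.map_sub _ (map_sub _), Matrix.map_mul, hD,
      evalTH_constH, hdet, sub_eq_zero, Matrix.mul_smul, Matrix.smul_mul]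
    rw [← hg2, gaugedLimit, add_sub_cancel_right]
  exact congrFun (congrFun hmat a) b

theorem constantCoeff_constTerm {L : Matrix (Fin n) (Fin n) (QHRing r)}
    (hL0 : L.map (qZeroH r) = 1) : (constTerm L).map MvPolynomial.constantCoeff = 1 := by
  ext1 a b
  have := congrArg (fun p : Polynomial ℂ => p.coeff 0) (congrFun (congrFun hL0 a) b)
  rw [Matrix.map_apply, qZeroH_apply] at this
  rw [constTerm, Matrix.map_apply, Matrix.map_apply, MvPolynomial.constantCoeff_eq, coeff_hZero,
    this, Matrix.one_apply, Matrix.one_apply]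
  split_ifs <;> simp

/-- The quotient X = L'L⁻¹ intertwines two h-independent connections up to the factor det B₀', which
is nonzero because it is 1 at q = 0. As X is polynomial and normalized at q = 0, it equals 1 by
`eq_one_of_gauge`. -/
theorem IsPolynomialPlusFactor.eq_of_gauge {A : Fin r → Matrix (Fin n) (Fin n) (QHRing r)}
    {L L' : Matrix (Fin n) (Fin n) (QHRing r)} (h : IsPolynomialPlusFactor A U L')
    (hU : IsOpen U) (hne : U.Nonempty) (hL'0 : L'.map (qZeroH r) = 1) (hL : IsUnit L)
    (hL0 : L.map (qZeroH r) = 1) {W : Fin r → Matrix (Fin n) (Fin n) (QRing r)}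
    (hgauge : ∀ i, L * A i - hDer i L = (W i).map (constH r) * L) : L' = L := by
  obtain ⟨K, hKL⟩ : ∃ K, K * L = 1 := ⟨_, Matrix.nonsing_inv_mul _
    ((Matrix.isUnit_iff_isUnit_det _).1 hL)⟩
  set X := L' * K with hX
  have hXL : X * L = L' := by rw [hX, mul_assoc, hKL, mul_one]
  set g := (constTerm L').det with hg
  have hlow : ∀ M : Matrix (Fin n) (Fin n) (QRing r),
      M.map (constH r) ∈ matSupp fun _ _ _ l => l = 0 := by
    intro M
    refine mem_matSupp.2 fun a b d l hl => ?_
    rw [Matrix.map_apply, coeff_constH, Polynomial.coeff_C] at hl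
    by_contra h0
    exact hl (if_neg h0)
  have hg0 : g ≠ 0 := by
    have h1 := constantCoeff_constTerm hL'0
    intro h0
    have h2 : MvPolynomial.constantCoeff g = 1 := by
      rw [hg, RingHom.map_det]
      change ((constTerm L').map (MvPolynomial.constantCoeff)).det = 1
      rw [h1, Matrix.det_one]
    rw [h0, map_zero] at h2
    exact zero_ne_one h2
  have hX0 : X.map (qZeroH r) = 1 := by
    have hK0 : K.map (qZeroH r) = 1 := by
      have := congrArg (fun M : Matrix (Fin n) (Fin n) (QHRing r) => M.map (qZeroH r)) hKL
      rwa [Matrix.map_mul, hL0, mul_one, Matrix.map_one _ (map_zero _) (map_one _)] at this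
    rw [hX, Matrix.map_mul, hL'0, hK0, one_mul]
  have hLK : L * K = 1 := mul_eq_one_comm.1 hKL
  have hi : ∀ i, constH r g • hDer i X = constH r g • (X * (W i).map (constH r)) -
      (constTerm L' * (A i).map (hZero r) * (constTerm L').adjugate).map (constH r) * X := by
    intro i
    have h1 := h.gauge_eq hU hne i
    rw [← hg] at h1
    set Z := (constTerm L' * (A i).map (hZero r) * (constTerm L').adjugate).map (constH r)
    have h2 : L' * A i - hDer i L' = (X * (W i).map (constH r) - hDer i X) * L := by
      rw [← hXL, hDer_mul, sub_mul, mul_assoc X _ L, ← hgauge i, mul_sub, mul_assoc]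
      abel
    have h3 : constH r g • (X * (W i).map (constH r) - hDer i X) = Z * X := by
      have h4 := congrArg (fun M => M * K) h1
      rwa [h2, Matrix.smul_mul, mul_assoc _ L K, hLK, mul_one, mul_assoc Z L' K] at h4
    rw [← h3, smul_sub, sub_sub_cancel]
  have hone := eq_one_of_gauge hg0 (V := ∑ i, (W i).map (constH r))
    (Z := ∑ i, (constTerm L' * (A i).map (hZero r) * (constTerm L').adjugate).map (constH r))
    (Submodule.sum_mem _ fun i _ => hlow _) (Submodule.sum_mem _ fun i _ => hlow _) hX0 (by
      rw [Finset.smul_sum, Finset.mul_sum, Finset.smul_sum, Finset.sum_mul,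
        ← Finset.sum_sub_distrib]
      exact Finset.sum_congr rfl fun i _ => hi i)
  rw [← hXL, hone, one_mul]

end PolynomialFactor

/-! ### Rescaling and homogeneity in `QH` -/

section Rescale

/-- The homomorphism `X ↦ z X` over a homomorphism of coefficient rings. -/
def rescale {ι A B : Type*} [CommSemiring A] [CommSemiring B] (φ : A →+* B) (z : B) :
    MvPolynomial ι A →+* MvPolynomial ι B :=
  MvPolynomial.eval₂Hom (MvPolynomial.C.comp φ) fun i => MvPolynomial.C z * MvPolynomial.X i

theorem coeff_rescale {ι A B : Type*} [CommSemiring A] [CommSemiring B] (φ : A →+* B) (z : B)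
    (f : MvPolynomial ι A) (d : ι →₀ ℕ) :
    (rescale φ z f).coeff d = z ^ d.degree * φ (f.coeff d) := by
  classical
  induction f using MvPolynomial.induction_on' with
  | monomial u a =>
    have h : rescale φ z (MvPolynomial.monomial u a) =
        MvPolynomial.monomial u (z ^ u.degree * φ a) := by
      rw [rescale, MvPolynomial.eval₂Hom_monomial, RingHom.comp_apply, MvPolynomial.monomial_eq,
        map_mul, map_pow]
      simp only [mul_pow, Finsupp.prod, Finset.prod_mul_distrib, Finset.prod_pow_eq_pow_sum]
      rw [Finsupp.degree_apply]
      ring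
    rw [h, MvPolynomial.coeff_monomial, MvPolynomial.coeff_monomial]
    split_ifs with hud
    · rw [hud]
    · rw [map_zero, mul_zero]
  | add p q hp hq => rw [map_add, MvPolynomial.coeff_add, hp, hq, MvPolynomial.coeff_add, map_add,
      mul_add]

/-- The automorphism `q ↦ 16 q` of `ℂ[q]`. -/
def rescaleQ (r : ℕ) : QRing r →+* QRing r := rescale (RingHom.id ℂ) (2 ^ 4)

/-- The automorphism `b ↦ 4 b`, `q ↦ 16 q` of `ℂ[b, q]`. -/
def rescaleBQ (r : ℕ) : BQRing r →+* BQRing r := rescale (rescaleQ r) (MvPolynomial.C (2 ^ 2))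

variable {r u n : ℕ}

theorem coeff_rescaleQ (f : QRing r) (d : Fin r →₀ ℕ) :
    (rescaleQ r f).coeff d = 2 ^ (4 * d.degree) * f.coeff d := by
  rw [rescaleQ, coeff_rescale, ← pow_mul, RingHom.id_apply]

theorem coeff_rescaleBQ (c : BQRing r) (α d : Fin r →₀ ℕ) :
    ((rescaleBQ r c).coeff α).coeff d =
      2 ^ (2 * α.degree + 4 * d.degree) * (c.coeff α).coeff d := by
  rw [rescaleBQ, coeff_rescale, ← map_pow, MvPolynomial.coeff_C_mul, coeff_rescaleQ, ← pow_mul,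
    pow_add, mul_assoc]

theorem rescaleBQ_C (f : QRing r) :
    rescaleBQ r (MvPolynomial.C f) = MvPolynomial.C (rescaleQ r f) := by
  rw [rescaleBQ, rescale, MvPolynomial.eval₂Hom_C, RingHom.comp_apply]

/-- The scalar `a` in `ℂ[b, q]`. -/
def constBQ (r : ℕ) (a : ℂ) : BQRing r := MvPolynomial.C (MvPolynomial.C a)

theorem rescaleBQ_of_isHomog {c : BQRing r} {N : ℕ} (hc : IsHomog c N) :
    rescaleBQ r c = constBQ r (2 ^ N) * c := by
  ext α d
  rw [coeff_rescaleBQ, constBQ, MvPolynomial.coeff_C_mul, MvPolynomial.coeff_C_mul]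
  by_cases h : (c.coeff α).coeff d = 0
  · rw [h, mul_zero, mul_zero]
  · rw [hc α d h]

theorem isHomog_of_symbolHZero {σ : BQHRing r} {N : ℕ} (hσ : IsHomogH σ N) :
    IsHomog (symbolHZero r σ) N := by
  intro α d h
  rw [symbolHZero, MvPolynomial.coeff_map, coeff_hZero] at h
  exact hσ α d 0 h

theorem isHomog_sum {ι : Type*} (s : Finset ι) {c : ι → BQRing r} {N : ℕ}
    (hc : ∀ i ∈ s, IsHomog (c i) N) : IsHomog (∑ i ∈ s, c i) N := by
  intro α d h
  rw [MvPolynomial.coeff_sum, MvPolynomial.coeff_sum] at h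
  obtain ⟨i, hi, hne⟩ := Finset.exists_ne_zero_of_sum_ne_zero h
  exact hc i hi α d hne

theorem isHomog_monomial {β : Fin r →₀ ℕ} {f : QRing r} {N : ℕ}
    (hf : ∀ d, f.coeff d ≠ 0 → 2 * β.degree + 4 * d.degree = N) :
    IsHomog (MvPolynomial.monomial β f) N := by
  classical
  intro α d h
  rw [MvPolynomial.coeff_monomial] at h
  split_ifs at h with hα
  · rw [← hα]
    exact hf d h
  · exact absurd (MvPolynomial.coeff_zero d) h

variable {R : Fin u → BQRing r}

/-- Coordinates of homogeneous elements in a homogeneous basis are homogeneous. -/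
theorem coeff_repr_of_isHomog (hR : ∀ i, ∃ N, IsHomog (R i) N)
    (e : Module.Basis (Fin n) (QRing r) (QH R)) {p : Fin n → BQRing r} {ν : Fin n → ℕ}
    (hp : ∀ j, IsHomog (p j) (ν j)) (he : ∀ j, e j = qhClass R (p j)) {c : BQRing r} {N : ℕ}
    (hc : IsHomog c N) (j : Fin n) (d : Fin r →₀ ℕ)
    (hd : (e.repr (qhClass R c) j).coeff d ≠ 0) : 4 * d.degree + ν j = N := by
  have hI : ∀ x ∈ Ideal.span (Set.range R),
      ((Ideal.Quotient.mk (Ideal.span (Set.range R))).comp (rescaleBQ r)) x = 0 := by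
    intro x hx
    rw [← RingHom.mem_ker]
    refine Ideal.span_le.2 ?_ hx
    rintro _ ⟨i, rfl⟩
    obtain ⟨N, hN⟩ := hR i
    rw [SetLike.mem_coe, RingHom.mem_ker, RingHom.comp_apply, rescaleBQ_of_isHomog hN,
      Ideal.Quotient.eq_zero_iff_mem]
    exact Ideal.mul_mem_left _ _ (Ideal.subset_span ⟨i, rfl⟩)
  -- Homogeneous relations are eigenvectors of the rescaling, so it descends to QH; degrees of
  -- coordinates are then read from its eigenvalues.
  set ρ : QH R →+* QH R := Ideal.Quotient.lift _ _ hI with hρdef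
  have hρ : ∀ x, ρ (qhClass R x) = qhClass R (rescaleBQ r x) := fun x => Ideal.Quotient.lift_mk _ _ _
  have hconst : ∀ (a : ℂ) (x : BQRing r), qhClass R (constBQ r a * x) =
      (MvPolynomial.C a : QRing r) • qhClass R x := fun a x => (smul_qhClass _ _).symm
  have hsmul : ∀ (f : QRing r) (x : BQRing r), ρ (f • qhClass R x) =
      rescaleQ r f • qhClass R (rescaleBQ r x) := fun f x => by
    rw [smul_qhClass, hρ, map_mul, rescaleBQ_C, smul_qhClass]
  have h1 : (MvPolynomial.C (2 ^ N) : QRing r) • qhClass R c =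
      ∑ j, (MvPolynomial.C (2 ^ ν j) * rescaleQ r (e.repr (qhClass R c) j)) • e j := by
    rw [← hconst, ← rescaleBQ_of_isHomog hc, ← hρ]
    conv_lhs => rw [← e.sum_repr (qhClass R c)]
    rw [map_sum]
    refine Finset.sum_congr rfl fun j _ => ?_
    rw [he, hsmul, rescaleBQ_of_isHomog (hp j), hconst, smul_smul, mul_comm]
  have h2 := congrArg (fun x => (e.repr x j).coeff d) h1
  rw [e.repr_sum_self, map_smul, Finsupp.smul_apply, smul_eq_mul, MvPolynomial.coeff_C_mul,
    MvPolynomial.coeff_C_mul, coeff_rescaleQ, ← mul_assoc, ← pow_add, add_comm] at h2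
  have h3 := mul_right_cancel₀ hd h2
  have h4 : (2 : ℕ) ^ N = 2 ^ (4 * d.degree + ν j) := by exact_mod_cast h3
  exact (Nat.pow_right_injective le_rfl h4).symm

/-- The inverse of a homogeneous matrix is homogeneous. -/
theorem coeff_inv_of_homogeneous {B : Matrix (Fin n) (Fin n) (QRing r)} (hB : IsUnit B)
    {w : Fin n → ℕ} (hw : ∀ a b d, (B a b).coeff d ≠ 0 → 2 * d.degree + w a = w b) (a b : Fin n)
    (d : Fin r →₀ ℕ) (hd : (B⁻¹ a b).coeff d ≠ 0) : 2 * d.degree + w a = w b := by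
  have hdet := (Matrix.isUnit_iff_isUnit_det _).1 hB
  set D : Matrix (Fin n) (Fin n) (QRing r) :=
    Matrix.diagonal fun a => MvPolynomial.C ((2 : ℂ) ^ (2 * w a)) with hD
  -- Homogeneity of B in equivariant form, which passes to the inverse.
  have h1 : D * B.map (rescaleQ r) = B * D := by
    ext a b d
    rw [hD, Matrix.diagonal_mul, Matrix.mul_diagonal, Matrix.map_apply, MvPolynomial.coeff_C_mul,
      mul_comm (B a b), MvPolynomial.coeff_C_mul, coeff_rescaleQ, ← mul_assoc, ← pow_add]
    by_cases h : (B a b).coeff d = 0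
    · rw [h, mul_zero, mul_zero]
    · rw [← hw a b d h]
      congr 2
      ring
  have h2 : B.map (rescaleQ r) * B⁻¹.map (rescaleQ r) = 1 := by
    rw [← Matrix.map_mul, Matrix.mul_nonsing_inv _ hdet,
      Matrix.map_one _ (map_zero _) (map_one _)]
  have h3 : B⁻¹ * D = D * B⁻¹.map (rescaleQ r) := by
    have := congrArg (fun M => B⁻¹ * M * B⁻¹.map (rescaleQ r)) h1
    simp only [Matrix.nonsing_inv_mul_cancel_left _ _ hdet] at this
    rw [← this, mul_assoc, mul_assoc D, h2, mul_one]
  have h4 := congrArg (fun M : Matrix (Fin n) (Fin n) (QRing r) => (M a b).coeff d) h3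
  rw [hD, Matrix.diagonal_mul, Matrix.mul_diagonal, Matrix.map_apply, MvPolynomial.coeff_C_mul,
    mul_comm (B⁻¹ a b), MvPolynomial.coeff_C_mul, coeff_rescaleQ, ← mul_assoc, ← pow_add] at h4
  have h5 := mul_right_cancel₀ hd h4
  have h6 : (2 : ℕ) ^ (2 * w b) = 2 ^ (2 * w a + 4 * d.degree) := by exact_mod_cast h5
  have := Nat.pow_right_injective le_rfl h6
  lia

end Rescale

/-! ### Changes of basis of `QH` -/

section ChangeOfBasis

variable {r u n : ℕ} {R : Fin u → BQRing r}

/-- The basis `ĉ_j = ∑ₖ (B⁻¹)ₖⱼ c_k`. -/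
def changeBasis (c : Module.Basis (Fin n) (QRing r) (QH R)) {B : Matrix (Fin n) (Fin n) (QRing r)}
    (hB : IsUnit B) : Module.Basis (Fin n) (QRing r) (QH R) :=
  c.map (Matrix.toLinearEquiv c B⁻¹
    (Matrix.isUnit_nonsing_inv_det _ ((Matrix.isUnit_iff_isUnit_det _).1 hB)))

variable (c : Module.Basis (Fin n) (QRing r) (QH R)) {B : Matrix (Fin n) (Fin n) (QRing r)}
  (hB : IsUnit B)

theorem changeBasis_apply (j : Fin n) :
    changeBasis c hB j = Matrix.toLin c c B⁻¹ (c j) := rfl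

theorem changeBasis_eq_qhClass {m : Fin n → Fin r →₀ ℕ}
    (hc : ∀ j, c j = qhClass R (MvPolynomial.monomial (m j) 1)) (j : Fin n) :
    changeBasis c hB j = qhClass R (cHat m B j) := by
  rw [changeBasis_apply, Matrix.toLin_self, cHat, qhClass, map_sum]
  refine Finset.sum_congr rfl fun k _ => ?_
  rw [hc, smul_qhClass_monomial]
  rfl

theorem mulMatrix_changeBasis (i : Fin r) :
    mulMatrix (changeBasis c hB) i = B * mulMatrix c i * B⁻¹ := by
  have hdet := (Matrix.isUnit_iff_isUnit_det _).1 hB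
  have hmul : ∀ x, qhClass R (MvPolynomial.X i) * x = Matrix.toLin c c (mulMatrix c i) x := by
    have : LinearMap.mulLeft (QRing r) (qhClass R (MvPolynomial.X i)) =
        Matrix.toLin c c (mulMatrix c i) := by
      refine c.ext fun j => ?_
      rw [Matrix.toLin_self]
      exact (c.sum_repr _).symm
    exact fun x => congrArg (fun f => f x) this
  ext1 k j
  rw [mulMatrix, Matrix.of_apply, changeBasis_apply, hmul, ← Matrix.toLin_mul_apply]
  have h1 : mulMatrix c i * B⁻¹ = B⁻¹ * (B * mulMatrix c i * B⁻¹) := by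
    rw [mul_assoc B, Matrix.nonsing_inv_mul_cancel_left _ _ hdet]
  rw [h1, Matrix.toLin_mul_apply c c c, Matrix.toLin_self, map_sum]
  simp only [map_smul, ← changeBasis_apply c hB]
  rw [Module.Basis.repr_sum_self]

end ChangeOfBasis

/-! ### The quantum evaluation map -/

section Evaluation

variable {r u n : ℕ} {R : Fin u → BQRing r}

theorem hqClass_constQ (x : MvPolynomial (Fin r) ℂ) :
    hqClass R (constQ r x) = (1 : QRing r) ⊗ₜ[ℂ] hClass R x := by
  have h : (hqClass R).toRingHom.comp (constQ r) =
      (Algebra.TensorProduct.includeRight : H R →ₐ[ℂ] HQ R).toRingHom.comp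
        (Ideal.Quotient.mk (Ideal.span (Set.range fun i => qZero r (R i)))) := by
    refine MvPolynomial.ringHom_ext (fun a => ?_) fun i => ?_
    · change hqClass R (constQ r (MvPolynomial.C a)) =
        (1 : QRing r) ⊗ₜ[ℂ] hClass R (MvPolynomial.C a)
      rw [constQ, MvPolynomial.map_C, hqClass, MvPolynomial.aeval_C]
      change (MvPolynomial.C a : QRing r) ⊗ₜ[ℂ] (1 : H R) = _
      have h1 : (MvPolynomial.C a : QRing r) = a • 1 := by
        rw [MvPolynomial.smul_eq_C_mul, mul_one]
      have h2 : hClass R (MvPolynomial.C a) = a • 1 := by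
        have : (MvPolynomial.C a : MvPolynomial (Fin r) ℂ) = a • 1 := by
          rw [MvPolynomial.smul_eq_C_mul, mul_one]
        rw [this]
        rfl
      rw [h2, h1, TensorProduct.smul_tmul]
    · change hqClass R (constQ r (MvPolynomial.X i)) =
        (1 : QRing r) ⊗ₜ[ℂ] hClass R (MvPolynomial.X i)
      rw [constQ, MvPolynomial.map_X, hqClass, MvPolynomial.aeval_X]
  exact congrArg (fun f => f x) h

theorem hqClass_monomial (α : Fin r →₀ ℕ) (f : QRing r) :
    hqClass R (MvPolynomial.monomial α f) =
      f • ((1 : QRing r) ⊗ₜ[ℂ] hClass R (MvPolynomial.monomial α 1)) := by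
  have h1 : (MvPolynomial.monomial α f : BQRing r) =
      f • constQ r (MvPolynomial.monomial α 1) := by
    rw [constQ, MvPolynomial.map_monomial, map_one, MvPolynomial.smul_monomial, smul_eq_mul, mul_one]
  rw [h1, map_smul, hqClass_constQ]

theorem hqAtZero_smul_tmul (f : QRing r) (x : H R) :
    hqAtZero R (f • ((1 : QRing r) ⊗ₜ[ℂ] x)) = MvPolynomial.constantCoeff f • x := by
  rw [TensorProduct.smul_tmul', smul_eq_mul, mul_one, hqAtZero, LinearMap.comp_apply,
    LinearMap.rTensor_tmul]
  change (MvPolynomial.aeval (fun _ : Fin r => (0 : ℂ)) f) • x = _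
  rw [MvPolynomial.aeval_zero']
  rfl

/-- The linear map `QH → H ⊗ ℂ[q]` that identifies two bases. -/
def basisEvaluation (e : Module.Basis (Fin n) (QRing r) (QH R)) (b : Module.Basis (Fin n) ℂ (H R)) :
    QH R ≃ₗ[QRing r] HQ R :=
  e.equiv (Algebra.TensorProduct.basis (QRing r) b) (Equiv.refl _)

variable (e : Module.Basis (Fin n) (QRing r) (QH R)) (b : Module.Basis (Fin n) ℂ (H R))

theorem basisEvaluation_basis (j : Fin n) :
    basisEvaluation e b (e j) = (1 : QRing r) ⊗ₜ[ℂ] b j := by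
  rw [basisEvaluation, Module.Basis.equiv_apply, Equiv.refl_apply,
    Algebra.TensorProduct.basis_apply]

theorem basisEvaluation_apply (x : QH R) :
    basisEvaluation e b x = ∑ j, e.repr x j • ((1 : QRing r) ⊗ₜ[ℂ] b j) := by
  conv_lhs => rw [← e.sum_repr x]
  rw [map_sum]
  simp only [map_smul, basisEvaluation_basis]

theorem smul_hClass (a : ℂ) (x : MvPolynomial (Fin r) ℂ) :
    a • hClass R x = hClass R (MvPolynomial.C a * x) := by
  rw [← MvPolynomial.smul_eq_C_mul]
  rfl

variable {e b}

/-- Setting q = 0 descends to a ring homomorphism QH → H. It agrees with the evaluation map followed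
by q = 0 on the basis, and both are semilinear over f ↦ f(0). -/
theorem hqAtZero_basisEvaluation {p : Fin n → BQRing r} (he : ∀ j, e j = qhClass R (p j))
    (hb : ∀ j, b j = hClass R (qZero r (p j))) (c : BQRing r) :
    hqAtZero R (basisEvaluation e b (qhClass R c)) = hClass R (qZero r c) := by
  have hI : ∀ x ∈ Ideal.span (Set.range R),
      ((Ideal.Quotient.mk (Ideal.span (Set.range fun i => qZero r (R i)))).comp (qZero r)) x = 0 := by
    intro x hx
    rw [← RingHom.mem_ker]
    refine Ideal.span_le.2 ?_ hx
    rintro _ ⟨i, rfl⟩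
    rw [SetLike.mem_coe, RingHom.mem_ker, RingHom.comp_apply, Ideal.Quotient.eq_zero_iff_mem]
    exact Ideal.subset_span ⟨i, rfl⟩
  set ε : QH R →+* H R := Ideal.Quotient.lift _ _ hI
  have hε : ∀ x, ε (qhClass R x) = hClass R (qZero r x) := fun x => Ideal.Quotient.lift_mk _ _ _
  have hεsmul : ∀ (f : QRing r) (x : BQRing r), ε (f • qhClass R x) =
      MvPolynomial.constantCoeff f • hClass R (qZero r x) := fun f x => by
    rw [smul_qhClass, hε, map_mul, smul_hClass, qZero, MvPolynomial.map_C]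
  rw [basisEvaluation_apply, map_sum, ← hε]
  conv_rhs => rw [← e.sum_repr (qhClass R c)]
  rw [map_sum]
  refine Finset.sum_congr rfl fun j _ => ?_
  rw [hqAtZero_smul_tmul, he, hεsmul, hb]

/-- The identification of a homogeneous basis of `QH` with a monomial basis of `H`, to which it
restricts at `q = 0`, is a quantum evaluation map. -/
theorem isQuantumEvaluation_basisEvaluation (hR : ∀ i, ∃ N, IsHomog (R i) N)
    {m : Fin n → Fin r →₀ ℕ} {p : Fin n → BQRing r}
    (he : ∀ j, e j = qhClass R (p j)) (hp : ∀ j, IsHomog (p j) (2 * (m j).degree))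
    (hp0 : ∀ j, qZero r (p j) = MvPolynomial.monomial (m j) 1)
    (hb : ∀ j, b j = hClass R (MvPolynomial.monomial (m j) 1)) :
    IsQuantumEvaluation R (basisEvaluation e b : QH R →ₗ[QRing r] HQ R) := by
  have hb' : ∀ j, b j = hClass R (qZero r (p j)) := fun j => by rw [hb, hp0]
  have hzero := hqAtZero_basisEvaluation he hb'
  -- Degree at most 2 leaves no room for a factor q of degree 4 in the coordinates, so the image is
  -- determined by its value at q = 0. This covers 1 and the bᵢ.
  have hlow : ∀ c : BQRing r, ∀ N ≤ 2, IsHomog c N → constQ r (qZero r c) = c →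
      basisEvaluation e b (qhClass R c) = hqClass R c := by
    intro c N hN hc hconst
    have hcoeff : ∀ j, e.repr (qhClass R c) j =
        MvPolynomial.C (MvPolynomial.constantCoeff (e.repr (qhClass R c) j)) := by
      classical
      intro j
      ext d
      rw [MvPolynomial.coeff_C, MvPolynomial.constantCoeff_eq]
      split_ifs with h0
      · rw [h0]
      · by_contra hne
        have := coeff_repr_of_isHomog hR e hp he hc j d hne
        have hd : d.degree ≠ 0 := fun h => h0 ((Finsupp.degree_eq_zero_iff d).1 h).symm
        lia
    have hz := hzero c
    rw [basisEvaluation_apply, map_sum] at hz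
    simp only [hqAtZero_smul_tmul] at hz
    conv_rhs => rw [← hconst]
    rw [hqClass_constQ, ← hz, basisEvaluation_apply, TensorProduct.tmul_sum]
    refine Finset.sum_congr rfl fun j _ => ?_
    rw [hcoeff, MvPolynomial.constantCoeff_C, TensorProduct.tmul_smul, TensorProduct.smul_tmul',
      TensorProduct.smul_tmul', smul_eq_mul, mul_one, MvPolynomial.smul_eq_C_mul, mul_one]
  refine ⟨(basisEvaluation e b).bijective, ?_, fun i => ?_, fun N c hc => ?_, hzero⟩
  · refine hlow 1 0 (by norm_num) ?_ (by simp only [map_one])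
    exact isHomog_monomial (β := 0) (f := 1) fun d hd => by
      classical
      rw [MvPolynomial.coeff_one] at hd
      by_cases h0 : 0 = d
      · simp [← h0]
      · simp [h0] at hd
  · refine hlow _ 2 le_rfl ?_ (by simp only [qZero, constQ, MvPolynomial.map_X])
    exact isHomog_monomial (β := Finsupp.single i 1) (f := 1) fun d hd => by
      classical
      rw [MvPolynomial.coeff_one] at hd
      by_cases h0 : 0 = d
      · simp [← h0]
      · simp [h0] at hd
  -- Each basis element is replaced by its monomial at q = 0, which has the same degree.
  · refine ⟨∑ j, MvPolynomial.monomial (m j) (e.repr (qhClass R c) j),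
      isHomog_sum _ fun j _ => isHomog_monomial fun d hd => ?_, ?_⟩
    · have := coeff_repr_of_isHomog hR e hp he hc j d hd
      lia
    · rw [map_sum]
      refine (basisEvaluation_apply e b _).trans (Finset.sum_congr rfl fun j _ => ?_)
      rw [hqClass_monomial, hb]

end Evaluation

/-! ### Flatness at `h = 0` -/

section Limit

variable {r n : ℕ}

theorem map_hZero_hDer (i : Fin r) (M : Matrix (Fin n) (Fin n) (QHRing r)) :
    (hDer i M).map (hZero r) = 0 := by
  ext1 a b
  exact hZero_hVar_mul_qDeriv i (M a b)

theorem map_hZero_comm_of_flat {A B : Matrix (Fin n) (Fin n) (QHRing r)} {i j : Fin r}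
    (h : A * B + hDer i B = B * A + hDer j A) :
    A.map (hZero r) * B.map (hZero r) = B.map (hZero r) * A.map (hZero r) := by
  have := congrArg (fun M : Matrix (Fin n) (Fin n) (QHRing r) => M.map (hZero r)) h
  rwa [Matrix.map_add _ (map_add _), Matrix.map_add _ (map_add _), map_hZero_hDer, map_hZero_hDer,
    add_zero, add_zero, Matrix.map_mul, Matrix.map_mul] at this

theorem matrix_map_hZero_map_constH (M : Matrix (Fin n) (Fin n) (QRing r)) :
    (M.map (constH r)).map (hZero r) = M := by
  ext1 a b
  exact hZero_constH (M a b)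

theorem comm_of_flat {A B : Matrix (Fin n) (Fin n) (QRing r)} {i j : Fin r}
    (h : A.map (constH r) * B.map (constH r) + hDer i (B.map (constH r)) =
      B.map (constH r) * A.map (constH r) + hDer j (A.map (constH r))) :
    A * B = B * A := by
  have := map_hZero_comm_of_flat h
  rwa [matrix_map_hZero_map_constH, matrix_map_hZero_map_constH] at this

/-- For matrices without h the flatness equation separates by powers of h: order zero is commutation
and order one is closedness. -/
theorem closed_of_flat {A B : Matrix (Fin n) (Fin n) (QRing r)} {i j : Fin r}
    (h : A.map (constH r) * B.map (constH r) + hDer i (B.map (constH r)) =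
      B.map (constH r) * A.map (constH r) + hDer j (A.map (constH r))) :
    B.map (qPartial i) = A.map (qPartial j) := by
  have hcomm := comm_of_flat h
  rw [← Matrix.map_mul, ← Matrix.map_mul, hcomm, add_right_inj] at h
  ext1 a b
  have hab := congrFun (congrFun h a) b
  simp only [hDer, Matrix.map_apply, qDeriv_constH] at hab
  have hX : (hVar r) ≠ 0 := by
    rw [hVar, Ne, MvPolynomial.C_eq_zero]
    exact Polynomial.X_ne_zero
  have h0 := congrArg (hZero r) (mul_left_cancel₀ hX hab)
  rwa [hZero_constH, hZero_constH] at h0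

end Limit

/-! ### The normalized factor -/

section NormalizedFactor

variable {r u n : ℕ} {R : Fin u → BQRing r} {σ : Fin u → BQHRing r} {m : Fin n → Fin r →₀ ℕ}
  {P : Module.Basis (Fin n) (QHRing r) (Mh σ)}

/-- For a homogeneous quantization there is a homogeneous polynomial gauge transformation, equal
to `1` at `q = 0`, to an `h`-independent connection. -/
theorem exists_normalized_factor (hP : ∀ j, P j = mhClass σ (hdMonomial (m j)))
    (hrank : n = Module.finrank ℂ (H R)) (hhom : ∀ i, ∃ N, IsHomogH (σ i) N)
    (hσ : ∀ i, symbolQZero r (σ i) = MvPolynomial.map Polynomial.C (qZero r (R i))) :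
    ∃ (L : Matrix (Fin n) (Fin n) (QHRing r)) (W : Fin r → Matrix (Fin n) (Fin n) (QRing r)),
      IsUnit L ∧ L.map (qZeroH r) = 1 ∧
      (∀ a b d, ((constTerm L) a b).coeff d ≠ 0 → 2 * d.degree + (m a).degree = (m b).degree) ∧
      (∀ i j, W i * W j = W j * W i) ∧
      (∀ i j, (W j).map (qPartial i) = (W i).map (qPartial j)) ∧
      ∀ i, L * hOmega P i - hDer i L = (W i).map (constH r) * L := by
  have hA : ∀ i, hOmega P i ∈ matSupp (wtSupp (fun a => (m a).degree) 1) := fun i =>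
    mem_matSupp.2 fun a b d l hne => hOmega_homogeneous hP hhom i a b d l hne
  have hA0 : ∀ i, hOmega P i ∈ matSupp fun _ _ d l => d.degree = 0 → l = 0 := fun i =>
    mem_matSupp.2 fun a b d l hne hd => by
      have hd0 := (Finsupp.degree_eq_zero_iff d).1 hd
      rw [hd0, coeff_zero_hOmega hσ hP hrank, Polynomial.coeff_C] at hne
      by_contra hl
      exact hne (if_neg hl)
  obtain ⟨L, hL, hunit, hL1, V, hV, hgauge⟩ :=
    exists_normalizing_gauge (A := hOmega P) (hOmega_flat P) hA hA0
  have hVW : ∀ i, ((V i).map (hZero r)).map (constH r) = V i := fun i =>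
    map_constH_map_hZero_of_hDegree (hV i)
  have hflat : ∀ i j, ((V i).map (hZero r)).map (constH r) * ((V j).map (hZero r)).map (constH r) +
      hDer i (((V j).map (hZero r)).map (constH r)) =
      ((V j).map (hZero r)).map (constH r) * ((V i).map (hZero r)).map (constH r) +
      hDer j (((V i).map (hZero r)).map (constH r)) := fun i j => by
    simp only [hVW]
    exact flat_of_gauge hunit (hOmega_flat P) hgauge i j
  refine ⟨L, fun i => (V i).map (hZero r), hunit, ?_, fun a b d hne => ?_,
    fun i j => comm_of_flat (hflat i j), fun i j => closed_of_flat (hflat i j), fun i => ?_⟩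
  · ext a b l
    by_contra hne
    have hne' : (((L - 1) a b).coeff 0).coeff l ≠ 0 := by
      rw [Matrix.map_apply, qZeroH_apply] at hne
      rw [Matrix.sub_apply, MvPolynomial.coeff_sub, Polynomial.coeff_sub, sub_ne_zero]
      convert! hne using 2
      rw [Matrix.one_apply, Matrix.one_apply]
      split_ifs
      · rw [MvPolynomial.coeff_zero_one]
      · rw [MvPolynomial.coeff_zero]
    have := mem_matSupp.1 hL1 a b 0 l hne'
    simp at this
  · rw [constTerm, Matrix.map_apply, coeff_hZero] at hne
    have := mem_matSupp.1 hL a b d 0 hne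
    simpa [wtSupp] using this
  · rw [hVW]
    exact hgauge i

theorem isUnit_constTerm {L : Matrix (Fin n) (Fin n) (QHRing r)} (hL : IsUnit L) :
    IsUnit (constTerm L) :=
  hL.map (hZero r).mapMatrix

/-- The derivative term of the gauge equation vanishes at h = 0. This identifies the transformed
connection with ω̂ = B₀ωB₀⁻¹. -/
theorem conj_constTerm_of_gauge {A L : Matrix (Fin n) (Fin n) (QHRing r)} (hL : IsUnit L)
    {i : Fin r} {W : Matrix (Fin n) (Fin n) (QRing r)}
    (h : L * A - hDer i L = W.map (constH r) * L) :
    constTerm L * A.map (hZero r) * (constTerm L)⁻¹ = W := by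
  have hB := (Matrix.isUnit_iff_isUnit_det _).1 (isUnit_constTerm hL)
  have h0 := congrArg (fun M : Matrix (Fin n) (Fin n) (QHRing r) => M.map (hZero r)) h
  rw [Matrix.map_sub _ (map_sub _), map_hZero_hDer, sub_zero, Matrix.map_mul, Matrix.map_mul,
    matrix_map_hZero_map_constH] at h0
  rw [constTerm] at hB ⊢
  rw [h0, Matrix.mul_nonsing_inv_cancel_right _ _ hB]

theorem constantCoeff_inv_constTerm {L : Matrix (Fin n) (Fin n) (QHRing r)} (hL : IsUnit L)
    (hL0 : L.map (qZeroH r) = 1) : ((constTerm L)⁻¹).map MvPolynomial.constantCoeff = 1 := by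
  have h1 := constantCoeff_constTerm hL0
  have h2 := congrArg (fun M : Matrix (Fin n) (Fin n) (QRing r) =>
    M.map MvPolynomial.constantCoeff) (Matrix.mul_nonsing_inv _
      ((Matrix.isUnit_iff_isUnit_det _).1 (isUnit_constTerm hL)))
  rwa [Matrix.map_mul, h1, one_mul, Matrix.map_one _ (map_zero _) (map_one _)] at h2

theorem qZero_cHat {B : Matrix (Fin n) (Fin n) (QRing r)}
    (hB : B⁻¹.map MvPolynomial.constantCoeff = 1) (j : Fin n) :
    qZero r (cHat m B j) = MvPolynomial.monomial (m j) 1 := by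
  have hent : ∀ k, MvPolynomial.constantCoeff (B⁻¹ k j) = (1 : Matrix (Fin n) (Fin n) ℂ) k j :=
    fun k => congrFun (congrFun hB k) j
  rw [cHat, map_sum, Finset.sum_eq_single j]
  · rw [qZero, MvPolynomial.map_monomial, hent, Matrix.one_apply_eq]
  · intro k _ hk
    rw [qZero, MvPolynomial.map_monomial, hent, Matrix.one_apply_ne hk, MvPolynomial.monomial_zero]
  · simp

theorem isHomog_cHat {B : Matrix (Fin n) (Fin n) (QRing r)} (hB : IsUnit B)
    (hw : ∀ a b d, (B a b).coeff d ≠ 0 → 2 * d.degree + (m a).degree = (m b).degree) (j : Fin n) :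
    IsHomog (cHat m B j) (2 * (m j).degree) :=
  isHomog_sum _ fun k _ => isHomog_monomial fun d hd => by
    have := coeff_inv_of_homogeneous hB hw k j d hd
    lia

end NormalizedFactor

end QuantumDModule

end

/-! ### The main theorem. -/

open QuantumDModule in
theorem theorem1p2 {r u s : ℕ}
    (R : Fin u → BQRing r) (σ : Fin u → BQHRing r) (hσ : IsQuantization R σ)
    (m : Fin (s + 1) → Fin r →₀ ℕ)
    (P : Module.Basis (Fin (s + 1)) (QHRing r) (Mh σ))
    (hP : ∀ j, P j = mhClass σ (hdMonomial (m j))) :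
    ∃ c : Module.Basis (Fin (s + 1)) (QRing r) (QH R),
      (∀ j, c j = qhClass R (MvPolynomial.monomial (m j) 1)) ∧
      -- every Birkhoff factorization yields a flat connection
      (∀ (U : Set (Fin r → ℂ)) (L Lm Lp : (Fin r → ℂ) → Circle →
          Matrix (Fin (s + 1)) (Fin (s + 1)) ℂ)
          (B₀ : (Fin r → ℂ) → Matrix (Fin (s + 1)) (Fin (s + 1)) ℂ),
        IsOpen U → IsBirkhoff (hOmega P) U L Lm Lp B₀ →
        (∀ i, ∀ t ∈ U, ∀ h : Circle,
          (Lm t h)⁻¹ * tPartial i (fun t' => Lm t' h) t = (h : ℂ)⁻¹ • omegaHat c B₀ i t) ∧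
        (∀ h : ℂ, h ≠ 0 → IsFlatOn U fun i t => h⁻¹ • omegaHat c B₀ i t) ∧
        (∀ i j, ∀ t ∈ U,
          tPartial i (omegaHat c B₀ j) t = tPartial j (omegaHat c B₀ i) t)) ∧
      -- the normalized factor and the quantum evaluation map
      ((∀ i, ∃ n, IsHomogH (σ i) n) →
        (∀ i, symbolQZero r (σ i) = MvPolynomial.map Polynomial.C (qZero r (R i))) →
        ∃ Lp : Matrix (Fin (s + 1)) (Fin (s + 1)) (QHRing r),
          IsUnit Lp ∧ Lp.map (qZeroH r) = 1 ∧
          IsPolynomialPlusFactor (hOmega P) Set.univ Lp ∧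
          (∀ (U : Set (Fin r → ℂ)) (Lp' : Matrix (Fin (s + 1)) (Fin (s + 1)) (QHRing r)),
            IsOpen U → U.Nonempty → Lp'.map (qZeroH r) = 1 →
            IsPolynomialPlusFactor (hOmega P) U Lp' → Lp' = Lp) ∧
          ∃ (c' : Module.Basis (Fin (s + 1)) (QRing r) (QH R)) (δ : QH R →ₗ[QRing r] HQ R),
            (∀ j, c' j = qhClass R (cHat m (constTerm Lp) j)) ∧
            (∀ j, δ (c' j) =
              hqClass R (constQ r (qZero r (cHat m (constTerm Lp) j)))) ∧
            IsQuantumEvaluation R δ ∧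
            (∀ i, mulMatrix c' i = constTerm Lp * mulMatrix c i * (constTerm Lp)⁻¹) ∧
            Integrability c') := by
  have hrank : s + 1 = Module.finrank ℂ (H R) := by
    rw [← hσ.rank, Module.finrank_eq_card_basis P, Fintype.card_fin]
  have hmul := mulMatrix_qhBasis hσ.limit hP
  have hcomm : ∀ i j, (hOmega P i).map (hZero r) * (hOmega P j).map (hZero r) =
      (hOmega P j).map (hZero r) * (hOmega P i).map (hZero r) := fun i j =>
    map_hZero_comm_of_flat (hOmega_flat P i j)
  refine ⟨qhBasis hσ.limit hP, qhBasis_apply hσ.limit hP, fun U L Lm Lp B₀ hU hB => ?_,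
    fun hhom hq => ?_⟩
  · have hhat : omegaHat (qhBasis hσ.limit hP) B₀ = gaugedLimit (hOmega P) B₀ := by
      funext i t
      rw [omegaHat, hmul, gaugedLimit]
    rw [hhat]
    exact ⟨fun i t ht h => hB.minus_gauge hU ht i h,
      fun h _ => hB.isFlatOn_gaugedLimit hU hcomm h⁻¹,
      fun i j t ht => hB.tPartial_gaugedLimit hU (hcomm i j) ht⟩
  · obtain ⟨L, W, hunit, hL0, hw, hWcomm, hWclosed, hgauge⟩ :=
      exists_normalized_factor hP hrank hhom hq
    have hB := isUnit_constTerm hunit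
    have hB0 := constantCoeff_inv_constTerm hunit hL0
    have hbasis := changeBasis_eq_qhClass (qhBasis hσ.limit hP) hB (qhBasis_apply hσ.limit hP)
    have hbH := hBasis_apply hq hP hrank
    -- The multiplication matrices in the new basis are the transformed connection itself, so
    -- closedness of W is the integrability condition.
    have hmulhat : ∀ i, mulMatrix (changeBasis (qhBasis hσ.limit hP) hB) i = W i := fun i => by
      rw [mulMatrix_changeBasis, hmul, conj_constTerm_of_gauge hunit (hgauge i)]
    have hR : ∀ i, ∃ N, IsHomog (R i) N := fun i => by
      obtain ⟨N, hN⟩ := hhom i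
      exact ⟨N, hσ.limit i ▸ isHomog_of_symbolHZero hN⟩
    refine ⟨L, hunit, hL0, isPolynomialPlusFactor_of_gauge hunit hWcomm hWclosed hgauge,
      fun U L' hU hne hL'0 hL' => hL'.eq_of_gauge hU hne hL'0 hunit hL0 hgauge,
      changeBasis (qhBasis hσ.limit hP) hB,
      (basisEvaluation (changeBasis (qhBasis hσ.limit hP) hB) (hBasis hq hP hrank) :
        QH R →ₗ[QRing r] HQ R), hbasis, fun j => ?_,
      isQuantumEvaluation_basisEvaluation hR hbasis (isHomog_cHat hB hw) (qZero_cHat hB0) hbH,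
      mulMatrix_changeBasis _ hB, fun i j => ?_⟩
    · rw [qZero_cHat hB0, hqClass_constQ, ← hbH]
      exact basisEvaluation_basis _ _ j
    · rw [hmulhat, hmulhat, hWclosed]
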